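/- Let $K$ be a field of characteristic $0$, and let $\mathfrak g$ and $V$ be vector spaces over $K$. **The Balavoine graded Lie algebra.** For a vector space $W$ put $C^n(W,W)=\mathrm{Hom}(\otimes^{n+1}W,W)$ for $n\ge 0$. For $P\in C^p(W,W)$, $Q\in C^q(W,W)$ let $[P,Q]_{\mathsf B}=P\bar\circ Q-(-1)^{pq}Q\bar\circ P\in C^{p+q}(W,W)$, where $P\bar\circ Q=\sum_{k=1}^{p+1}P\circ_kQ$ and $$(P\circ_kQ)(x_1,\dots,x_{p+q+1})=\sum_{\sigma}(-1)^{(k-1)q}(-1)^{\sigma}P\big(x_{\sigma(1)},\dots,x_{\sigma(k-1)},Q(x_{\sigma(k)},\dots,x_{\sigma(k+q-1)},x_{k+q}),x_{k+q+1},\dots,x_{p+q+1}\big),$$ the sum being over all $(k-1,q)$-shuffles $\sigma$. Let $W=\mathfrak g\oplus V$ and $L=\bigoplus_{n\ge0}C^n(\mathfrak g\oplus V,\mathfrak g\oplus V)$. A multilinear map on some of the summands $\mathfrak g,V$ with values in one of them is regarded as an element of $L$ by extending it by zero. In this way put $$\mathfrak h=\bigoplus_{n\ge0}\mathrm{Hom}(\otimes^{n+1}V,\mathfrak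 g)\subset L,\qquad L'=\bigoplus_{n\ge0}\big(\mathrm{Hom}(\wedge^{n+1}\mathfrak g,\mathfrak g)\oplus\mathrm{Hom}(\wedge^n\mathfrak g\otimes V,V)\big)\subset L,$$ and let $P:L\to L$ be the projection onto $\mathfrak h$ (restrict all arguments to $V$ and take the $\mathfrak g$-component of the value). **$L_\infty$-algebras.** An $L_\infty$-algebra is a $\mathbb Z$-graded vector space with linear maps $l_k$ ($k\ge1$) of degree $1$ from its $k$-th tensor power to itself that are graded symmetric and satisfy, for all $n\ge1$ and homogeneous $x_1,\dots,x_n$, $$\sum_{i=1}^n\sum_{\sigma}\varepsilon(\sigma;x_1,\dots,x_n)\,l_{n-i+1}(l_i(x_{\sigma(1)},\dots,x_{\sigma(i)}),x_{\sigma(i+1)},\dots,x_{\sigma(n)})=0,$$ where $\sigma$ runs over the $(i,n-i)$-shuffles and $\varepsilon$ is the Koszul sign. A Maurer–Cartan element is an element $\alpha$ of degree $0$ such that the sum $\sum_{k\ge1}\frac1{k!}l_k(\alpha,\dots,\alpha)$ has only finitely many nonzero terms and equals $0$. **V-data.** V-data $(L,\mathfrak h,P,\Delta)$ consist of a graded Lie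 algebra $L$, an abelian graded Lie subalgebra $\mathfrak h$, a degree-preserving linear map $P:L\to L$ with $P\circ P=P$ whose image is $\mathfrak h$ and whose kernel is a graded Lie subalgebra, and an element $\Delta\in\ker(P)$ of degree $1$ with $[\Delta,\Delta]=0$. **Theorem.** With the above $L$, $\mathfrak h$, $P$, and with $\Delta=0$, the quadruple $(L,\mathfrak h,P,\Delta)$ is V-data, and $L'$ is a graded Lie subalgebra of $L$. The graded vector space $s^{-1}L'\oplus\mathfrak h$ (whose part of degree $i$ is $(L')^{i+1}\oplus\mathfrak h^i$) is an $L_\infty$-algebra with Voronov's higher derived brackets $$l_1(s^{-1}Q,\theta)=P(Q),\qquad l_2(s^{-1}Q,s^{-1}Q')=(-1)^{|Q|}s^{-1}[Q,Q']_{\mathsf B},$$ $$l_k(s^{-1}Q,\theta_1,\dots,\theta_{k-1})=P[\cdots[[Q,\theta_1]_{\mathsf B},\theta_2]_{\mathsf B},\cdots,\theta_{k-1}]_{\mathsf B}\quad(k\ge2)$$ for homogeneous $Q,Q'\in L'$ and $\theta,\theta_i\in\mathfrak h$, all brackets not obtained from these by permuting arguments being zero (here $l_1=0$, since $P$ vanishes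 on $L'$). Moreover, let $\mu\in\mathrm{Hom}(\wedge^2\mathfrak g,\mathfrak g)$, $\rho\in\mathrm{Hom}(\mathfrak g\otimes V,V)$, $T\in\mathrm{Hom}(V,\mathfrak g)$, and let $\mu\boxplus\rho\in C^1(\mathfrak g\oplus V,\mathfrak g\oplus V)$ be given by $(\mu\boxplus\rho)((x,u),(y,v))=(\mu(x,y),\rho(x)v)$. Then $((\mathfrak g,\mu),(V;\rho),T)$ is a Lie–Leibniz triple, that is, $\mu$ is a Lie bracket on $\mathfrak g$, $\rho$ is a representation of the Lie algebra $(\mathfrak g,\mu)$ on $V$, and $\mu(Tu,Tv)=T(\rho(Tu)v)$ for all $u,v\in V$, if and only if $(s^{-1}(\mu\boxplus\rho),T)$ is a Maurer–Cartan element of this $L_\infty$-algebra $s^{-1}L'\oplus\mathfrak h$. -/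

import Mathlib

open scoped DirectSum

namespace LieLeibniz

section Signs

/-- The sign `(-1)^n ∈ {1, -1} ⊂ ℤ` of an integer `n`. -/
def negPow (n : ℤ) : ℤ := (n.negOnePow : ℤˣ)

/-- The `(i, j)`-shuffles: permutations of the first `i + j` of `N` letters that are increasing on
the first `i` letters and on the following `j` letters, extended by the identity to all `N`
letters. -/
def shuffles (N i j : ℕ) : Finset (Equiv.Perm (Fin N)) :=
  Finset.univ.filter fun σ =>
    (∀ a b : Fin N, a < b → (b : ℕ) < i → σ a < σ b) ∧
    (∀ a b : Fin N, i ≤ (a : ℕ) → a < b → (b : ℕ) < i + j → σ a < σ b) ∧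
    (∀ a : Fin N, i + j ≤ (a : ℕ) → σ a = a)

/-- The Koszul sign `ε(σ; v₁, …, vₙ)` for elements `v₁, …, vₙ` of degrees `d₁, …, dₙ`, determined
by `v₁ ⊙ ⋯ ⊙ vₙ = ε(σ; v₁, …, vₙ) v_{σ(1)} ⊙ ⋯ ⊙ v_{σ(n)}`: every pair of letters
whose order is reversed contributes `(-1)` to the product of their degrees. -/
def koszulSign {n : ℕ} (σ : Equiv.Perm (Fin n)) (d : Fin n → ℤ) : ℤ :=
  ∏ i : Fin n, ∏ j : Fin n,
    if i < j ∧ σ j < σ i then negPow (d (σ i) * d (σ j)) else 1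

end Signs

section General

variable {K : Type*} [Field K]

/-- `𝓛` and `br` make the vector space `L` a (`ℤ`-graded) graded Lie algebra. -/
structure IsGradedLieAlgebra {L : Type*} [AddCommGroup L] [Module K L]
    (𝓛 : ℤ → Submodule K L) (br : L →ₗ[K] L →ₗ[K] L) : Prop where
  internal : DirectSum.IsInternal 𝓛
  degree : ∀ (i j : ℤ) (x y : L), x ∈ 𝓛 i → y ∈ 𝓛 j → br x y ∈ 𝓛 (i + j)
  antisymm : ∀ (i j : ℤ) (x y : L), x ∈ 𝓛 i → y ∈ 𝓛 j →
    br x y = -(negPow (i * j) • br y x)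
  jacobi : ∀ (i j k : ℤ) (x y z : L), x ∈ 𝓛 i → y ∈ 𝓛 j → z ∈ 𝓛 k →
    br x (br y z) = br (br x y) z + negPow (i * j) • br y (br x z)

/-- `M` is a graded subspace of `L` that is closed under the bracket. -/
structure IsGradedLieSubalgebra {L : Type*} [AddCommGroup L] [Module K L]
    (𝓛 : ℤ → Submodule K L) (br : L →ₗ[K] L →ₗ[K] L) (M : Submodule K L) : Prop where
  graded : ⨆ i, M ⊓ 𝓛 i = M
  closed : ∀ x ∈ M, ∀ y ∈ M, br x y ∈ M

/-- `(L, 𝔥, P, Δ)` are V-data, `L` being the graded Lie algebra given by `𝓛` and `br`. -/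
structure IsVData {L : Type*} [AddCommGroup L] [Module K L]
    (𝓛 : ℤ → Submodule K L) (br : L →ₗ[K] L →ₗ[K] L) (𝔥 : Submodule K L)
    (P : L →ₗ[K] L) (Δ : L) : Prop where
  gradedLie : IsGradedLieAlgebra 𝓛 br
  subalgebra : IsGradedLieSubalgebra 𝓛 br 𝔥
  abelian : ∀ a ∈ 𝔥, ∀ b ∈ 𝔥, br a b = 0
  proj_degree : ∀ (i : ℤ) (x : L), x ∈ 𝓛 i → P x ∈ 𝓛 i
  proj_proj : P ∘ₗ P = P
  range_eq : LinearMap.range P = 𝔥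
  ker_subalgebra : IsGradedLieSubalgebra 𝓛 br (LinearMap.ker P)
  delta_ker : P Δ = 0
  delta_degree : Δ ∈ 𝓛 1
  delta_square : br Δ Δ = 0

/-- The iterated bracket `[⋯[[x, a₁], a₂], ⋯, aₙ]`. -/
def nested {L : Type*} [AddCommGroup L] [Module K L] (br : L →ₗ[K] L →ₗ[K] L) :
    (n : ℕ) → L → (Fin n → L) → L
  | 0, x, _ => x
  | n + 1, x, a => br (nested br n x (fun i => a i.castSucc)) (a (Fin.last n))

/-- The homogeneous components of `s⁻¹L' ⊕ 𝔥`, inside `L × L`. Here `(x, a)` stands for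
`(s⁻¹x, a)`; it has degree `i` when `x` has degree `i + 1` and `a` has degree `i` in `L`. -/
def desuspSum {L : Type*} [AddCommGroup L] [Module K L] (𝓛 : ℤ → Submodule K L)
    (L' 𝔥 : Submodule K L) (i : ℤ) : Submodule K (L × L) :=
  (L' ⊓ 𝓛 (i + 1)).prod (𝔥 ⊓ 𝓛 i)

/-- Voronov's higher derived brackets `l_k(e₁, …, e_k)`, for elements `e_i = (s⁻¹x_i, a_i)` of
`s⁻¹L ⊕ 𝔥` that are homogeneous of degrees `d₁, …, d_k`. The nonzero values are
* `l₁(s⁻¹x, a) = (-s⁻¹[Δ, x], P(x + [Δ, a]))`,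
* `l₂(s⁻¹x, s⁻¹y) = (-1)^{|x|} s⁻¹[x, y]`,
* `l_k(s⁻¹x, a₁, …, a_{k-1}) = P[⋯[[x, a₁], a₂], ⋯, a_{k-1}]` for `k ≥ 2`,
* `l_k(a₁, …, a_k) = P[⋯[[Δ, a₁], a₂], ⋯, a_k]` for `k ≥ 2`,
and the values obtained from these by permuting the arguments: bringing `s⁻¹x_j` from the
`j`-th place to the first one costs the Koszul sign `(-1)^{d_j (d₁ + ⋯ + d_{j-1})}`. -/
def voronovBracket {L : Type*} [AddCommGroup L] [Module K L] (br : L →ₗ[K] L →ₗ[K] L)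
    (P : L →ₗ[K] L) (Δ : L) : (k : ℕ) → (Fin k → ℤ) → (Fin k → L × L) → L × L
  | 0, _, _ => 0
  | n + 1, d, e =>
    ((match n, d, e with
      | 0, _, e => -br Δ (e 0).1
      | 1, d, e => negPow (d 0 + 1) • br (e 0).1 (e 1).1
      | _ + 2, _, _ => 0),
     P (nested br (n + 1) Δ fun i => (e i).2) +
       ∑ j : Fin (n + 1), negPow (d j * ∑ i ∈ Finset.Iio j, d i) •
         P (nested br n (e j).1 fun i => (e (j.succAbove i)).2))

/-- An `L_∞`-algebra structure on the graded vector space `M = ⨁ᵢ 𝒜 i`, a subspace of `E`.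

The linear maps `l_k : ⊗ᵏ M → M`, `k ≥ 1`, are given by their restrictions to the summands
`𝒜 (d₁) ⊗ ⋯ ⊗ 𝒜 (d_k)`: the value on homogeneous elements `x₁, …, x_k` of degrees
`d₁, …, d_k` is `l k d x`. The values of `l` on other tuples play no role. -/
structure IsLInfinityAlgebra {E : Type*} [AddCommGroup E] [Module K E] (M : Submodule K E)
    (𝒜 : ℤ → Submodule K E) (l : (k : ℕ) → (Fin k → ℤ) → (Fin k → E) → E) : Prop where
  independent : iSupIndep 𝒜
  iSup_eq : ⨆ i, 𝒜 i = M
  multilinear : ∀ (k : ℕ) (d : Fin k → ℤ), 1 ≤ k →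
    ∃ m : MultilinearMap K (fun i => 𝒜 (d i)) E, ∀ x, m x = l k d fun i => (x i : E)
  degree : ∀ (k : ℕ) (d : Fin k → ℤ) (x : Fin k → E), 1 ≤ k → (∀ i, x i ∈ 𝒜 (d i)) →
    l k d x ∈ 𝒜 (∑ i, d i + 1)
  symmetric : ∀ (k : ℕ) (d : Fin k → ℤ) (x : Fin k → E) (σ : Equiv.Perm (Fin k)), 1 ≤ k →
    (∀ i, x i ∈ 𝒜 (d i)) →
    l k (fun i => d (σ i)) (fun i => x (σ i)) = koszulSign σ d • l k d x
  /-- The inner bracket has `i + 1` arguments, the outer one `n - i`, for `0 ≤ i < n`. -/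
  jacobi : ∀ (n : ℕ) (d : Fin n → ℤ) (x : Fin n → E), 1 ≤ n → (∀ i, x i ∈ 𝒜 (d i)) →
    ∑ i : Fin n, ∑ σ ∈ shuffles n (i + 1) (n - (i + 1)),
      koszulSign σ d •
        l (n - (i + 1) + 1)
          (Fin.cons (∑ a : Fin (i + 1), d (σ ⟨a, by omega⟩) + 1)
            fun b : Fin (n - (i + 1)) => d (σ ⟨i + 1 + b, by omega⟩))
          (Fin.cons
            (l (i + 1) (fun a => d (σ ⟨a, by omega⟩)) (fun a => x (σ ⟨a, by omega⟩)))
            fun b : Fin (n - (i + 1)) => x (σ ⟨i + 1 + b, by omega⟩)) = 0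

/-- Maurer–Cartan elements: elements `α` of degree `0` such that the series
`∑_{k ≥ 1} (1/k!) l_k(α, …, α)` has only finitely many nonzero terms and its sum is `0`. -/
def IsMaurerCartan {E : Type*} [AddCommGroup E] [Module K E]
    (𝒜 : ℤ → Submodule K E) (l : (k : ℕ) → (Fin k → ℤ) → (Fin k → E) → E) (α : E) : Prop :=
  α ∈ 𝒜 0 ∧
  (Function.support fun k : ℕ =>
    ((Nat.factorial (k + 1) : K)⁻¹) • l (k + 1) (fun _ => 0) (fun _ => α)).Finite ∧
  ∑ᶠ k : ℕ, ((Nat.factorial (k + 1) : K)⁻¹) • l (k + 1) (fun _ => 0) (fun _ => α) = 0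

end General

section Balavoine

variable (K : Type*) [Field K] (W : Type*) [AddCommGroup W] [Module K W]

/-- `Cⁿ(W, W) = Hom(⊗ⁿ⁺¹ W, W)`. -/
abbrev Cochain (n : ℕ) : Type _ := MultilinearMap K (fun _ : Fin (n + 1) => W) W

/-- `C^•(W, W) = ⨁ₙ Cⁿ(W, W)`. -/
abbrev Cochains : Type _ := ⨁ n : ℕ, Cochain K W n

/-- The homogeneous component of degree `i` of `C^•(W, W)`; it is zero for `i < 0`. -/
def cochainGrading (i : ℤ) : Submodule K (Cochains K W) where
  carrier := {f | ∀ n : ℕ, (n : ℤ) ≠ i → f n = 0}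
  add_mem' := fun hf hg n hn => by simp [DirectSum.add_apply, hf n hn, hg n hn]
  zero_mem' := fun n _ => by simp
  smul_mem' := fun c f hf n hn => by simp [DirectSum.smul_apply, hf n hn]

variable {K W}

set_option linter.unusedSectionVars false

/-- The arguments `(x₀, …, x_{k-1}, y, x_{k+q+1}, …, x_{p+q})`. -/
def outerArgs {p : ℕ} (q : ℕ) (k : Fin (p + 1)) (x : Fin (p + q + 1) → W) (y : W) :
    Fin (p + 1) → W := fun i =>
  if i < k then x ⟨i, by omega⟩ else if i = k then y else x ⟨i + q, by omega⟩

/-- The arguments `(x_k, …, x_{k+q})`. -/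
def innerArgs {p : ℕ} (q : ℕ) (k : Fin (p + 1)) (x : Fin (p + q + 1) → W) :
    Fin (q + 1) → W := fun j => x ⟨k + j, by omega⟩

theorem outerArgs_eq_update {p : ℕ} (q : ℕ) (k : Fin (p + 1)) (x : Fin (p + q + 1) → W)
    (y z : W) : outerArgs q k x y = Function.update (outerArgs q k x z) k y := by
  funext i
  by_cases h : i = k
  · subst h; simp [outerArgs]
  · simp [outerArgs, h]

theorem args_update {p : ℕ} (q : ℕ) (k : Fin (p + 1)) (m : Fin (p + q + 1)) :
    (∃ i : Fin (p + 1), ∀ (x : Fin (p + q + 1) → W) (z y : W),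
      innerArgs q k (Function.update x m z) = innerArgs q k x ∧
      outerArgs q k (Function.update x m z) y = Function.update (outerArgs q k x y) i z) ∨
    (∃ j : Fin (q + 1), ∀ (x : Fin (p + q + 1) → W) (z y : W),
      innerArgs q k (Function.update x m z) = Function.update (innerArgs q k x) j z ∧
      outerArgs q k (Function.update x m z) y = outerArgs q k x y) := by
  rcases lt_or_ge (m : ℕ) (k : ℕ) with h1 | h1
  · refine Or.inl ⟨⟨m, by omega⟩, fun x z y => ⟨?_, ?_⟩⟩
    · funext j
      simp only [innerArgs, Function.update_apply, Fin.ext_iff]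
      rw [if_neg (by omega)]
    · funext i
      simp only [outerArgs, Function.update_apply, Fin.ext_iff, Fin.lt_def]
      split_ifs <;> first | rfl | omega
  · rcases le_or_gt (m : ℕ) (k + q) with h2 | h2
    · refine Or.inr ⟨⟨m - k, by omega⟩, fun x z y => ⟨?_, ?_⟩⟩
      · funext j
        simp only [innerArgs, Function.update_apply, Fin.ext_iff]
        split_ifs <;> first | rfl | omega
      · funext i
        simp only [outerArgs, Function.update_apply, Fin.ext_iff, Fin.lt_def]
        split_ifs <;> first | rfl | omega
    · refine Or.inl ⟨⟨m - q, by omega⟩, fun x z y => ⟨?_, ?_⟩⟩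
      · funext j
        simp only [innerArgs, Function.update_apply, Fin.ext_iff]
        rw [if_neg (by omega)]
      · funext i
        simp only [outerArgs, Function.update_apply, Fin.ext_iff, Fin.lt_def]
        split_ifs <;> first | rfl | omega

/-- `(x₀, …, x_{p+q}) ↦ f(x₀, …, x_{k-1}, g(x_k, …, x_{k+q}), x_{k+q+1}, …, x_{p+q})`. -/
def insertAt {p q : ℕ} (k : Fin (p + 1)) (f : Cochain K W p) (g : Cochain K W q) :
    Cochain K W (p + q) :=
  MultilinearMap.mk' (fun x => f (outerArgs q k x (g (innerArgs q k x))))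
    (fun x m y z => by
      rcases args_update (W := W) q k m with ⟨i, h⟩ | ⟨j, h⟩
      · have hi := fun x z => (h x z 0).1
        have ho := fun x z y => (h x z y).2
        simp only [hi, ho, MultilinearMap.map_update_add]
      · have hi := fun x z => (h x z 0).1
        have ho := fun x z y => (h x z y).2
        simp only [hi, ho, MultilinearMap.map_update_add]
        rw [outerArgs_eq_update q k x _ 0, MultilinearMap.map_update_add,
          ← outerArgs_eq_update, ← outerArgs_eq_update])
    (fun x m c y => by
      rcases args_update (W := W) q k m with ⟨i, h⟩ | ⟨j, h⟩
      · have hi := fun x z => (h x z 0).1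
        have ho := fun x z y => (h x z y).2
        simp only [hi, ho, MultilinearMap.map_update_smul]
      · have hi := fun x z => (h x z 0).1
        have ho := fun x z y => (h x z y).2
        simp only [hi, ho, MultilinearMap.map_update_smul]
        rw [outerArgs_eq_update q k x _ 0, MultilinearMap.map_update_smul,
          ← outerArgs_eq_update])

/-- The operation `f ∘_{k+1} g` for `0 ≤ k ≤ p` (indices start from `0` here), that is
`∑_σ (-1)^{kq} (-1)^σ f(x_{σ(0)}, …, x_{σ(k-1)}, g(x_{σ(k)}, …, x_{σ(k+q-1)}, x_{k+q}),
x_{k+q+1}, …, x_{p+q})`, summed over the `(k, q)`-shuffles `σ`. -/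
def circAt {p q : ℕ} (k : Fin (p + 1)) (f : Cochain K W p) (g : Cochain K W q) :
    Cochain K W (p + q) :=
  ∑ σ ∈ shuffles (p + q + 1) k q,
    (negPow ((k : ℤ) * q) * (Equiv.Perm.sign σ : ℤ)) • (insertAt k f g).domDomCongr σ

/-- `f ∘̄ g = ∑_{k=1}^{p+1} f ∘_k g`. -/
def circ {p q : ℕ} (f : Cochain K W p) (g : Cochain K W q) : Cochain K W (p + q) :=
  ∑ k : Fin (p + 1), circAt k f g

theorem insertAt_apply {p q : ℕ} (k : Fin (p + 1)) (f : Cochain K W p) (g : Cochain K W q)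
    (x : Fin (p + q + 1) → W) :
    insertAt k f g x = f (outerArgs q k x (g (innerArgs q k x))) := rfl

theorem circ_apply {p q : ℕ} (f : Cochain K W p) (g : Cochain K W q)
    (x : Fin (p + q + 1) → W) :
    circ f g x = ∑ k : Fin (p + 1), ∑ σ ∈ shuffles (p + q + 1) k q,
      (negPow ((k : ℤ) * q) * (Equiv.Perm.sign σ : ℤ)) •
        f (outerArgs q k (fun i => x (σ i)) (g (innerArgs q k fun i => x (σ i)))) := by
  simp [circ, circAt, insertAt_apply]

variable (K W)

/-- `f ∘̄ g` as a bilinear operation on homogeneous cochains. -/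
def circBilin (p q : ℕ) : Cochain K W p →ₗ[K] Cochain K W q →ₗ[K] Cochain K W (p + q) :=
  LinearMap.mk₂ K circ
    (fun f f' g => by
      ext x; simp [circ_apply, Finset.sum_add_distrib])
    (fun c f g => by
      ext x; simp [circ_apply, Finset.smul_sum, smul_comm c])
    (fun f g g' => by
      ext x
      simp only [circ_apply, add_apply, ← Finset.sum_add_distrib, ← smul_add]
      refine Finset.sum_congr rfl fun k _ => Finset.sum_congr rfl fun σ _ => ?_
      rw [outerArgs_eq_update q k _ _ 0, MultilinearMap.map_update_add,
        ← outerArgs_eq_update, ← outerArgs_eq_update])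
    (fun c f g => by
      ext x
      simp only [circ_apply, smul_apply, Finset.smul_sum, smul_comm c]
      refine Finset.sum_congr rfl fun k _ => Finset.sum_congr rfl fun σ _ => ?_
      rw [outerArgs_eq_update q k _ _ 0, MultilinearMap.map_update_smul,
        ← outerArgs_eq_update])

theorem circBilin_apply (p q : ℕ) (f : Cochain K W p) (g : Cochain K W q) :
    circBilin K W p q f g = circ f g := rfl

/-- The Balavoine bracket `C^p × C^q → C^•(W, W)`. -/
def balavoineComponent (p q : ℕ) :
    Cochain K W p →ₗ[K] Cochain K W q →ₗ[K] Cochains K W :=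
  LinearMap.mk₂ K
    (fun f g => DirectSum.lof K ℕ (Cochain K W) (p + q) (circ f g) -
      negPow ((p : ℤ) * q) • DirectSum.lof K ℕ (Cochain K W) (q + p) (circ g f))
    (fun f f' g => by simp only [← circBilin_apply, map_add, LinearMap.add_apply, smul_add]; abel)
    (fun c f g => by
      simp only [← circBilin_apply, map_smul, LinearMap.smul_apply, smul_sub, smul_comm c])
    (fun f g g' => by simp only [← circBilin_apply, map_add, LinearMap.add_apply, smul_add]; abel)
    (fun c f g => by
      simp only [← circBilin_apply, map_smul, LinearMap.smul_apply, smul_sub, smul_comm c])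

/-- The Balavoine bracket on `C^•(W, W)`: for `f ∈ C^p` and `g ∈ C^q` it is
`[f, g] = f ∘̄ g - (-1)^{pq} g ∘̄ f`. -/
def balavoineBracket : Cochains K W →ₗ[K] Cochains K W →ₗ[K] Cochains K W :=
  DirectSum.toModule K ℕ _ fun p => LinearMap.flip <| DirectSum.toModule K ℕ _ fun q =>
    LinearMap.flip (balavoineComponent K W p q)

theorem balavoineBracket_lof (p q : ℕ) (f : Cochain K W p) (g : Cochain K W q) :
    balavoineBracket K W (DirectSum.lof K ℕ (Cochain K W) p f)
      (DirectSum.lof K ℕ (Cochain K W) q g) =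
    DirectSum.lof K ℕ (Cochain K W) (p + q) (circ f g) -
      negPow ((p : ℤ) * q) • DirectSum.lof K ℕ (Cochain K W) (q + p) (circ g f) := by
  simp [balavoineBracket, balavoineComponent]

end Balavoine

section Triples

variable {K : Type*} [Field K] {𝔤 : Type*} [AddCommGroup 𝔤] [Module K 𝔤]
  {V : Type*} [AddCommGroup V] [Module K V]

/-- `((𝔤, μ), (V; ρ), T)` is a Lie–Leibniz triple: `μ` is a Lie bracket on `𝔤` (an alternating
map satisfying the Jacobi identity), `ρ` is a representation of `(𝔤, μ)` on `V`, and `T` is an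
embedding tensor. -/
structure IsLieLeibnizTriple (μ : 𝔤 [⋀^Fin 2]→ₗ[K] 𝔤) (ρ : 𝔤 →ₗ[K] Module.End K V)
    (T : V →ₗ[K] 𝔤) : Prop where
  jacobi : ∀ x y z : 𝔤, μ ![x, μ ![y, z]] = μ ![μ ![x, y], z] + μ ![y, μ ![x, z]]
  rep : ∀ x y : 𝔤, ρ (μ ![x, y]) = ρ x ∘ₗ ρ y - ρ y ∘ₗ ρ x
  embedding : ∀ u v : V, μ ![T u, T v] = T (ρ (T u) v)

/-- The map `(μ ⊞ ρ)((x, u), (y, v)) = (μ(x, y), ρ(x)v)`. -/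
def boxPlus (μ : 𝔤 [⋀^Fin 2]→ₗ[K] 𝔤) (ρ : 𝔤 →ₗ[K] Module.End K V) : Cochain K (𝔤 × V) 1 :=
  MultilinearMap.mk' (fun w => (μ ![(w 0).1, (w 1).1], ρ (w 0).1 (w 1).2))
    (fun w i a b => by
      have h0 := fun u v x => μ.map_vecCons_add ![x] u v
      have h1 := fun u v x => μ.map_update_add ![x, 0] 1 u v
      have h2 : ∀ x y : 𝔤, Function.update ![x, 0] 1 y = ![x, y] := fun x y => by
        funext t; fin_cases t <;> rfl
      simp only [h2] at h1
      fin_cases i <;> simp [h0, h1])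
    (fun w i c a => by
      have h0 := fun u x => μ.map_vecCons_smul ![x] c u
      have h1 := fun u x => μ.map_update_smul ![x, 0] 1 c u
      have h2 : ∀ x y : 𝔤, Function.update ![x, 0] 1 y = ![x, y] := fun x y => by
        funext t; fin_cases t <;> rfl
      simp only [h2] at h1
      fin_cases i <;> simp [h0, h1])

variable (K 𝔤 V)

/-- The horizontal lift `Hom(⊗ⁿ⁺¹ V, 𝔤) → Cⁿ(𝔤 ⊕ V, 𝔤 ⊕ V)`,
`ĉ((x₀, v₀), …, (xₙ, vₙ)) = (c(v₀, …, vₙ), 0)`. -/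
def liftH (n : ℕ) :
    MultilinearMap K (fun _ : Fin (n + 1) => V) 𝔤 →ₗ[K] Cochain K (𝔤 × V) n where
  toFun c := (LinearMap.inl K 𝔤 V).compMultilinearMap
    (c.compLinearMap fun _ => LinearMap.snd K 𝔤 V)
  map_add' _ _ := by ext <;> simp
  map_smul' _ _ := by ext <;> simp

/-- `𝔥 = ⨁ₙ Hom(⊗ⁿ⁺¹ V, 𝔤)`, as a subspace of `C^•(𝔤 ⊕ V, 𝔤 ⊕ V)`. -/
def subspaceH : Submodule K (Cochains K (𝔤 × V)) where
  carrier := {f | ∀ n, f n ∈ LinearMap.range (liftH K 𝔤 V n)}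
  add_mem' := fun hf hg n => by
    rw [DirectSum.add_apply]; exact Submodule.add_mem _ (hf n) (hg n)
  zero_mem' := fun n => by rw [DirectSum.zero_apply]; exact Submodule.zero_mem _
  smul_mem' := fun c f hf n => by
    rw [DirectSum.smul_apply]; exact Submodule.smul_mem _ c (hf n)

/-- The projection of `Cⁿ(𝔤 ⊕ V, 𝔤 ⊕ V)` onto `Hom(⊗ⁿ⁺¹ V, 𝔤)`: restrict the arguments to `V`
and take the `𝔤`-component of the value. -/
def projHComponent (n : ℕ) : Cochain K (𝔤 × V) n →ₗ[K] Cochain K (𝔤 × V) n where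
  toFun f := liftH K 𝔤 V n <| (LinearMap.fst K 𝔤 V).compMultilinearMap
    (f.compLinearMap fun _ => LinearMap.inr K 𝔤 V)
  map_add' _ _ := by ext <;> simp [liftH]
  map_smul' _ _ := by ext <;> simp [liftH]

/-- The projection `P` of `C^•(𝔤 ⊕ V, 𝔤 ⊕ V)` onto `𝔥`. -/
def projH : Cochains K (𝔤 × V) →ₗ[K] Cochains K (𝔤 × V) :=
  DirectSum.lmap (projHComponent K 𝔤 V)

/-- The horizontal lift of `(f, φ) ∈ Hom(⋀ⁿ⁺¹ 𝔤, 𝔤) ⊕ Hom(⋀ⁿ 𝔤 ⊗ V, V)` to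
`Cⁿ(𝔤 ⊕ V, 𝔤 ⊕ V)`: `((x₀, v₀), …, (xₙ, vₙ)) ↦ (f(x₀, …, xₙ), φ(x₀, …, x_{n-1}) vₙ)`. -/
def liftL (n : ℕ) :
    (𝔤 [⋀^Fin (n + 1)]→ₗ[K] 𝔤) × (𝔤 [⋀^Fin n]→ₗ[K] Module.End K V) →ₗ[K]
      Cochain K (𝔤 × V) n where
  toFun fφ :=
    (LinearMap.inl K 𝔤 V).compMultilinearMap
      (fφ.1.toMultilinearMap.compLinearMap fun _ => LinearMap.fst K 𝔤 V) +
    (LinearMap.inr K 𝔤 V).compMultilinearMap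
      ((LinearMap.lcomp K V (LinearMap.snd K 𝔤 V)).compMultilinearMap
        (fφ.2.toMultilinearMap.compLinearMap fun _ => LinearMap.fst K 𝔤 V)).uncurryRight
  map_add' _ _ := by ext <;> simp
  map_smul' _ _ := by ext <;> simp

theorem liftL_apply (n : ℕ) (f : 𝔤 [⋀^Fin (n + 1)]→ₗ[K] 𝔤)
    (φ : 𝔤 [⋀^Fin n]→ₗ[K] Module.End K V) (w : Fin (n + 1) → 𝔤 × V) :
    liftL K 𝔤 V n (f, φ) w =
      (f fun i => (w i).1, φ (fun i => (w i.castSucc).1) (w (Fin.last n)).2) := by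
  ext <;> simp [liftL, Fin.init]

/-- `L' = ⨁ₙ (Hom(⋀ⁿ⁺¹ 𝔤, 𝔤) ⊕ Hom(⋀ⁿ 𝔤 ⊗ V, V))`, as a subspace of
`C^•(𝔤 ⊕ V, 𝔤 ⊕ V)`. -/
def subspaceL' : Submodule K (Cochains K (𝔤 × V)) where
  carrier := {f | ∀ n, f n ∈ LinearMap.range (liftL K 𝔤 V n)}
  add_mem' := fun hf hg n => by
    rw [DirectSum.add_apply]; exact Submodule.add_mem _ (hf n) (hg n)
  zero_mem' := fun n => by rw [DirectSum.zero_apply]; exact Submodule.zero_mem _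
  smul_mem' := fun c f hf n => by
    rw [DirectSum.smul_apply]; exact Submodule.smul_mem _ c (hf n)

/-- The graded vector space `s⁻¹L' ⊕ 𝔥`, by its homogeneous components. -/
def controllingGrading : ℤ → Submodule K (Cochains K (𝔤 × V) × Cochains K (𝔤 × V)) :=
  desuspSum (cochainGrading K (𝔤 × V)) (subspaceL' K 𝔤 V) (subspaceH K 𝔤 V)

/-- The brackets of the controlling algebra of Lie–Leibniz triples: Voronov's higher derived
brackets for the Balavoine bracket, the projection onto `𝔥`, and `Δ = 0`. -/
def controllingBracket : (k : ℕ) → (Fin k → ℤ) →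
    (Fin k → Cochains K (𝔤 × V) × Cochains K (𝔤 × V)) →
      Cochains K (𝔤 × V) × Cochains K (𝔤 × V) :=
  voronovBracket (balavoineBracket K (𝔤 × V)) (projH K 𝔤 V) 0

variable {K 𝔤 V}

/-- The element `(s⁻¹(μ ⊞ ρ), T)`; here `μ ⊞ ρ ∈ C¹(𝔤 ⊕ V, 𝔤 ⊕ V)` and `T ∈ Hom(V, 𝔤)`. -/
def tripleElement (μ : 𝔤 [⋀^Fin 2]→ₗ[K] 𝔤) (ρ : 𝔤 →ₗ[K] Module.End K V) (T : V →ₗ[K] 𝔤) :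
    Cochains K (𝔤 × V) × Cochains K (𝔤 × V) :=
  (DirectSum.lof K ℕ (Cochain K (𝔤 × V)) 1 (boxPlus μ ρ),
   DirectSum.lof K ℕ (Cochain K (𝔤 × V)) 0
    (liftH K 𝔤 V 0 (MultilinearMap.ofSubsingleton (ι := Fin 1) K V 𝔤 0 T)))

end Triples

end LieLeibniz

open LieLeibniz

namespace LieLeibniz

/-! ### Signs and Koszul signs. -/

section SignLemmas

/-! The combinatorial device is to turn every signed sum over shuffles into a recursion on lists. In
a shuffle the smallest letter stands at the head of one of the two blocks, and deleting it leaves a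
shuffle of the remaining letters (`sum_shuffles_succ`). The Koszul-signed shuffle sums thus become
`shl` and `shsum`, and the operation `∘̄` becomes `circL`; sign identities are then proved by
induction on a list, one letter at a time.

The Balavoine bracket is the graded commutator of `∘̄`. The associator of `∘̄` is graded symmetric
in its last two arguments (`circL_preLie`), and for such a pre-Lie product the commutator satisfies
the graded Jacobi identity. The subspace `𝔥` is abelian because a cochain in it takes values in `𝔤`
but reads only `V`-components; `ker P` consists of the cochains that send tuples from `V` into `V`,
and these are stable under composition. For `L'` to be closed, its components are characterised by
the conditions `IsLieType`, which `circL` preserves.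

The `L_∞`-relations hold for arbitrary V-data with `Δ = 0` and any graded Lie subalgebra `L'`, by
Voronov's argument. Their `s⁻¹L'`-part is the graded Jacobi identity for three elements. In the
`𝔥`-part each term contains exactly two elements of `L'`, and the terms with a given pair cancel
(`proj_nestL_jacobi`). This rests on three facts: bracketing with elements of `𝔥` obeys the Leibniz
rule (`nestL_bracket`), such brackets graded-commute as `𝔥` is abelian, and `P[p, q] = P[Pp, q] +
P[p, Pq]` (`IsVData.proj_bracket`).

For the Maurer–Cartan equation of `(s⁻¹(μ ⊞ ρ), T)` only two brackets matter. The term with `l₂` is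
`-s⁻¹((μ ⊞ ρ) ∘̄ (μ ⊞ ρ))`, which vanishes exactly when `μ` satisfies Jacobi and `ρ` is a
representation. The term with `l₃` is `(u, v) ↦ μ(Tu, Tv) - T(ρ(Tu)v)`. All other terms are zero,
since three brackets with `T` kill `μ ⊞ ρ`. The two terms lie in different summands, so they must
vanish separately. -/

theorem negPow_zero : negPow 0 = 1 := by simp [negPow]

theorem negPow_one : negPow 1 = -1 := by simp [negPow]

theorem negPow_add (a b : ℤ) : negPow (a + b) = negPow a * negPow b := by
  simp [negPow, Int.negOnePow_add]

theorem negPow_congr {a b : ℤ} (h : Even (a - b)) : negPow a = negPow b := by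
  unfold negPow
  rw [(Int.negOnePow_eq_iff a b).2 h]

theorem negPow_mul_self (a : ℤ) : negPow a * negPow a = 1 := by
  rw [← negPow_add, negPow_congr (b := 0) (by simp), negPow_zero]

theorem negPow_sum {ι : Type*} (s : Finset ι) (f : ι → ℤ) :
    negPow (∑ i ∈ s, f i) = ∏ i ∈ s, negPow (f i) := by
  classical
  induction s using Finset.induction_on with
  | empty => simp [negPow_zero]
  | insert a s ha ih => rw [Finset.sum_insert ha, Finset.prod_insert ha, negPow_add, ih]

theorem negPow_smul_negPow_smul {E : Type*} [AddCommGroup E] (a b : ℤ) (v : E) :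
    negPow a • negPow b • v = negPow (a + b) • v := by
  rw [negPow_add, mul_smul]

theorem negPow_smul_self {E : Type*} [AddCommGroup E] (a : ℤ) (v : E) :
    negPow a • negPow a • v = v := by
  rw [← mul_smul, negPow_mul_self, one_smul]

theorem koszulSign_one {n : ℕ} (d : Fin n → ℤ) : koszulSign (1 : Equiv.Perm (Fin n)) d = 1 := by
  unfold koszulSign
  refine Finset.prod_eq_one fun i _ => Finset.prod_eq_one fun j _ => if_neg ?_
  simp only [Equiv.Perm.coe_one, id_eq, not_and, not_lt]
  exact fun h => h.le

/-- In degree one each inversion contributes `-1`. Through this the sign of a permutation in `circ`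
is a special Koszul sign, and the same list recursion serves both `∘̄` and the `L_∞`-relations. -/
theorem koszulSign_const_one {n : ℕ} (σ : Equiv.Perm (Fin n)) :
    koszulSign σ (fun _ => 1) = (Equiv.Perm.sign σ : ℤ) := by
  rw [Equiv.Perm.sign_eq_prod_prod_Ioi, koszulSign]
  push_cast
  refine Finset.prod_congr rfl fun i _ => ?_
  rw [← Finset.prod_subset (Finset.subset_univ (Finset.Ioi i))]
  · refine Finset.prod_congr rfl fun j hj => ?_
    have hij : i < j := Finset.mem_Ioi.1 hj
    have hne : σ i ≠ σ j := fun h => hij.ne (σ.injective h)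
    by_cases h : σ i < σ j
    · simp [hij, h, not_lt_of_gt h]
    · have h' : σ j < σ i := lt_of_le_of_ne (not_lt.1 h) hne.symm
      simp [hij, h, h', negPow_one]
  · intro j _ hj
    rw [if_neg]
    intro h
    exact hj (Finset.mem_Ioi.2 h.1)

end SignLemmas

/-! ### Removing the smallest letter from a shuffle. -/

section PermDecomposition

/-- The permutation sending `p` to `0` and acting as `σ` on the remaining letters. -/
def insPerm {N : ℕ} (p : Fin (N + 1)) (σ : Equiv.Perm (Fin N)) : Equiv.Perm (Fin (N + 1)) :=
  Equiv.Perm.decomposeFin.symm (0, σ) * p.cycleRange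

@[simp] theorem insPerm_self {N : ℕ} (p : Fin (N + 1)) (σ : Equiv.Perm (Fin N)) :
    insPerm p σ p = 0 := by
  simp [insPerm]

@[simp] theorem insPerm_succAbove {N : ℕ} (p : Fin (N + 1)) (σ : Equiv.Perm (Fin N))
    (a : Fin N) : insPerm p σ (p.succAbove a) = (σ a).succ := by
  simp [insPerm]

theorem insPerm_injective {N : ℕ} (p : Fin (N + 1)) : Function.Injective (insPerm p) := by
  intro σ τ h
  ext a
  have := congrArg (fun f : Equiv.Perm (Fin (N + 1)) => f (p.succAbove a)) h
  simpa using congrArg Fin.val this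

theorem exists_insPerm {N : ℕ} (σ : Equiv.Perm (Fin (N + 1))) (p : Fin (N + 1)) (h : σ p = 0) :
    ∃ τ, insPerm p τ = σ := by
  have h0 : (Equiv.Perm.decomposeFin (σ * p.cycleRange⁻¹)).1 = 0 := by
    have h1 : (σ * p.cycleRange⁻¹) 0 = 0 := by
      have : p.cycleRange⁻¹ 0 = p := by
        rw [Equiv.Perm.inv_eq_iff_eq]; simp
      rw [Equiv.Perm.mul_apply, this, h]
    obtain ⟨⟨a, τ⟩, hτ⟩ := Equiv.Perm.decomposeFin.symm.surjective (σ * p.cycleRange⁻¹)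
    rw [← hτ] at h1 ⊢
    simpa using h1
  refine ⟨(Equiv.Perm.decomposeFin (σ * p.cycleRange⁻¹)).2, ?_⟩
  unfold insPerm
  rw [← h0, Prod.mk.eta, Equiv.symm_apply_apply]
  simp

/-- The letter `0` is inverted with exactly those letters standing before position `p`; the
inversions among the other letters are those of `σ`. -/
theorem koszulSign_insPerm {N : ℕ} (p : Fin (N + 1)) (σ : Equiv.Perm (Fin N))
    (d : Fin (N + 1) → ℤ) :
    koszulSign (insPerm p σ) d =
      negPow (d 0 * ∑ a : Fin N, if a.castSucc < p then d (σ a).succ else 0) *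
        koszulSign σ (fun i => d i.succ) := by
  unfold koszulSign
  rw [Fin.prod_univ_succAbove _ p]
  rw [Finset.prod_eq_one (fun j _ => if_neg (by simp)), one_mul]
  have : ∀ a : Fin N, (∏ j : Fin (N + 1),
      if p.succAbove a < j ∧ insPerm p σ j < insPerm p σ (p.succAbove a) then
        negPow (d (insPerm p σ (p.succAbove a)) * d (insPerm p σ j)) else 1) =
      negPow (d 0 * if a.castSucc < p then d (σ a).succ else 0) *
        ∏ b : Fin N, if a < b ∧ σ b < σ a then negPow (d (σ a).succ * d (σ b).succ) else 1 := by
    intro a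
    rw [Fin.prod_univ_succAbove _ p]
    simp only [insPerm_succAbove, insPerm_self, Fin.succ_pos, and_true,
      Fin.succ_lt_succ_iff, Fin.succAbove_lt_succAbove_iff, Fin.succAbove_lt_iff_castSucc_lt]
    congr 1
    split_ifs
    · rw [mul_comm]
    · simp [negPow_zero]
  rw [Finset.prod_congr rfl (fun a _ => this a), Finset.prod_mul_distrib, Finset.mul_sum,
    negPow_sum]

/-- Fixing all positions from `j` on forces the first `j` to be permuted among themselves. Such a
permutation is strictly monotone on all of `Fin N`, hence the identity. -/
theorem shuffles_zero_left (N j : ℕ) : shuffles N 0 j = {1} := by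
  ext σ
  simp only [shuffles, Finset.mem_filter, Finset.mem_univ, true_and, Finset.mem_singleton,
    Nat.not_lt_zero, zero_add, Nat.zero_le, forall_const]
  constructor
  · rintro ⟨-, h2, h3⟩
    have hlt : ∀ a : Fin N, (a : ℕ) < j → (σ a : ℕ) < j := by
      intro a ha
      by_contra hc
      have := σ.injective (h3 (σ a) (not_lt.1 hc))
      rw [this] at hc; exact hc ha
    have hm : StrictMono σ := by
      intro a b hab
      by_cases hb : (b : ℕ) < j
      · exact h2 a b hab hb
      · rw [h3 b (not_lt.1 hb)]
        by_cases ha : (a : ℕ) < j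
        · exact Fin.lt_def.2 (lt_of_lt_of_le (hlt a ha) (not_lt.1 hb))
        · rw [h3 a (not_lt.1 ha)]; exact hab
    ext a
    have := congrFun (hm.range_inj (g := id) strictMono_id |>.1 (by
      rw [σ.surjective.range_eq, Set.range_id])) a
    simpa using congrArg Fin.val this
  · rintro rfl
    exact ⟨by simp, by simp +contextual, by simp⟩

theorem shuffles_zero_right (N i : ℕ) : shuffles N i 0 = {1} := by
  rw [← shuffles_zero_left N i]
  ext σ
  simp only [shuffles, Finset.mem_filter, Finset.mem_univ, true_and, add_zero,
    Nat.not_lt_zero, zero_add, Nat.zero_le, forall_const]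
  constructor
  · rintro ⟨h1, -, h3⟩
    exact ⟨by simp, h1, h3⟩
  · rintro ⟨-, h1, h3⟩
    exact ⟨h1, fun a b h h' h'' => by omega, h3⟩

theorem insPerm_zero_mem_shuffles {N i j : ℕ} (σ : Equiv.Perm (Fin N)) :
    insPerm 0 σ ∈ shuffles (N + 1) (i + 1) j ↔ σ ∈ shuffles N i j := by
  have e0 : insPerm 0 σ 0 = 0 := insPerm_self 0 σ
  have e1 : ∀ a : Fin N, insPerm 0 σ a.succ = (σ a).succ := fun a => by
    simpa using insPerm_succAbove 0 σ a
  simp only [shuffles, Finset.mem_filter, Finset.mem_univ, true_and]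
  constructor
  · rintro ⟨h1, h2, h3⟩
    refine ⟨fun a b hab hb => ?_, fun a b ha hab hb => ?_, fun a ha => ?_⟩
    · simpa [e1] using h1 a.succ b.succ (by simpa using hab) (by simpa using hb)
    · simpa [e1] using h2 a.succ b.succ (by simpa using ha) (by simpa using hab)
        (by simp; omega)
    · simpa [e1] using h3 a.succ (by simp; omega)
  · rintro ⟨h1, h2, h3⟩
    refine ⟨fun a b hab hb => ?_, fun a b ha hab hb => ?_, fun a ha => ?_⟩
    · cases b using Fin.cases with
      | zero => simp at hab
      | succ b =>
        cases a using Fin.cases with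
        | zero => simp [e0, e1]
        | succ a => simpa [e1] using h1 a b (by simpa using hab) (by simpa using hb)
    · cases b using Fin.cases with
      | zero => simp at hab
      | succ b =>
        cases a using Fin.cases with
        | zero => simp at ha
        | succ a =>
          simpa [e1] using h2 a b (by simpa using ha) (by simpa using hab)
            (by simp at hb; omega)
    · cases a using Fin.cases with
      | zero => simp at ha
      | succ a => simpa [e1] using h3 a (by simp at ha; omega)

/-- Position `i` is the head of the second block, where the smallest letter never violates
monotonicity. `insPerm_zero_mem_shuffles` is the counterpart for the head of the first block. -/
theorem insPerm_mem_shuffles {N i j : ℕ} (hi : i < N + 1) (σ : Equiv.Perm (Fin N)) :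
    insPerm ⟨i, hi⟩ σ ∈ shuffles (N + 1) i (j + 1) ↔ σ ∈ shuffles N i j := by
  set p : Fin (N + 1) := ⟨i, hi⟩
  have e0 : insPerm p σ p = 0 := insPerm_self p σ
  have e1 : ∀ a : Fin N, insPerm p σ (p.succAbove a) = (σ a).succ := insPerm_succAbove p σ
  have hlt : ∀ a : Fin N, (a : ℕ) < i → (p.succAbove a : ℕ) = a := fun a ha => by
    rw [Fin.succAbove_of_castSucc_lt _ _ (by simpa [Fin.lt_def, p] using ha)]; rfl
  have hge : ∀ a : Fin N, i ≤ (a : ℕ) → (p.succAbove a : ℕ) = a + 1 := fun a ha => by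
    rw [Fin.succAbove_of_le_castSucc _ _ (by simpa [Fin.le_def, p] using ha)]; rfl
  simp only [shuffles, Finset.mem_filter, Finset.mem_univ, true_and]
  constructor
  · rintro ⟨h1, h2, h3⟩
    refine ⟨fun a b hab hb => ?_, fun a b ha hab hb => ?_, fun a ha => ?_⟩
    · simpa [e1] using h1 (p.succAbove a) (p.succAbove b) (by simpa using hab)
        (by rw [hlt b hb]; exact hb)
    · simpa [e1] using h2 (p.succAbove a) (p.succAbove b) (by rw [hge a ha]; omega)
        (by simpa using hab) (by rw [hge b (ha.trans hab.le)]; omega)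
    · have := h3 (p.succAbove a) (by rw [hge a (by omega)]; omega)
      rw [e1] at this
      have := congrArg Fin.val this
      rw [hge a (by omega)] at this
      ext
      simpa using this
  · rintro ⟨h1, h2, h3⟩
    refine ⟨fun a b hab hb => ?_, fun a b ha hab hb => ?_, fun a ha => ?_⟩
    · rcases Fin.eq_self_or_eq_succAbove p a with rfl | ⟨a, rfl⟩
      · simp [Fin.lt_def, p] at hab; omega
      rcases Fin.eq_self_or_eq_succAbove p b with rfl | ⟨b, rfl⟩
      · simp [p] at hb
      rw [e1, e1, Fin.succ_lt_succ_iff]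
      refine h1 a b (by simpa using hab) ?_
      by_contra hc
      rw [hge b (by omega)] at hb; omega
    · rcases Fin.eq_self_or_eq_succAbove p b with rfl | ⟨b, rfl⟩
      · simp [Fin.lt_def, p] at hab; omega
      rcases Fin.eq_self_or_eq_succAbove p a with rfl | ⟨a, rfl⟩
      · rw [e0, e1]; simp
      rw [e1, e1, Fin.succ_lt_succ_iff]
      have hab' : a < b := by simpa using hab
      have ha' : i ≤ (a : ℕ) := by
        by_contra hc
        rw [hlt a (by omega)] at ha; omega
      refine h2 a b ha' hab' ?_
      rw [hge b (ha'.trans hab'.le)] at hb; omega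
    · rcases Fin.eq_self_or_eq_succAbove p a with rfl | ⟨a, rfl⟩
      · simp [p] at ha
      have ha' : i ≤ (a : ℕ) := by
        by_contra hc
        rw [hlt a (by omega)] at ha; omega
      rw [hge a ha'] at ha
      rw [e1, h3 a (by omega)]
      ext
      rw [hge a ha']; rfl

/-- A Pascal-type recursion: the two nonempty blocks have two heads, and the letter `0` sits at one
of them. -/
theorem sum_shuffles_succ {M : Type*} [AddCommMonoid M] {N i j : ℕ} (hij : i + j + 1 ≤ N)
    (H : Equiv.Perm (Fin (N + 1)) → M) :
    ∑ σ ∈ shuffles (N + 1) (i + 1) (j + 1), H σ =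
      ∑ σ ∈ shuffles N i (j + 1), H (insPerm 0 σ) +
        ∑ σ ∈ shuffles N (i + 1) j, H (insPerm ⟨i + 1, by omega⟩ σ) := by
  classical
  rw [← Finset.sum_image (s := shuffles N i (j + 1)) (g := insPerm 0)
      (fun _ _ _ _ h => insPerm_injective _ h),
    ← Finset.sum_image (s := shuffles N (i + 1) j) (g := insPerm ⟨i + 1, by omega⟩)
      (fun _ _ _ _ h => insPerm_injective _ h), ← Finset.sum_union]
  · refine Finset.sum_congr ?_ fun _ _ => rfl
    ext σ
    simp only [Finset.mem_union, Finset.mem_image]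
    constructor
    · intro hσ
      obtain ⟨p, hp⟩ := σ.surjective 0
      -- Anywhere else in a block the head of that block would be mapped below `0`; beyond both
      -- blocks `p` would be fixed.
      have hp' : p = 0 ∨ p = ⟨i + 1, by omega⟩ := by
        by_contra hc
        push Not at hc
        obtain ⟨h1, h2, h3⟩ := (Finset.mem_filter.1 hσ).2
        have hc1 : (p : ℕ) ≠ 0 := fun h => hc.1 (Fin.ext h)
        have hc2 : (p : ℕ) ≠ i + 1 := fun h => hc.2 (Fin.ext h)
        rcases lt_or_ge (p : ℕ) (i + 1) with h | h
        · have := h1 0 p (Fin.pos_iff_ne_zero.2 hc.1) h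
          rw [hp] at this
          simp at this
        rcases lt_or_ge (p : ℕ) (i + 1 + (j + 1)) with h' | h'
        · have := h2 ⟨i + 1, by omega⟩ p le_rfl (Fin.lt_def.2 (by simp; omega)) h'
          rw [hp] at this
          simp at this
        · have := h3 p h'
          rw [hp] at this
          exact hc.1 this.symm
      rcases hp' with h | h
      · rw [h] at hp
        obtain ⟨τ, rfl⟩ := exists_insPerm σ _ hp
        exact Or.inl ⟨τ, (insPerm_zero_mem_shuffles τ).1 hσ, rfl⟩
      · rw [h] at hp
        obtain ⟨τ, hτ⟩ := exists_insPerm σ _ hp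
        rw [← hτ] at hσ
        exact Or.inr ⟨τ, (insPerm_mem_shuffles _ τ).1 hσ, hτ⟩
    · rintro (⟨τ, hτ, rfl⟩ | ⟨τ, hτ, rfl⟩)
      · exact (insPerm_zero_mem_shuffles τ).2 hτ
      · exact (insPerm_mem_shuffles _ τ).2 hτ
  · rw [Finset.disjoint_left]
    simp only [Finset.mem_image, not_exists, not_and]
    rintro _ ⟨τ, -, rfl⟩ τ' - h
    have h1 := insPerm_self 0 τ
    rw [← h] at h1
    have h2 := insPerm_self ⟨i + 1, by omega⟩ τ'
    have := (insPerm (⟨i + 1, by omega⟩ : Fin (N + 1)) τ').injective (h1.trans h2.symm)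
    simp [Fin.ext_iff] at this

end PermDecomposition

/-! ### Shuffle sums as recursions on lists. -/

section ListShuffles

variable {α : Type*} (deg : α → ℤ) {E : Type*} [AddCommGroup E]

/-- The total degree of a list. -/
def degL (l : List α) : ℤ := (l.map deg).sum

@[simp] theorem degL_nil : degL deg [] = 0 := rfl

@[simp] theorem degL_cons (x : α) (l : List α) : degL deg (x :: l) = deg x + degL deg l := by
  simp [degL]

theorem degL_perm {l m : List α} (h : l.Perm m) : degL deg l = degL deg m :=
  (h.map deg).sum_eq

/-- The signed sum of `F x l'` over all choices of an entry `x` of a list, `l'` being the list of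
the other entries. -/
def pick : (α → List α → E) → List α → E
  | _, [] => 0
  | F, x :: l => F x l + pick (fun y l' => negPow (deg y * deg x) • F y (x :: l')) l

/-- The signed sum of `F I O` over all decompositions of a list into two complementary sublists. -/
def shsum : (List α → List α → E) → List α → E
  | F, [] => F [] []
  | F, x :: l => shsum (fun I O => F (x :: I) O) l +
      shsum (fun I O => negPow (deg x * degL deg I) • F I (x :: O)) l

/-- The signed sum of `Φ` over all rearrangements of a list by `(i, j)`-shuffles. -/
def shl : ℕ → ℕ → (List α → E) → List α → E
  | 0, _, Φ, l => Φ l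
  | _ + 1, 0, Φ, l => Φ l
  | _ + 1, _ + 1, _, [] => 0
  | i + 1, j + 1, Φ, x :: l => shl i (j + 1) (fun m => Φ (x :: m)) l +
      shl (i + 1) j (fun m => negPow (deg x * degL deg (m.take (i + 1))) •
        Φ (m.insertIdx (i + 1) x)) l

theorem shl_zero_left (j : ℕ) (Φ : List α → E) (l : List α) : shl deg 0 j Φ l = Φ l := by
  simp [shl]

theorem shl_zero_right (i : ℕ) (Φ : List α → E) (l : List α) : shl deg i 0 Φ l = Φ l := by
  cases i <;> simp [shl]

theorem shl_cons (i j : ℕ) (Φ : List α → E) (x : α) (l : List α) :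
    shl deg (i + 1) (j + 1) Φ (x :: l) = shl deg i (j + 1) (fun m => Φ (x :: m)) l +
      shl deg (i + 1) j (fun m => negPow (deg x * degL deg (m.take (i + 1))) •
        Φ (m.insertIdx (i + 1) x)) l := by
  rw [shl]

/-- The bound on `i + j` guarantees that `insertIdx` really inserts its letter, so `Φ` is only
evaluated on lists of full length. -/
theorem shl_congr (i j : ℕ) (Φ Ψ : List α → E) (l : List α) (hij : i + j ≤ l.length)
    (h : ∀ m, m.length = l.length → Φ m = Ψ m) : shl deg i j Φ l = shl deg i j Ψ l := by
  induction l generalizing i j Φ Ψ with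
  | nil =>
    obtain ⟨rfl, rfl⟩ : i = 0 ∧ j = 0 := by simpa using hij
    simpa [shl] using h [] rfl
  | cons x l ih =>
    rcases i with - | i
    · simpa [shl] using h _ rfl
    rcases j with - | j
    · simpa [shl] using h _ rfl
    simp only [List.length_cons] at hij
    rw [shl_cons, shl_cons]
    congr 1
    · exact ih _ _ _ _ (by omega) fun m hm => h _ (by simp [hm])
    · refine ih _ _ _ _ (by omega) fun m hm => ?_
      rw [h _ (by rw [List.length_insertIdx_of_le_length (by omega), hm]; rfl)]

theorem shl_smul (c : ℤ) (i j : ℕ) (Φ : List α → E) (l : List α) :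
    shl deg i j (fun m => c • Φ m) l = c • shl deg i j Φ l := by
  induction l generalizing i j Φ with
  | nil => rcases i with - | i <;> rcases j with - | j <;> simp [shl]
  | cons x l ih =>
    rcases i with - | i
    · simp [shl]
    rcases j with - | j
    · simp [shl]
    simp only [shl_cons, smul_comm _ c, ih, smul_add]

theorem take_insertIdx (p : ℕ) (x : α) (l : List α) :
    (l.insertIdx p x).take p = l.take p :=
  List.take_insertIdx_eq_take_of_le l x p p le_rfl

theorem drop_insertIdx (p : ℕ) (x : α) (l : List α) (hp : p ≤ l.length) :
    (l.insertIdx p x).drop p = x :: l.drop p := by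
  induction p generalizing l with
  | zero => simp
  | succ p ih =>
    rcases l with - | ⟨y, l⟩
    · simp at hp
    · simpa using ih l (by simpa using hp)

theorem ofFn_insPerm {N : ℕ} (p : Fin (N + 1)) (σ : Equiv.Perm (Fin N)) (x : Fin (N + 1) → α) :
    List.ofFn (fun a => x (insPerm p σ a)) =
      (List.ofFn fun a => x (σ a).succ).insertIdx p (x 0) := by
  have hl : (p : ℕ) ≤ (List.ofFn fun a => x (σ a).succ).length := by
    simp only [List.length_ofFn]; omega
  refine List.ext_getElem (by rw [List.length_insertIdx_of_le_length hl]; simp) fun k h1 h2 => ?_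
  rw [List.getElem_insertIdx]
  simp only [List.length_ofFn] at h1
  simp only [List.getElem_ofFn]
  rcases Fin.eq_self_or_eq_succAbove p ⟨k, h1⟩ with h | ⟨a, h⟩
  · rw [h, insPerm_self]
    have : k = p := congrArg Fin.val h
    simp [this]
  · rw [h, insPerm_succAbove]
    have hv := congrArg Fin.val h
    simp only at hv
    rcases lt_or_ge a.castSucc p with hp | hp
    · rw [Fin.succAbove_of_castSucc_lt _ _ hp] at hv
      have : k < (p : ℕ) := by rw [hv]; exact hp
      rw [dif_pos this]
      congr
      exact Fin.ext hv.symm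
    · rw [Fin.succAbove_of_le_castSucc _ _ hp] at hv
      simp only [Fin.val_succ] at hv
      have hp' : (p : ℕ) ≤ a := hp
      rw [dif_neg (by omega), dif_neg (by omega)]
      congr
      exact Fin.ext (by simp; omega)

theorem koszulSign_insPerm_smul {N : ℕ} (p : Fin (N + 1)) (σ : Equiv.Perm (Fin N))
    (x : Fin (N + 1) → α) :
    koszulSign (insPerm p σ) (fun i => deg (x i)) =
      negPow (deg (x 0) * degL deg ((List.ofFn fun a => x (σ a).succ).take p)) *
        koszulSign σ (fun i => deg (x i.succ)) := by
  rw [koszulSign_insPerm]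
  congr 3
  rw [degL, List.map_take, List.map_ofFn, List.sum_take_ofFn, Finset.sum_filter]
  rfl

/-- Both sides obey the same recursion in the first letter: at the head of the second block it has
passed the `i + 1` letters of the first block, which produces the sign in `shl`. -/
theorem sum_shuffles_eq_shl {N i j : ℕ} (hij : i + j ≤ N) (x : Fin N → α) (Φ : List α → E) :
    ∑ σ ∈ shuffles N i j, koszulSign σ (fun a => deg (x a)) • Φ (List.ofFn fun a => x (σ a)) =
      shl deg i j Φ (List.ofFn x) := by
  induction N generalizing i j Φ with
  | zero =>
    obtain ⟨rfl, rfl⟩ : i = 0 ∧ j = 0 := by omega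
    rw [shuffles_zero_left, shl_zero_left, Finset.sum_singleton, koszulSign_one, one_smul]
    rfl
  | succ N ih =>
    rcases i with - | i
    · rw [shuffles_zero_left, shl_zero_left, Finset.sum_singleton, koszulSign_one, one_smul]
      rfl
    rcases j with - | j
    · rw [shuffles_zero_right, shl_zero_right, Finset.sum_singleton, koszulSign_one, one_smul]
      rfl
    rw [sum_shuffles_succ (by omega), List.ofFn_succ, shl_cons, ← ih (by omega), ← ih (by omega)]
    congr 1
    · refine Finset.sum_congr rfl fun σ _ => ?_
      rw [koszulSign_insPerm_smul, ofFn_insPerm]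
      simp [negPow_zero]
    · refine Finset.sum_congr rfl fun σ _ => ?_
      rw [koszulSign_insPerm_smul, ofFn_insPerm, mul_comm, mul_smul]

/-- Summing over all block sizes makes the sizes irrelevant: each letter independently joins the
first or the second sublist. -/
theorem sum_shl_eq_shsum (F : List α → List α → E) (l : List α) (n : ℕ) (hn : l.length = n) :
    ∑ i ∈ Finset.range (n + 1), shl deg i (n - i) (fun m => F (m.take i) (m.drop i)) l =
      shsum deg F l := by
  induction l generalizing F n with
  | nil => subst hn; simp [shl, shsum]
  | cons x l ih =>
    obtain ⟨n, rfl⟩ : ∃ k, n = k + 1 := ⟨l.length, by simpa using hn.symm⟩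
    have hl : l.length = n := by simpa using hn
    rw [shsum, ← ih _ n hl, ← ih _ n hl]
    -- The extreme sizes `0` and `n + 1` leave only one sublist for `x`, so they are split off;
    -- every size in between gives two terms.
    rw [Finset.sum_range_succ', Finset.sum_range_succ, Finset.sum_range_succ _ n,
      Finset.sum_range_succ' _ n]
    have key : ∀ i ∈ Finset.range n,
        shl deg (i + 1) (n + 1 - (i + 1)) (fun m => F (m.take (i + 1)) (m.drop (i + 1))) (x :: l) =
        shl deg i (n - i) (fun m => F (x :: m.take i) (m.drop i)) l +
        shl deg (i + 1) (n - (i + 1)) (fun m => negPow (deg x * degL deg (m.take (i + 1))) •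
          F (m.take (i + 1)) (x :: m.drop (i + 1))) l := by
      intro i hi
      have hi := Finset.mem_range.1 hi
      obtain ⟨j, rfl⟩ : ∃ j, n = i + 1 + j := ⟨n - (i + 1), by omega⟩
      rw [show i + 1 + j + 1 - (i + 1) = j + 1 by omega, show i + 1 + j - i = j + 1 by omega,
        show i + 1 + j - (i + 1) = j by omega, shl_cons]
      congr 1
      refine shl_congr _ _ _ _ _ _ (by omega) fun m hm => ?_
      rw [take_insertIdx, drop_insertIdx _ _ _ (by omega)]
    rw [Finset.sum_congr rfl key, Finset.sum_add_distrib]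
    simp only [Nat.sub_self, shl_zero_right, shl_zero_left, List.take_zero, List.drop_zero,
      degL_nil, mul_zero, negPow_zero, one_smul, List.take_succ_cons, List.drop_succ_cons]
    abel

theorem apply_insertIdx_of_swap (Φ : List α → E)
    (hΦ : ∀ l u v m, Φ (l ++ u :: v :: m) = negPow (deg u * deg v) • Φ (l ++ v :: u :: m))
    (l : List α) (p : ℕ) (hp : p ≤ l.length) (x : α) :
    Φ (l.insertIdx p x) = negPow (deg x * degL deg (l.take p)) • Φ (x :: l) := by
  induction p generalizing l Φ with
  | zero => simp [negPow_zero]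
  | succ p ih =>
    rcases l with - | ⟨y, l⟩
    · simp at hp
    · rw [List.insertIdx_succ_cons,
        ih (fun m => Φ (y :: m)) (fun k u v m => hΦ (y :: k) u v m) l (by simpa using hp)]
      have := hΦ [] y x l
      simp only [List.nil_append] at this
      rw [this, negPow_smul_negPow_smul, List.take_succ_cons, degL_cons]
      congr 2
      ring

/-- Induction on `N`: adjacent swaps carry the letter `0` to the front, at the cost computed in
`koszulSign_insPerm_smul`, and the rest is a permutation of fewer letters. Graded symmetry thus
needs checking on adjacent swaps only. -/
theorem apply_perm_of_swap {N : ℕ} (Φ : List α → E)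
    (hΦ : ∀ l u v m, Φ (l ++ u :: v :: m) = negPow (deg u * deg v) • Φ (l ++ v :: u :: m))
    (x : Fin N → α) (σ : Equiv.Perm (Fin N)) :
    Φ (List.ofFn fun i => x (σ i)) = koszulSign σ (fun i => deg (x i)) • Φ (List.ofFn x) := by
  induction N generalizing Φ with
  | zero => simp [koszulSign]
  | succ N ih =>
    obtain ⟨p, hp⟩ := σ.surjective 0
    obtain ⟨τ, rfl⟩ := exists_insPerm σ p hp
    rw [ofFn_insPerm, apply_insertIdx_of_swap deg Φ hΦ _ _ (by simp; omega),
      ih (fun m => Φ (x 0 :: m)) (fun k u v m => hΦ (x 0 :: k) u v m) (fun i => x i.succ),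
      koszulSign_insPerm_smul, mul_smul, List.ofFn_succ]

end ListShuffles

/-! ### Calculus of signed sums over sublists and chosen entries. -/

section ListSums

variable {α : Type*} (deg : α → ℤ) {E E' : Type*} [AddCommGroup E] [AddCommGroup E']

theorem pick_congr {F G : α → List α → E} {l : List α}
    (h : ∀ y l', (y :: l').Perm l → F y l' = G y l') : pick deg F l = pick deg G l := by
  induction l generalizing F G with
  | nil => simp [pick]
  | cons x l ih =>
    rw [pick, pick, h x l (List.Perm.refl _)]
    congr 1
    refine ih fun y l' hp => ?_
    rw [h y (x :: l') ((List.Perm.swap x y l').trans (hp.cons x))]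

theorem map_pick (φ : E →+ E') (F : α → List α → E) (l : List α) :
    φ (pick deg F l) = pick deg (fun y l' => φ (F y l')) l := by
  induction l generalizing F with
  | nil => simp [pick]
  | cons x l ih => simp only [pick, map_add, ih, map_zsmul]

theorem pick_add (F G : α → List α → E) (l : List α) :
    pick deg (fun y l' => F y l' + G y l') l = pick deg F l + pick deg G l := by
  induction l generalizing F G with
  | nil => simp [pick]
  | cons x l ih =>
    simp only [pick, smul_add, ih]
    abel

theorem pick_zero (l : List α) : pick deg (fun _ _ => (0 : E)) l = 0 := by
  induction l with
  | nil => rfl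
  | cons x l ih => simp only [pick, smul_zero, ih, add_zero]

theorem pick_smul (c : ℤ) (F : α → List α → E) (l : List α) :
    pick deg (fun y l' => c • F y l') l = c • pick deg F l :=
  (map_pick deg (DistribSMul.toAddMonoidHom E c) F l).symm

theorem pick_map {β : Type*} (f : β → α) (F : α → List α → E) (l : List β) :
    pick deg F (l.map f) = pick (fun b => deg (f b)) (fun y l' => F (f y) (l'.map f)) l := by
  induction l generalizing F with
  | nil => rfl
  | cons x l ih => simp only [List.map_cons, pick, ih]

theorem map_shsum (φ : E →+ E') (F : List α → List α → E) (l : List α) :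
    φ (shsum deg F l) = shsum deg (fun I O => φ (F I O)) l := by
  induction l generalizing F with
  | nil => simp [shsum]
  | cons x l ih => simp only [shsum, map_add, ih, map_zsmul]

theorem shsum_add (F G : List α → List α → E) (l : List α) :
    shsum deg (fun I O => F I O + G I O) l = shsum deg F l + shsum deg G l := by
  induction l generalizing F G with
  | nil => simp [shsum]
  | cons x l ih =>
    simp only [shsum, smul_add, ih]
    abel

theorem shsum_smul (c : ℤ) (F : List α → List α → E) (l : List α) :
    shsum deg (fun I O => c • F I O) l = c • shsum deg F l :=
  (map_shsum deg (DistribSMul.toAddMonoidHom E c) F l).symm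

theorem shsum_zero (l : List α) : shsum deg (fun _ _ => (0 : E)) l = 0 := by
  induction l with
  | nil => rfl
  | cons x l ih => simp only [shsum, smul_zero, ih, add_zero]

theorem shsum_comm (F : List α → List α → E) (l : List α) :
    shsum deg F l = shsum deg (fun I O => negPow (degL deg I * degL deg O) • F O I) l := by
  induction l generalizing F with
  | nil => simp [shsum, negPow_zero]
  | cons x l ih =>
    rw [shsum, shsum, ih (fun I O => F (x :: I) O),
      ih (fun I O => negPow (deg x * degL deg I) • F I (x :: O)), add_comm]
    congr 1
    · congr 1
      funext I O
      rw [negPow_smul_negPow_smul, degL_cons]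
      congr 2
      ring
    · congr 1
      funext I O
      rw [negPow_smul_negPow_smul, degL_cons]
      congr 1
      exact negPow_congr (by
        exact ⟨-(deg x * degL deg I), by ring⟩)

/-- Distributing and then choosing an entry of the first sublist amounts to choosing the entry
first. There is no extra sign, since the entry ends up in front of both sublists either way. -/
theorem shsum_pick_left (F : α → List α → List α → E) (l : List α) :
    shsum deg (fun I O => pick deg (fun y I' => F y I' O) I) l =
      pick deg (fun y l' => shsum deg (fun I' O => F y I' O) l') l := by
  induction l generalizing F with
  | nil => simp [shsum, pick]
  | cons x l ih =>
    have h1 : ∀ I O, negPow (deg x * degL deg I) • pick deg (fun y I' => F y I' (x :: O)) I =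
        pick deg (fun y I' => negPow (deg x * (deg y + degL deg I')) • F y I' (x :: O)) I := by
      intro I O
      rw [← pick_smul]
      exact pick_congr deg fun y l' hp => by rw [← degL_perm deg hp, degL_cons]
    simp only [shsum, pick, h1, shsum_add, smul_add, pick_add]
    rw [ih (fun y I' O => negPow (deg y * deg x) • F y (x :: I') O),
      ih (fun y I' O => negPow (deg x * (deg y + degL deg I')) • F y I' (x :: O)), add_assoc]
    congr 2
    · simp only [shsum_smul]
    · congr 1
      funext y l'
      rw [← shsum_smul]
      congr 1
      funext I O
      rw [negPow_smul_negPow_smul]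
      congr 2
      ring

/-- Here the chosen entry comes from the second sublist, so bringing it to the very front makes it
pass the first sublist; this accounts for the sign. -/
theorem shsum_pick_right (F : α → List α → List α → E) (l : List α) :
    shsum deg (fun I O => pick deg (fun z O' => F z I O') O) l =
      pick deg (fun z l' =>
        shsum deg (fun I O' => negPow (deg z * degL deg I) • F z I O') l') l := by
  induction l generalizing F with
  | nil => simp [shsum, pick]
  | cons x l ih =>
    simp only [shsum, pick, shsum_add, smul_add, pick_add, ← pick_smul]
    rw [ih (fun z I O' => F z (x :: I) O'),
      ih (fun z I O' => negPow (deg x * degL deg I) • negPow (deg z * deg x) • F z I (x :: O')),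
      add_left_comm]
    congr 2
    · congr 1
      funext y l'
      rw [← shsum_smul]
      congr 1
      funext I O
      rw [negPow_smul_negPow_smul, degL_cons]
      congr 1
      refine negPow_congr ⟨-(deg y * deg x), by ring⟩
    · congr 1
      funext y l'
      rw [← shsum_smul]
      congr 1
      funext I O
      simp only [negPow_smul_negPow_smul]
      congr 2
      ring

/-- The signed sum of `H u v l'` over all choices of a pair of entries `u, v` of a list (in their
order), `l'` being the list of the other entries. -/
def pickPair : (α → α → List α → E) → List α → E
  | _, [] => 0
  | H, x :: l => pick deg (fun v l' => H x v l') l +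
      pickPair (fun u v l' => negPow ((deg u + deg v) * deg x) • H u v (x :: l')) l

/-- The function `F` of the second list if the first one is empty. -/
def ifNil (F : List α → E) : List α → List α → E
  | [], O => F O
  | _, _ => 0

/-- The function `F` of the entry of the first list if this has length one. -/
def ifSingleton (F : α → List α → E) : List α → List α → E
  | [v], O => F v O
  | _, _ => 0

/-- The function `F` of the entries of the first list if this has length two. -/
def ifPair (F : α → α → List α → E) : List α → List α → E
  | [u, v], O => F u v O
  | _, _ => 0

theorem shsum_ifNil (F : List α → E) (l : List α) : shsum deg (ifNil F) l = F l := by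
  induction l generalizing F with
  | nil => rfl
  | cons x l ih =>
    rw [shsum]
    have h1 : (fun I O => ifNil F (x :: I) O) = fun _ _ => 0 := rfl
    have h2 : (fun I O => negPow (deg x * degL deg I) • ifNil F I (x :: O)) =
        ifNil fun O => F (x :: O) := by
      funext I O
      cases I <;> simp [ifNil, negPow_zero]
    rw [h1, h2, shsum_zero, ih, zero_add]

theorem shsum_ifSingleton (F : α → List α → E) (l : List α) :
    shsum deg (ifSingleton F) l = pick deg F l := by
  induction l generalizing F with
  | nil => rfl
  | cons x l ih =>
    rw [shsum, pick]
    have h1 : (fun I O => ifSingleton F (x :: I) O) = ifNil (F x) := by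
      funext I O
      cases I <;> rfl
    have h2 : (fun I O => negPow (deg x * degL deg I) • ifSingleton F I (x :: O)) =
        ifSingleton fun y O => negPow (deg y * deg x) • F y (x :: O) := by
      funext I O
      rcases I with - | ⟨a, - | ⟨b, I⟩⟩ <;> simp [ifSingleton, mul_comm]
    rw [h1, h2, shsum_ifNil, ih]

theorem shsum_ifPair (F : α → α → List α → E) (l : List α) :
    shsum deg (ifPair F) l = pickPair deg F l := by
  induction l generalizing F with
  | nil => rfl
  | cons x l ih =>
    rw [shsum, pickPair]
    have h1 : (fun I O => ifPair F (x :: I) O) = ifSingleton (F x) := by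
      funext I O
      rcases I with - | ⟨a, - | ⟨b, I⟩⟩ <;> rfl
    have h2 : (fun I O => negPow (deg x * degL deg I) • ifPair F I (x :: O)) =
        ifPair fun u v O => negPow ((deg u + deg v) * deg x) • F u v (x :: O) := by
      funext I O
      rcases I with - | ⟨a, - | ⟨b, - | ⟨c, I⟩⟩⟩ <;> simp [ifPair, mul_comm]
    rw [h1, h2, shsum_ifSingleton, ih]

/-- Two successive choices pick an unordered pair in one of its two orders. In the `L_∞`-relation
the two orders are which element of `L'` sits in the inner and which in the outer bracket. -/
theorem pick_pick (H : α → α → List α → E) (l : List α) :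
    pick deg (fun u l' => pick deg (fun v l'' => H u v l'') l') l =
      pickPair deg (fun u v O => H u v O + negPow (deg u * deg v) • H v u O) l := by
  induction l generalizing H with
  | nil => rfl
  | cons x l ih =>
    simp only [pick, pickPair, smul_add, pick_add, ← pick_smul]
    rw [ih (fun u v l'' => negPow (deg u * deg x) • negPow (deg v * deg x) • H u v (x :: l'')),
      add_assoc]
    congr 2
    · simp only [mul_comm]
    · congr 1
      funext u v O
      simp only [negPow_smul_negPow_smul]
      congr 2
      · congr 1; ring
      · congr 1; ring

theorem pickPair_congr {F G : α → α → List α → E} {l : List α}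
    (h : ∀ u v O, O.length + 2 = l.length → F u v O = G u v O) :
    pickPair deg F l = pickPair deg G l := by
  induction l generalizing F G with
  | nil => rfl
  | cons x l ih =>
    rw [pickPair, pickPair]
    congr 1
    · exact pick_congr deg fun v O hp => h x v O (by simp [← hp.length_eq])
    · exact ih fun u v O hO => by rw [h u v (x :: O) (by simp [← hO])]

theorem pickPair_zero (l : List α) : pickPair deg (fun _ _ _ => (0 : E)) l = 0 := by
  induction l with
  | nil => rfl
  | cons x l ih => simp only [pickPair, smul_zero, pick_zero, zero_add, ih]

theorem pickPair_add (F G : α → α → List α → E) (l : List α) :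
    pickPair deg (fun u v l' => F u v l' + G u v l') l = pickPair deg F l + pickPair deg G l := by
  induction l generalizing F G with
  | nil => simp [pickPair]
  | cons x l ih =>
    simp only [pickPair, smul_add, pick_add, ih]
    abel

/-- No symmetry between `y` and the list is needed: if the chosen entry is `u` or `v`, exchanging
these two merely exchanges the two corresponding terms of the sum. -/
theorem pick_swap (F : α → List α → E)
    (hF : ∀ y l u v m, F y (l ++ u :: v :: m) = negPow (deg u * deg v) • F y (l ++ v :: u :: m))
    (l : List α) (u v : α) (m : List α) :
    pick deg F (l ++ u :: v :: m) = negPow (deg u * deg v) • pick deg F (l ++ v :: u :: m) := by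
  induction l generalizing F with
  | nil =>
    simp only [List.nil_append, pick, smul_add]
    have h : ∀ y l', F y (u :: v :: l') = negPow (deg u * deg v) • F y (v :: u :: l') :=
      fun y l' => hF y [] u v l'
    rw [negPow_smul_self, mul_comm (deg v), add_left_comm]
    congr 2
    rw [← pick_smul]
    congr 1
    funext y l'
    rw [h]
    simp only [negPow_smul_negPow_smul]
    congr 2
    ring
  | cons x l ih =>
    simp only [List.cons_append, pick, smul_add]
    rw [hF x l, ih]
    intro y k u v m
    have := hF y (x :: k) u v m
    simp only [List.cons_append] at this
    rw [this]
    simp only [negPow_smul_negPow_smul]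
    rw [add_comm]

/-- This is the sum over `j` in `voronovBracket`, read on lists. The `match` includes the empty
tuple, for which `succAbove` makes no sense, so that the induction can start there. -/
theorem sum_succAbove_eq_pick {n : ℕ} (e : Fin n → α) (F : α → List α → E) :
    (match n, e with
      | 0, _ => 0
      | _ + 1, e => ∑ j, negPow (deg (e j) * ∑ i ∈ Finset.Iio j, deg (e i)) •
          F (e j) (List.ofFn fun i => e (j.succAbove i))) = pick deg F (List.ofFn e) := by
  induction n generalizing F with
  | zero => rfl
  | succ n ih =>
    simp only
    rw [List.ofFn_succ, pick, ← ih, Fin.sum_univ_succ]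
    congr 1
    · have : Finset.Iio (0 : Fin (n + 1)) = ∅ := by ext; simp
      simp [this, negPow_zero]
    · cases n with
      | zero => simp
      | succ n =>
        refine Finset.sum_congr rfl fun j _ => ?_
        have : ∑ i ∈ Finset.Iio j.succ, deg (e i) =
            deg (e 0) + ∑ i ∈ Finset.Iio j, deg (e i.succ) := by
          have h : ∀ (m : ℕ) (k : Fin m) (f : Fin m → ℤ),
              ∑ i ∈ Finset.Iio k, f i = ∑ i, if i < k then f i else 0 := fun m k f => by
            rw [← Finset.sum_filter]
            congr 1
            ext
            simp
          rw [h, h, Fin.sum_univ_succ]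
          simp
        rw [this, negPow_smul_negPow_smul, List.ofFn_succ]
        simp only [Fin.succ_succAbove_zero, Fin.succ_succAbove_succ]
        congr 2
        ring

end ListSums

/-! ### Higher derived brackets of V-data with `Δ = 0` form an `L_∞`-algebra. -/

section DerivedBrackets

variable {K : Type*} [Field K] {L : Type*} [AddCommGroup L] [Module K L]
  {𝓛 : ℤ → Submodule K L} {br : L →ₗ[K] L →ₗ[K] L} {𝔥 : Submodule K L} {P : L →ₗ[K] L}

/-- The iterated bracket `x ↦ [⋯[[x, a₁], a₂], ⋯, aₙ]` for a list `a₁, …, aₙ`. -/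
def nestL (br : L →ₗ[K] L →ₗ[K] L) : List L → L →ₗ[K] L
  | [] => LinearMap.id
  | a :: l => nestL br l ∘ₗ br.flip a

@[simp] theorem nestL_nil (x : L) : nestL br [] x = x := rfl

@[simp] theorem nestL_cons (a : L) (l : List L) (x : L) :
    nestL br (a :: l) x = nestL br l (br x a) := rfl

theorem nestL_append (l m : List L) (x : L) :
    nestL br (l ++ m) x = nestL br m (nestL br l x) := by
  induction l generalizing x with
  | nil => rfl
  | cons a l ih => simp [ih]

theorem nested_eq_nestL (n : ℕ) (x : L) (a : Fin n → L) :
    nested br n x a = nestL br (List.ofFn a) x := by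
  induction n with
  | zero => rfl
  | succ n ih =>
    rw [nested, ih, List.ofFn_succ', List.concat_eq_append, nestL_append]
    rfl

/-- The Jacobi identity in the form that `[·, a]` is a graded derivation acting from the right, as
suits the left-nested brackets. -/
theorem IsGradedLieAlgebra.bracket_bracket (hL : IsGradedLieAlgebra 𝓛 br) {i j k : ℤ}
    {x y a : L} (hx : x ∈ 𝓛 i) (hy : y ∈ 𝓛 j) (ha : a ∈ 𝓛 k) :
    br (br x y) a = br x (br y a) + negPow (k * j) • br (br x a) y := by
  rw [hL.jacobi i j k x y a hx hy ha,
    hL.antisymm j (i + k) y (br x a) hy (hL.degree i k x a hx ha), smul_neg,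
    negPow_smul_negPow_smul,
    negPow_congr (a := i * j + j * (i + k)) (b := k * j) ⟨i * j, by ring⟩]
  abel

theorem IsVData.bracket_bracket_comm {Δ : L} (hV : IsVData 𝓛 br 𝔥 P Δ) {i j k : ℤ} {y a b : L}
    (hy : y ∈ 𝓛 i) (ha : a ∈ 𝓛 j) (hb : b ∈ 𝓛 k) (ha' : a ∈ 𝔥) (hb' : b ∈ 𝔥) :
    br (br y a) b = negPow (j * k) • br (br y b) a := by
  rw [hV.gradedLie.bracket_bracket hy ha hb, hV.abelian a ha' b hb', map_zero, zero_add, mul_comm]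

/-- The elements `p - Pp` and `q - Pq` lie in `ker P`, which is closed under the bracket. Expanding
`P[p - Pp, q - Pq] = 0` and dropping `[Pp, Pq] = 0` gives the formula. -/
theorem IsVData.proj_bracket {Δ : L} (hV : IsVData 𝓛 br 𝔥 P Δ) (p q : L) :
    P (br p q) = P (br (P p) q) + P (br p (P q)) := by
  have hPP : ∀ x, P (P x) = P x := fun x => LinearMap.congr_fun hV.proj_proj x
  have hmem : ∀ x, P x ∈ 𝔥 := fun x => hV.range_eq ▸ LinearMap.mem_range_self P x
  have h := hV.ker_subalgebra.closed (p - P p) (by simp [hPP]) (q - P q) (by simp [hPP])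
  rw [LinearMap.mem_ker] at h
  simp only [map_sub, LinearMap.sub_apply, hV.abelian _ (hmem p) _ (hmem q), map_zero] at h
  rw [sub_zero] at h
  rw [← sub_eq_zero, ← h]
  abel

section

variable {Δ : L} (hV : IsVData 𝓛 br 𝔥 P Δ) {α : Type*} {deg : α → ℤ} {X A : α → L}
  (hX : ∀ u, X u ∈ 𝓛 (deg u + 1)) (hA : ∀ u, A u ∈ 𝓛 (deg u)) (hA' : ∀ u, A u ∈ 𝔥)

include hV hA in
theorem nestL_mem {i : ℤ} {x : L} (hx : x ∈ 𝓛 i) (l : List α) :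
    nestL br (l.map A) x ∈ 𝓛 (i + degL deg l) := by
  induction l generalizing i x with
  | nil => simpa using hx
  | cons a l ih =>
    simpa [add_assoc] using ih (hV.gradedLie.degree _ _ _ _ hx (hA a))

include hV hA hA' in
theorem nestL_swap {i : ℤ} {x : L} (hx : x ∈ 𝓛 i) (l : List α) (u v : α) (m : List α) :
    nestL br ((l ++ u :: v :: m).map A) x =
      negPow (deg u * deg v) • nestL br ((l ++ v :: u :: m).map A) x := by
  simp only [List.map_append, nestL_append, List.map_cons, nestL_cons]
  rw [hV.bracket_bracket_comm (nestL_mem hV hA hx l) (hA u) (hA v) (hA' u) (hA' v), map_zsmul]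

include hV hA hA' in
-- Since `c` lies in the abelian `𝔥`, bracketing with `c` graded-commutes with bracketing with each
-- entry and can be postponed to the end.
theorem nestL_bracket_of_mem {i j : ℤ} {y c : L} (hy : y ∈ 𝓛 i) (hc : c ∈ 𝓛 j) (hc' : c ∈ 𝔥)
    (l : List α) :
    nestL br (l.map A) (br y c) = negPow (j * degL deg l) • br (nestL br (l.map A) y) c := by
  induction l generalizing i y with
  | nil => simp [negPow_zero]
  | cons a l ih =>
    simp only [List.map_cons, nestL_cons]
    rw [hV.bracket_bracket_comm hy hc (hA a) hc' (hA' a), map_zsmul,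
      ih (hV.gradedLie.degree _ _ _ _ hy (hA a)), negPow_smul_negPow_smul, degL_cons, mul_add]

include hV hA in
-- The iterated Leibniz rule: each entry acts either on `x` or on `y`, and those acting on `x` have
-- to pass `y`.
theorem nestL_bracket {i j : ℤ} {x y : L} (hx : x ∈ 𝓛 i) (hy : y ∈ 𝓛 j) (l : List α) :
    nestL br (l.map A) (br x y) = shsum deg (fun I O => negPow (j * degL deg I) •
      br (nestL br (I.map A) x) (nestL br (O.map A) y)) l := by
  induction l generalizing i j x y with
  | nil => simp [shsum, negPow_zero]
  | cons a l ih =>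
    simp only [List.map_cons, nestL_cons, shsum]
    rw [hV.gradedLie.bracket_bracket hx hy (hA a), map_add, map_zsmul,
      ih hx (hV.gradedLie.degree _ _ _ _ hy (hA a)), ih (hV.gradedLie.degree _ _ _ _ hx (hA a)) hy,
      ← shsum_smul, add_comm]
    congr 2
    · funext I O
      rw [negPow_smul_negPow_smul, degL_cons]
      congr 2
      ring
    · funext I O
      rw [negPow_smul_negPow_smul]
      congr 2
      ring

/-- The `𝔥`-component of Voronov's higher derived bracket (for `Δ = 0`) of a list. -/
def derivedProj (br : L →ₗ[K] L →ₗ[K] L) (P : L →ₗ[K] L) (deg : α → ℤ) (X A : α → L) :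
    List α → L :=
  pick deg fun y l => P (nestL br (l.map A) (X y))

/-- The `s⁻¹L`-component of Voronov's higher derived bracket (for `Δ = 0`) of a list. -/
def derivedLie (br : L →ₗ[K] L →ₗ[K] L) (deg : α → ℤ) (X : α → L) (l : List α) : L :=
  ifPair (fun u v _ => negPow (deg u + 1) • br (X u) (X v)) l []

theorem voronovBracket_eq {k : ℕ} (e : Fin k → α) :
    voronovBracket br P 0 k (fun i => deg (e i)) (fun i => (X (e i), A (e i))) =
      (derivedLie br deg X (List.ofFn e), derivedProj br P deg X A (List.ofFn e)) := by
  rcases k with - | n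
  · rfl
  refine Prod.ext ?_ ?_
  · rcases n with - | - | n
    · simp [voronovBracket, derivedLie, ifPair]
    · simp [voronovBracket, derivedLie, ifPair]
    · simp [voronovBracket, derivedLie, ifPair]
  · have h : (voronovBracket br P 0 (n + 1) (fun i => deg (e i))
        (fun i => (X (e i), A (e i)))).2 = P (nested br (n + 1) 0 fun i => A (e i)) +
        ∑ j : Fin (n + 1), negPow (deg (e j) * ∑ i ∈ Finset.Iio j, deg (e i)) •
          P (nested br n (X (e j)) fun i => A (e (j.succAbove i))) := rfl
    rw [h, nested_eq_nestL, map_zero, map_zero, zero_add]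
    simp only [derivedProj]
    rw [← sum_succAbove_eq_pick]
    simp only [nested_eq_nestL, List.map_ofFn, Function.comp_def]

include hV hX hA hA' in
theorem derivedProj_swap (l : List α) (u v : α) (m : List α) :
    derivedProj br P deg X A (l ++ u :: v :: m) =
      negPow (deg u * deg v) • derivedProj br P deg X A (l ++ v :: u :: m) :=
  pick_swap deg _ (fun y l u v m => by
    rw [nestL_swap hV hA hA' (hX y), map_zsmul]) l u v m

include hV hX in
-- Desuspension turns graded antisymmetry into graded symmetry: the degrees in `L` are `deg + 1`,
-- and the factor `(-1)^{|x|}` in `l₂` makes up the difference.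
theorem derivedLie_swap (l : List α) (u v : α) (m : List α) :
    derivedLie br deg X (l ++ u :: v :: m) =
      negPow (deg u * deg v) • derivedLie br deg X (l ++ v :: u :: m) := by
  rcases l with - | ⟨a, - | ⟨b, l⟩⟩
  · rcases m with - | ⟨c, m⟩
    · simp only [derivedLie, ifPair, List.nil_append]
      rw [hV.gradedLie.antisymm _ _ _ _ (hX u) (hX v), negPow_smul_negPow_smul, smul_neg,
        negPow_smul_negPow_smul, ← neg_one_smul ℤ, ← negPow_one, negPow_smul_negPow_smul]
      congr 1
      apply negPow_congr
      -- Signs agree when their exponents have the same parity, which is a propositional statement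
      -- about the parities of the degrees.
      simp only [Int.even_add, Int.even_sub, Int.even_mul, Int.not_even_one]
      grind
    · simp [derivedLie, ifPair]
  · simp [derivedLie, ifPair]
  · simp [derivedLie, ifPair]

/-- The `𝔥`-component of Voronov's higher derived bracket (for `Δ = 0`) of a list with first entry
`(s⁻¹x, a)` of degree `D`. -/
def derivedProjCons (br : L →ₗ[K] L →ₗ[K] L) (P : L →ₗ[K] L) (deg : α → ℤ) (X A : α → L)
    (D : ℤ) (x a : L) (l : List α) : L :=
  P (nestL br (l.map A) x) +
    pick deg (fun z l' => negPow (deg z * D) • P (nestL br (a :: l'.map A) (X z))) l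

/-- The `s⁻¹L`-component of Voronov's higher derived bracket (for `Δ = 0`) of a list with first
entry `(s⁻¹x, a)` of degree `D`. -/
def derivedLieCons (br : L →ₗ[K] L →ₗ[K] L) (X : α → L) (D : ℤ) (x : L) (l : List α) : L :=
  ifSingleton (fun v _ => negPow (D + 1) • br x (X v)) l []

include hV hX hA hA' in
-- The heart of Voronov's theorem: for a fixed pair, the term with inner `l₂` cancels the two terms
-- in which one element of the pair is in the inner and the other in the outer bracket. All three
-- sums are brought to the form where `I` acts on `X u` and `O` acts on `X v`, with `P` applied to
-- one of the two factors.
theorem proj_nestL_jacobi (u v : α) (l : List α) :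
    negPow (deg u + 1) • P (nestL br (l.map A) (br (X u) (X v))) +
      (negPow (deg u) • shsum deg (fun I O => P (nestL br (O.map A)
        (br (X u) (P (nestL br (I.map A) (X v)))))) l +
      negPow (deg u * deg v) • negPow (deg v) • shsum deg (fun I O => P (nestL br (O.map A)
        (br (X v) (P (nestL br (I.map A) (X u)))))) l) = 0 := by
  have hP : ∀ i x, x ∈ 𝓛 i → P x ∈ 𝓛 i := hV.proj_degree
  have hP' : ∀ x, P x ∈ 𝔥 := fun x => hV.range_eq ▸ LinearMap.mem_range_self P x
  have hn : ∀ w (I : List α), nestL br (I.map A) (X w) ∈ 𝓛 (deg w + 1 + degL deg I) :=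
    fun w I => nestL_mem hV hA (hX w) I
  -- Leibniz rule followed by the projection formula: this one sum yields both kinds of terms.
  have e1 : P (nestL br (l.map A) (br (X u) (X v))) = shsum deg (fun I O =>
      negPow ((deg v + 1) * degL deg I) •
        P (br (P (nestL br (I.map A) (X u))) (nestL br (O.map A) (X v))) +
      negPow ((deg v + 1) * degL deg I) •
        P (br (nestL br (I.map A) (X u)) (P (nestL br (O.map A) (X v))))) l := by
    rw [nestL_bracket hV hA (hX u) (hX v)]
    refine (map_shsum deg P.toAddMonoidHom _ l).trans ?_
    congr 1
    funext I O
    rw [← smul_add, ← hV.proj_bracket]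
    exact map_zsmul P _ _
  have e2 : shsum deg (fun I O => P (nestL br (O.map A)
        (br (X v) (P (nestL br (I.map A) (X u)))))) l = shsum deg (fun I O =>
      negPow (1 + (deg u + 1 + degL deg I) * (deg v + 1)) •
        P (br (P (nestL br (I.map A) (X u))) (nestL br (O.map A) (X v)))) l := by
    congr 1
    funext I O
    rw [nestL_bracket_of_mem hV hA hA' (hX v) (hP _ _ (hn u I)) (hP' _),
      hV.gradedLie.antisymm _ _ _ _ (hn v O) (hP _ _ (hn u I)), smul_neg,
      negPow_smul_negPow_smul, ← neg_one_smul ℤ, ← negPow_one, negPow_smul_negPow_smul, map_zsmul]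
    congr 1
    apply negPow_congr
    simp only [Int.even_add, Int.even_sub, Int.even_mul, Int.not_even_one]
    grind
  have e3 : shsum deg (fun I O => P (nestL br (O.map A)
        (br (X u) (P (nestL br (I.map A) (X v)))))) l = shsum deg (fun I O =>
      negPow ((deg v + 1) * degL deg I) •
        P (br (nestL br (I.map A) (X u)) (P (nestL br (O.map A) (X v))))) l := by
    -- The inner bracket contains `X v` here, so the sublists trade names to match the other two
    -- sums.
    rw [shsum_comm]
    congr 1
    funext I O
    rw [nestL_bracket_of_mem hV hA hA' (hX u) (hP _ _ (hn v O)) (hP' _), map_zsmul,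
      negPow_smul_negPow_smul]
    congr 1
    apply negPow_congr
    simp only [Int.even_add, Int.even_sub, Int.even_mul, Int.not_even_one]
    grind
  rw [e1, e2, e3, shsum_add, smul_add, ← shsum_smul, ← shsum_smul, ← shsum_smul, ← shsum_smul,
    ← shsum_smul, ← shsum_add, ← shsum_add, ← shsum_add]
  convert shsum_zero deg l using 2
  funext I O
  simp only [negPow_smul_negPow_smul]
  generalize P (br (P (nestL br (I.map A) (X u))) (nestL br (O.map A) (X v))) = s
  generalize P (br (nestL br (I.map A) (X u)) (P (nestL br (O.map A) (X v)))) = t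
  generalize degL deg I = d
  have h1 : negPow (deg u + 1 + (deg v + 1) * d) = - negPow (deg u + (deg v + 1) * d) := by
    rw [show deg u + 1 + (deg v + 1) * d = (deg u + (deg v + 1) * d) + 1 by ring, negPow_add _ 1,
      negPow_one, mul_neg_one]
  have h2 : negPow (deg u * deg v + deg v + (1 + (deg u + 1 + d) * (deg v + 1))) =
      negPow (deg u + (deg v + 1) * d) := by
    apply negPow_congr
    simp only [Int.even_add, Int.even_sub, Int.even_mul, Int.not_even_one]
    grind
  simp only [← add_assoc] at h2 ⊢
  rw [h1]
  have h3 : negPow (deg u * deg v + deg v + 1 + (deg u + 1 + d) * (deg v + 1)) =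
      negPow (deg u + (deg v + 1) * d) := h2
  simp only [neg_smul, h3]
  abel

include hV hX hA hA' in
-- As `Δ = 0`, a nonzero term uses exactly two entries through their `L'`-components: both inside an
-- inner `l₂`, or one inside and one outside. Collecting by unordered pairs reduces to
-- `proj_nestL_jacobi`.
theorem derivedProj_jacobi (l : List α) :
    shsum deg (fun I O => derivedProjCons br P deg X A (degL deg I + 1) (derivedLie br deg X I)
      (derivedProj br P deg X A I) O) l = 0 := by
  have e1 : ∀ I O : List α, P (nestL br (O.map A) (derivedLie br deg X I)) =
      ifPair (fun u v O => negPow (deg u + 1) • P (nestL br (O.map A) (br (X u) (X v)))) I O := by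
    intro I O
    rcases I with - | ⟨a, - | ⟨b, - | ⟨c, I⟩⟩⟩ <;> simp [ifPair, derivedLie]
  have e2 : ∀ (z : α) (I O : List α), negPow (deg z * degL deg I) •
      negPow (deg z * (degL deg I + 1)) •
        P (nestL br (derivedProj br P deg X A I :: O.map A) (X z)) =
      pick deg (fun y I' => negPow (deg z) • P (nestL br (O.map A)
        (br (X z) (P (nestL br (I'.map A) (X y)))))) I := by
    intro z I O
    rw [negPow_smul_negPow_smul, pick_smul, nestL_cons]
    congr 1
    · exact negPow_congr ⟨deg z * degL deg I, by ring⟩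
    · exact map_pick deg ((P ∘ₗ nestL br (O.map A) ∘ₗ br (X z)).toAddMonoidHom) _ I
  simp only [derivedProjCons, shsum_add, e1, shsum_ifPair, shsum_pick_right, e2]
  rw [pick_congr deg fun z l' _ => shsum_pick_left deg (fun y I' O => negPow (deg z) •
    P (nestL br (O.map A) (br (X z) (P (nestL br (I'.map A) (X y)))))) l',
    pick_pick, ← pickPair_add]
  convert pickPair_zero deg l using 2
  funext u v O
  simp only [shsum_smul]
  exact proj_nestL_jacobi hV hX hA hA' u v O

include hV hX in
-- Only `l₂(l₂(·, ·), ·)` reaches the component in `s⁻¹L`, so only lists of length three matter, and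
-- there the relation is the graded Jacobi identity.
theorem derivedLie_jacobi (l : List α) :
    shsum deg (fun I O => derivedLieCons br X (degL deg I + 1) (derivedLie br deg X I) O) l =
      0 := by
  have e : (fun I O => derivedLieCons br X (degL deg I + 1) (derivedLie br deg X I) O) =
      ifPair (fun u v O => derivedLieCons br X (deg u + deg v + 1)
        (negPow (deg u + 1) • br (X u) (X v)) O) := by
    funext I O
    rcases I with - | ⟨a, - | ⟨b, - | ⟨c, I⟩⟩⟩ <;> rcases O with - | ⟨d, - | ⟨f, O⟩⟩ <;>
      simp [ifPair, derivedLie, derivedLieCons, ifSingleton]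
  rw [e, shsum_ifPair]
  rcases l with - | ⟨a, - | ⟨b, - | ⟨c, - | ⟨d, l⟩⟩⟩⟩
  · rfl
  · simp [pickPair, pick]
  · simp [pickPair, pick, derivedLieCons, ifSingleton]
  · simp only [pickPair, pick, derivedLieCons, ifSingleton, add_zero,
      map_zsmul, LinearMap.smul_apply, negPow_smul_negPow_smul]
    have j := hV.gradedLie.jacobi _ _ _ _ _ _ (hX a) (hX b) (hX c)
    rw [hV.gradedLie.antisymm _ _ _ _ (hX a) (hV.gradedLie.degree _ _ _ _ (hX b) (hX c)),
      hV.gradedLie.antisymm _ _ _ _ (hX b) (hV.gradedLie.degree _ _ _ _ (hX a) (hX c)),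
      ← sub_eq_iff_eq_add, smul_neg, negPow_smul_negPow_smul, sub_neg_eq_add] at j
    rw [← j, smul_add, smul_neg, negPow_smul_negPow_smul, negPow_smul_negPow_smul]
    generalize br (br (X b) (X c)) (X a) = s
    generalize br (br (X a) (X c)) (X b) = t
    rw [negPow_congr (a := deg a + deg b + 1 + 1 + (deg a + 1) +
        (deg a + 1) * (deg b + 1 + (deg c + 1)))
        (b := (deg b + deg c) * deg a + (deg b + deg c + 1 + 1 + (deg b + 1))) (by
          simp only [Int.even_add, Int.even_sub, Int.even_mul, Int.not_even_one]
          grind),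
      negPow_congr (a := deg a + deg b + 1 + 1 + (deg a + 1) +
        ((deg a + 1) * (deg b + 1) + (deg b + 1) * (deg a + 1 + (deg c + 1))))
        (b := (deg c * deg b + (deg a + deg c + 1 + 1 + (deg a + 1))) + 1) (by
          simp only [Int.even_add, Int.even_sub, Int.even_mul, Int.not_even_one]
          grind), negPow_add _ 1, negPow_one, mul_neg_one, neg_smul]
    abel
  · rw [pickPair_congr deg (G := fun _ _ _ => 0), pickPair_zero]
    intro u v O hO
    rcases O with - | ⟨f, - | ⟨g, O⟩⟩
    · simp at hO
    · simp at hO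
    · rfl

end

theorem pick_mem {α : Type*} (deg : α → ℤ) {F : α → List α → L} {l : List α} (S : Submodule K L)
    (h : ∀ y l', (y :: l').Perm l → F y l' ∈ S) : pick deg F l ∈ S := by
  induction l generalizing F with
  | nil => exact S.zero_mem
  | cons x l ih =>
    refine S.add_mem (h _ _ (List.Perm.refl _)) (ih fun y l' hp => ?_)
    exact zsmul_mem (h _ _ ((List.Perm.swap x y l').trans (hp.cons x))) _

theorem exists_multilinearMap_nested (n : ℕ) :
    ∃ m : MultilinearMap K (fun _ : Fin (n + 1) => L) L,
      ∀ v, m v = nested br n (v 0) fun i => v i.succ := by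
  induction n with
  | zero => exact ⟨MultilinearMap.ofSubsingleton K L L (0 : Fin 1) LinearMap.id, fun v => rfl⟩
  | succ n ih =>
    obtain ⟨m, hm⟩ := ih
    refine ⟨(br.compMultilinearMap m).uncurryRight, fun v => ?_⟩
    rw [MultilinearMap.uncurryRight_apply, LinearMap.compMultilinearMap_apply, hm, nested]
    rfl

theorem exists_multilinearMap_voronovBracket (k : ℕ) (d : Fin k → ℤ) :
    ∃ m : MultilinearMap K (fun _ : Fin k => L × L) (L × L),
      ∀ x, m x = voronovBracket br P 0 k d x := by
  rcases k with - | n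
  · exact ⟨0, fun x => rfl⟩
  have h1 : ∃ m : MultilinearMap K (fun _ : Fin (n + 1) => L × L) L,
      ∀ x, m x = (voronovBracket br P 0 (n + 1) d x).1 := by
    rcases n with - | - | n
    · exact ⟨0, fun x => by simp [voronovBracket]⟩
    · obtain ⟨m, hm⟩ := exists_multilinearMap_nested (br := br) 1
      refine ⟨negPow (d 0 + 1) • m.compLinearMap fun _ => LinearMap.fst K L L, fun x => ?_⟩
      simp [voronovBracket, hm, nested]
    · exact ⟨0, fun x => by simp [voronovBracket]⟩
  obtain ⟨m1, hm1⟩ := h1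
  obtain ⟨m, hm⟩ := exists_multilinearMap_nested (br := br) n
  -- The permutation `j.cycleRange.symm` takes `0` to `j` and `i.succ` to `j.succAbove i`, so it
  -- puts the `j`-th argument first.
  refine ⟨m1.prod (∑ j : Fin (n + 1), negPow (d j * ∑ i ∈ Finset.Iio j, d i) •
    P.compMultilinearMap ((m.compLinearMap (Fin.cons (LinearMap.fst K L L)
      fun _ => LinearMap.snd K L L : Fin (n + 1) → L × L →ₗ[K] L)).domDomCongr
        j.cycleRange.symm)), fun x => ?_⟩
  refine Prod.ext (by simpa using hm1 x) ?_
  have h : (voronovBracket br P 0 (n + 1) d x).2 = P (nested br (n + 1) 0 fun i => (x i).2) +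
      ∑ j : Fin (n + 1), negPow (d j * ∑ i ∈ Finset.Iio j, d i) •
        P (nested br n (x j).1 fun i => (x (j.succAbove i)).2) := rfl
  rw [h, nested_eq_nestL, map_zero, map_zero, zero_add]
  simp [hm]

theorem iSupIndep_desuspSum (h : iSupIndep 𝓛) (L' 𝔥 : Submodule K L) :
    iSupIndep (desuspSum 𝓛 L' 𝔥) := by
  intro i
  rw [Submodule.disjoint_def]
  rintro ⟨x, a⟩ hx hx'
  have hle : ⨆ j, ⨆ _ : j ≠ i, desuspSum 𝓛 L' 𝔥 j ≤
      (⨆ j, ⨆ _ : j ≠ i + 1, 𝓛 j).prod (⨆ j, ⨆ _ : j ≠ i, 𝓛 j) := by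
    refine iSup₂_le fun j hj => ?_
    rintro ⟨y, b⟩ ⟨hy, hb⟩
    exact ⟨Submodule.mem_iSup_of_mem (j + 1) (Submodule.mem_iSup_of_mem (by omega) hy.2),
      Submodule.mem_iSup_of_mem j (Submodule.mem_iSup_of_mem hj hb.2)⟩
  have hm := hle hx'
  have e1 := Submodule.disjoint_def.1 (h (i + 1)) x hx.1.2 hm.1
  have e2 := Submodule.disjoint_def.1 (h i) a hx.2.2 hm.2
  rw [e1, e2]
  rfl

theorem iSup_desuspSum {L' : Submodule K L} (hL' : ⨆ i, L' ⊓ 𝓛 i = L')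
    (hh : ⨆ i, 𝔥 ⊓ 𝓛 i = 𝔥) : ⨆ i, desuspSum 𝓛 L' 𝔥 i = L'.prod 𝔥 := by
  refine le_antisymm (iSup_le fun i => ?_) ?_
  · exact Submodule.prod_mono inf_le_left inf_le_left
  · have h1 : L' ≤ (⨆ i, desuspSum 𝓛 L' 𝔥 i).comap (LinearMap.inl K L L) := by
      conv_lhs => rw [← hL']
      refine iSup_le fun i x hx => Submodule.mem_iSup_of_mem (i - 1) ⟨?_, Submodule.zero_mem _⟩
      simpa using hx
    have h2 : 𝔥 ≤ (⨆ i, desuspSum 𝓛 L' 𝔥 i).comap (LinearMap.inr K L L) := by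
      conv_lhs => rw [← hh]
      exact iSup_le fun i x hx => Submodule.mem_iSup_of_mem i ⟨Submodule.zero_mem _, hx⟩
    rintro ⟨x, a⟩ ⟨hx, ha⟩
    have e1 : ((x, 0) : L × L) ∈ ⨆ i, desuspSum 𝓛 L' 𝔥 i := h1 hx
    have e2 : ((0, a) : L × L) ∈ ⨆ i, desuspSum 𝓛 L' 𝔥 i := h2 ha
    simpa using Submodule.add_mem _ e1 e2

/-- The first argument of an outer bracket is a computed value, not a letter of `α`. Applying
`voronovBracket_eq` over the tautological alphabet `ℤ × L × L` allows for it. -/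
theorem voronovBracket_cons {α : Type*} {deg : α → ℤ} {X A : α → L} {k : ℕ} (D : ℤ) (v : L × L)
    (e : Fin k → α) :
    voronovBracket br P 0 (k + 1) (Fin.cons D fun b => deg (e b))
        (Fin.cons v fun b => (X (e b), A (e b))) =
      (derivedLieCons br X D v.1 (List.ofFn e),
        derivedProjCons br P deg X A D v.1 v.2 (List.ofFn e)) := by
  have h := voronovBracket_eq (br := br) (P := P) (deg := fun u : ℤ × L × L => u.1)
    (X := fun u => u.2.1) (A := fun u => u.2.2)
    (Fin.cons (D, v) fun b => (deg (e b), X (e b), A (e b)) : Fin (k + 1) → ℤ × L × L)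
  have e1 : (fun i => ((Fin.cons (D, v) fun b => (deg (e b), X (e b), A (e b)) :
      Fin (k + 1) → ℤ × L × L) i).1) = (Fin.cons D fun b => deg (e b)) := by
    funext i
    cases i using Fin.cases <;> rfl
  have e2 : (fun i => ((Fin.cons (D, v) fun b => (deg (e b), X (e b), A (e b)) :
      Fin (k + 1) → ℤ × L × L) i).2) = (Fin.cons v fun b => (X (e b), A (e b))) := by
    funext i
    cases i using Fin.cases <;> rfl
  simp only [Prod.mk.eta, e1, e2] at h
  rw [h]
  have e3 : List.ofFn (Fin.cons (D, v) fun b => (deg (e b), X (e b), A (e b)) :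
      Fin (k + 1) → ℤ × L × L) =
      (D, v) :: (List.ofFn e).map fun b => (deg b, X b, A b) := by
    rw [List.ofFn_succ, List.map_ofFn]
    rfl
  rw [e3]
  refine Prod.ext ?_ ?_
  · rcases List.ofFn e with - | ⟨a, - | ⟨b, l⟩⟩ <;> rfl
  · simp only [derivedProj, derivedProjCons, pick, pick_map, List.map_map, Function.comp_def,
      List.map_cons]

theorem degL_ofFn {α : Type*} (deg : α → ℤ) {n : ℕ} (e : Fin n → α) :
    degL deg (List.ofFn e) = ∑ i, deg (e i) := by
  rw [degL, List.map_ofFn, List.sum_ofFn]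
  rfl

theorem IsVData.isLInfinityAlgebra (hV : IsVData 𝓛 br 𝔥 P 0) {L' : Submodule K L}
    (hL' : IsGradedLieSubalgebra 𝓛 br L') :
    IsLInfinityAlgebra (L'.prod 𝔥) (desuspSum 𝓛 L' 𝔥) (voronovBracket br P 0) := by
  -- The letters of the lists are homogeneous elements bundled with their degrees.
  set deg : (Σ d, desuspSum 𝓛 L' 𝔥 d) → ℤ := Sigma.fst with hdeg
  set X : (Σ d, desuspSum 𝓛 L' 𝔥 d) → L := fun e => (e.2 : L × L).1 with hXdef
  set A : (Σ d, desuspSum 𝓛 L' 𝔥 d) → L := fun e => (e.2 : L × L).2 with hAdef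
  have hX : ∀ u, X u ∈ 𝓛 (deg u + 1) := fun u => u.2.2.1.2
  have hX' : ∀ u, X u ∈ L' := fun u => u.2.2.1.1
  have hA : ∀ u, A u ∈ 𝓛 (deg u) := fun u => u.2.2.2.2
  have hA' : ∀ u, A u ∈ 𝔥 := fun u => u.2.2.2.1
  have hP' : ∀ x, P x ∈ 𝔥 := fun x => hV.range_eq ▸ LinearMap.mem_range_self P x
  have hpack : ∀ {k : ℕ} (d : Fin k → ℤ) (x : Fin k → L × L),
      (∀ i, x i ∈ desuspSum 𝓛 L' 𝔥 (d i)) →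
      ∃ e : Fin k → Σ d, desuspSum 𝓛 L' 𝔥 d, (d = fun i => deg (e i)) ∧
        x = fun i => (X (e i), A (e i)) :=
    fun d x h => ⟨fun i => ⟨d i, x i, h i⟩, rfl, rfl⟩
  refine ⟨iSupIndep_desuspSum hV.gradedLie.internal.submodule_iSupIndep L' 𝔥,
    iSup_desuspSum hL'.graded hV.subalgebra.graded, ?_, ?_, ?_, ?_⟩
  · intro k d _
    obtain ⟨m, hm⟩ := exists_multilinearMap_voronovBracket (br := br) (P := P) k d
    exact ⟨m.compLinearMap fun i => (desuspSum 𝓛 L' 𝔥 (d i)).subtype, fun x => hm _⟩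
  · intro k d x _ hx
    obtain ⟨e, rfl, rfl⟩ := hpack d x hx
    rw [voronovBracket_eq, ← degL_ofFn]
    refine ⟨⟨?_, ?_⟩, ?_, ?_⟩
    · rcases List.ofFn e with - | ⟨a, - | ⟨b, - | ⟨c, l⟩⟩⟩
      · exact L'.zero_mem
      · exact L'.zero_mem
      · exact zsmul_mem (hL'.closed _ (hX' a) _ (hX' b)) _
      · exact L'.zero_mem
    · rcases List.ofFn e with - | ⟨a, - | ⟨b, - | ⟨c, l⟩⟩⟩
      · exact Submodule.zero_mem _
      · exact Submodule.zero_mem _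
      · have := hV.gradedLie.degree _ _ _ _ (hX a) (hX b)
        rw [show deg a + 1 + (deg b + 1) = degL deg [a, b] + 1 + 1 by simp; ring] at this
        exact zsmul_mem this _
      · exact Submodule.zero_mem _
    · exact pick_mem deg 𝔥 fun y l' _ => hP' _
    · refine pick_mem deg _ fun y l' hp => hV.proj_degree _ _ ?_
      have := nestL_mem hV hA (hX y) l'
      rwa [← degL_perm deg hp, degL_cons, add_right_comm]
  · intro k d x σ _ hx
    obtain ⟨e, rfl, rfl⟩ := hpack d x hx
    rw [voronovBracket_eq, voronovBracket_eq,
      apply_perm_of_swap deg _ (derivedProj_swap hV hX hA hA'),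
      apply_perm_of_swap deg _ (derivedLie_swap hV hX)]
    rfl
  · intro n d x _ hx
    obtain ⟨e, rfl, rfl⟩ := hpack d x hx
    set F : List (Σ d, desuspSum 𝓛 L' 𝔥 d) → List (Σ d, desuspSum 𝓛 L' 𝔥 d) → L × L :=
      fun I O => (derivedLieCons br X (degL deg I + 1) (derivedLie br deg X I) O,
        derivedProjCons br P deg X A (degL deg I + 1) (derivedLie br deg X I)
          (derivedProj br P deg X A I) O) with hF
    have key : ∀ (i : Fin n) (σ : Equiv.Perm (Fin n)),
        voronovBracket br P 0 (n - (i + 1) + 1)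
          (Fin.cons (∑ a : Fin (i + 1), deg (e (σ ⟨a, by omega⟩)) + 1)
            fun b : Fin (n - (i + 1)) => deg (e (σ ⟨i + 1 + b, by omega⟩)))
          (Fin.cons
            (voronovBracket br P 0 (i + 1) (fun a => deg (e (σ ⟨a, by omega⟩)))
              (fun a => (X (e (σ ⟨a, by omega⟩)), A (e (σ ⟨a, by omega⟩)))))
            fun b : Fin (n - (i + 1)) =>
              (X (e (σ ⟨i + 1 + b, by omega⟩)), A (e (σ ⟨i + 1 + b, by omega⟩)))) =
        F ((List.ofFn fun a => e (σ a)).take (i + 1))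
          ((List.ofFn fun a => e (σ a)).drop (i + 1)) := by
      intro i σ
      rw [voronovBracket_eq (e := fun a : Fin (i + 1) => e (σ ⟨a, by omega⟩)),
        voronovBracket_cons (e := fun b : Fin (n - (i + 1)) => e (σ ⟨i + 1 + b, by omega⟩))]
      have h1 : (List.ofFn fun a => e (σ a)).take (i + 1) =
          List.ofFn fun a : Fin (i + 1) => e (σ ⟨a, by omega⟩) := by
        refine List.ext_getElem (by simp) fun k h1 h2 => ?_
        simp only [List.getElem_take, List.getElem_ofFn]
      have h2 : (List.ofFn fun a => e (σ a)).drop (i + 1) =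
          List.ofFn fun b : Fin (n - (i + 1)) => e (σ ⟨i + 1 + b, by omega⟩) := by
        refine List.ext_getElem (by simp) fun k h1 h2 => ?_
        simp only [List.getElem_drop, List.getElem_ofFn]
      rw [h1, h2, hF]
      simp only [degL_ofFn]
    simp only [key]
    -- The sum `shsum` also includes an empty inner bracket, which the `L_∞`-relation does not have;
    -- its contribution vanishes.
    have h0 : ∀ l, F [] l = 0 := by
      intro l
      refine Prod.ext ?_ ?_
      · rcases l with - | ⟨a, - | ⟨b, l⟩⟩ <;>
          simp [hF, derivedLieCons, derivedLie, ifPair, ifSingleton]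
      · simp [hF, derivedProjCons, derivedLie, ifPair, derivedProj, pick, pick_zero]
    have hsum : ∑ i : Fin n, ∑ σ ∈ shuffles n (i + 1) (n - (i + 1)),
        koszulSign σ (fun i => deg (e i)) •
          F ((List.ofFn fun a => e (σ a)).take (i + 1))
            ((List.ofFn fun a => e (σ a)).drop (i + 1)) =
        shsum deg F (List.ofFn e) := by
      rw [← sum_shl_eq_shsum deg F (List.ofFn e) n (by simp), Finset.sum_range_succ',
        shl_zero_left, List.take_zero, h0, add_zero, ← Fin.sum_univ_eq_sum_range (fun i =>
          shl deg (i + 1) (n - (i + 1)) (fun m => F (m.take (i + 1)) (m.drop (i + 1)))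
            (List.ofFn e)) n]
      refine Finset.sum_congr rfl fun i _ => ?_
      exact sum_shuffles_eq_shl deg (by omega) e
        (fun m => F (m.take (i + 1)) (m.drop (i + 1)))
    rw [hsum]
    refine Prod.ext ?_ ?_
    · exact (map_shsum deg (AddMonoidHom.fst L L) F _).trans (derivedLie_jacobi hV hX _)
    · exact (map_shsum deg (AddMonoidHom.snd L L) F _).trans (derivedProj_jacobi hV hX hA hA' _)

end DerivedBrackets

/-! ### The operation `∘̄` on functions of lists and its pre-Lie identity. -/

section ListCochains

variable {W U : Type*} [AddCommGroup U]

/-- The operation `P ∘̄ g` on functions of lists, where `g` has `m` arguments; for `m = 0` it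
inserts the element `g []` in the first place. -/
def circL : ℕ → (List W → U) → (List W → W) → List W → U
  | 0, P, g, l => P (g [] :: l)
  | _ + 1, _, _, [] => 0
  | m + 1, P, g, x :: l => negPow m • circL (m + 1) (fun l => P (x :: l)) g l +
      circL m P (fun l => g (x :: l)) l

theorem circL_zero (P : List W → U) (g : List W → W) (l : List W) :
    circL 0 P g l = P (g [] :: l) := by
  cases l <;> rfl

theorem circL_nil (m : ℕ) (P : List W → U) (g : List W → W) : circL (m + 1) P g [] = 0 := rfl

/-- The letter `x` goes either to `P`, where `g` of degree `m` passes it, or to `g`. When `g`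
receives its last letter its value is inserted at once, because in `∘_k` that letter directly
follows the shuffled ones. -/
theorem circL_cons (m : ℕ) (P : List W → U) (g : List W → W) (x : W) (l : List W) :
    circL (m + 1) P g (x :: l) = negPow m • circL (m + 1) (fun l => P (x :: l)) g l +
      circL m P (fun l => g (x :: l)) l := rfl

theorem circL_eq_zero_of_length_lt {m : ℕ} {P : List W → U} {g : List W → W} {l : List W}
    (h : l.length < m) : circL m P g l = 0 := by
  induction l generalizing m P g with
  | nil =>
    obtain ⟨m, rfl⟩ := Nat.exists_eq_succ_of_ne_zero (Nat.ne_of_gt h)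
    rfl
  | cons x l ih =>
    obtain ⟨m, rfl⟩ := Nat.exists_eq_succ_of_ne_zero (Nat.ne_of_gt (Nat.zero_lt_of_lt h))
    simp only [List.length_cons] at h
    rw [circL_cons, ih (by omega), ih (by omega), smul_zero, add_zero]

/-- Every list fed to `P` contains a value of `g`, so equality on nonempty lists suffices;
`circL_indep` relies on this. -/
theorem circL_congr {m : ℕ} {P P' : List W → U} {g g' : List W → W} {l : List W}
    (hP : ∀ k, k.length + m = l.length + 1 → k ≠ [] → P k = P' k)
    (hg : ∀ k, k.length = m → g k = g' k) : circL m P g l = circL m P' g' l := by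
  induction l generalizing m P P' g g' with
  | nil =>
    rcases m with - | m
    · rw [circL_zero, circL_zero, hg [] rfl, hP _ (by simp) (by simp)]
    · rfl
  | cons x l ih =>
    rcases m with - | m
    · rw [circL_zero, circL_zero, hg [] rfl, hP _ (by simp) (by simp)]
    · rw [circL_cons, circL_cons]
      simp only [List.length_cons] at hP
      rw [ih (P' := fun l => P' (x :: l)) (g' := g')
          (fun k hk _ => hP (x :: k) (by simp only [List.length_cons]; omega) (by simp)) hg,
        ih (P' := P') (g' := fun l => g' (x :: l)) (fun k hk => hP k (by omega))
          (fun k hk => hg (x :: k) (by simp only [List.length_cons]; omega))]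

theorem circL_add_left (m : ℕ) (P P' : List W → U) (g : List W → W) (l : List W) :
    circL m (fun l => P l + P' l) g l = circL m P g l + circL m P' g l := by
  induction l generalizing m P P' g with
  | nil => rcases m with - | m <;> simp [circL_zero, circL_nil]
  | cons x l ih =>
    rcases m with - | m
    · simp [circL_zero]
    · simp only [circL_cons, ih, smul_add]
      abel

theorem circL_smul_left (c : ℤ) (m : ℕ) (P : List W → U) (g : List W → W) (l : List W) :
    circL m (fun l => c • P l) g l = c • circL m P g l := by
  induction l generalizing m P g with
  | nil => rcases m with - | m <;> simp [circL_zero, circL_nil]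
  | cons x l ih =>
    rcases m with - | m
    · simp [circL_zero]
    · simp only [circL_cons, ih, smul_add, smul_comm c]

theorem circL_zero_left (m : ℕ) (g : List W → W) (l : List W) :
    circL m (fun _ => (0 : U)) g l = 0 := by
  simpa using circL_smul_left 0 m (fun _ => (0 : U)) g l

variable [AddCommGroup W]

/-- Additivity in all arguments of a function of lists. -/
def ListAdditive (P : List W → U) : Prop :=
  ∀ l a b m, P (l ++ (a + b) :: m) = P (l ++ a :: m) + P (l ++ b :: m)

theorem ListAdditive.cons {P : List W → U} (hP : ListAdditive P) (x : W) :
    ListAdditive fun l => P (x :: l) :=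
  fun l a b m => hP (x :: l) a b m

theorem ListAdditive.cons_add {P : List W → U} (hP : ListAdditive P) (a b : W) (l : List W) :
    P ((a + b) :: l) = P (a :: l) + P (b :: l) :=
  hP [] a b l

theorem ListAdditive.cons_zero {P : List W → U} (hP : ListAdditive P) (l : List W) :
    P (0 :: l) = 0 := by
  have := hP.cons_add 0 0 l
  simpa using this

theorem circL_add_right (m : ℕ) {P : List W → U} (hP : ListAdditive P) (g g' : List W → W)
    (l : List W) : circL m P (fun l => g l + g' l) l = circL m P g l + circL m P g' l := by
  induction l generalizing m P g g' with
  | nil => rcases m with - | m <;> simp [circL_zero, circL_nil, hP.cons_add]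
  | cons x l ih =>
    rcases m with - | m
    · simp [circL_zero, hP.cons_add]
    · simp only [circL_cons, ih _ hP, ih _ (hP.cons x), smul_add]
      abel

theorem circL_zero_right (m : ℕ) {P : List W → U} (hP : ListAdditive P) (l : List W) :
    circL m P (fun _ => 0) l = 0 := by
  have := circL_add_right m hP (fun _ => 0) (fun _ => 0) l
  simpa using this

theorem circL_neg_right (m : ℕ) {P : List W → U} (hP : ListAdditive P) (g : List W → W)
    (l : List W) : circL m P (fun l => -g l) l = -circL m P g l := by
  have := circL_add_right m hP g (fun l => -g l) l
  simp only [add_neg_cancel, circL_zero_right m hP] at this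
  exact (neg_eq_of_add_eq_zero_right this.symm).symm

theorem circL_negPow_smul_right (c : ℤ) (m : ℕ) {P : List W → U} (hP : ListAdditive P)
    (g : List W → W) (l : List W) :
    circL m P (fun l => negPow c • g l) l = negPow c • circL m P g l := by
  rcases Int.even_or_odd c with h | h
  · simp [negPow, Int.negOnePow_even c h]
  · simp [negPow, Int.negOnePow_odd c h, circL_neg_right m hP]

/-- The graded pre-Lie identity for `∘̄`. -/
theorem circL_preLie (q r : ℕ) {P : List W → U} (hP : ListAdditive P) (g h : List W → W)
    (l : List W) :
    circL (r + 1) (circL (q + 1) P g) h l - circL (q + r + 1) P (circL (r + 1) g h) l =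
      negPow (q * r) • (circL (q + 1) (circL (r + 1) P h) g l -
        circL (q + r + 1) P (circL (q + 1) h g) l) := by
  induction l generalizing P q r g h with
  | nil => simp [circL_nil]
  | cons x l ih =>
    have c1 : ∀ (m : ℕ) (Q : List W → U) (k : List W → W),
        (fun l => circL (m + 1) Q k (x :: l)) = fun l =>
          negPow m • circL (m + 1) (fun l => Q (x :: l)) k l + circL m Q (fun l => k (x :: l)) l :=
      fun _ _ _ => rfl
    have c2 : ∀ (m : ℕ) (Q : List W → W) (k : List W → W),
        (fun l => circL (m + 1) Q k (x :: l)) = fun l =>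
          negPow m • circL (m + 1) (fun l => Q (x :: l)) k l + circL m Q (fun l => k (x :: l)) l :=
      fun _ _ _ => rfl
    -- The terms in which `x` goes to `g`; those in which it goes to `h` follow by exchanging the
    -- two roles.
    have i2 : ∀ (q r : ℕ) (g h : List W → W),
        negPow r • (circL (r + 1) (circL q P fun l => g (x :: l)) h l -
          circL (q + r) P (circL (r + 1) (fun l => g (x :: l)) h) l) =
        negPow (q * r) • (circL q (circL (r + 1) P h) (fun l => g (x :: l)) l -
          circL (q + r) P (circL q h fun l => g (x :: l)) l) := by
      intro q r g h
      rcases q with - | q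
      · rw [circL_congr (m := 0 + r) (g := circL (r + 1) (fun l => g (x :: l)) h)
          (g' := fun _ => 0) (fun _ _ _ => rfl)
          (fun k hk => circL_eq_zero_of_length_lt (by omega)), circL_zero_right _ hP,
          circL_zero, circL_cons, Nat.zero_add, Nat.cast_zero, zero_mul, negPow_zero, one_smul,
          sub_zero]
        have e1 : circL 0 P (fun l => g (x :: l)) = fun l => P (g [x] :: l) :=
          funext fun l => circL_zero P _ l
        have e2 : circL 0 h (fun l => g (x :: l)) = fun l => h (g [x] :: l) :=
          funext fun l => circL_zero h _ l
        rw [e1, e2]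
        abel
      · rw [show q + 1 + r = q + r + 1 by omega, ih q r hP, negPow_smul_negPow_smul]
        congr 2
        push_cast
        ring
    have i1 := ih q r (hP.cons x) g h
    have i2' := i2 q r g h
    have i3 := congrArg (fun v => negPow (q * r) • v) (i2 r q h g)
    rw [add_comm r q, mul_comm (r : ℤ) q] at i3
    simp only [negPow_smul_self] at i3
    rw [circL_cons, circL_cons, circL_cons, circL_cons, c1, c1, c2, c2]
    rw [circL_add_left, circL_add_left, circL_add_right _ hP, circL_add_right _ hP,
      circL_smul_left, circL_smul_left, circL_negPow_smul_right _ _ hP,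
      circL_negPow_smul_right _ _ hP]
    push_cast
    rw [negPow_add q r]
    linear_combination (norm := module) (negPow q * negPow r) • i1 + i2' - i3

end ListCochains

/-! ### Comparison of the recursion with the sum over shuffles and insertion places. -/

section InsertLists

variable {W U : Type*}

theorem exists_ofFn (l : List W) (n : ℕ) (h : l.length = n) :
    ∃ x : Fin n → W, l = List.ofFn x := by
  subst h
  exact ⟨l.get, (List.ofFn_get l).symm⟩

/-- `F(x₀, …, x_{k-1}, G(x_k, …, x_{k+q}), x_{k+q+1}, …)`. -/
def insertL (k q : ℕ) (F : List W → U) (G : List W → W) (m : List W) : U :=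
  F (m.take k ++ G ((m.drop k).take (q + 1)) :: (m.drop k).drop (q + 1))

/-- A first letter kept by `F` comes from `k + 1` arguments in front of `G`, a first letter taken by
`G` lowers `q`. In the latter case passing `k` letters changes `(-1)^{kq}` into `(-1)^{k(q-1)}`, as
the recursion requires. -/
theorem circL_eq_sum_shl [AddCommGroup U] (p q : ℕ) (F : List W → U)
    (G : List W → W) (l : List W) (hl : l.length = p + q + 1) :
    circL (q + 1) F G l = ∑ k ∈ Finset.range (p + 1), negPow (k * q) •
      shl (fun _ => 1) k q (insertL k q F G) l := by
  induction l generalizing p q F G with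
  | nil => simp at hl
  | cons x l ih =>
    have hl : l.length = p + q := by simpa using hl
    rw [circL_cons, Finset.sum_range_succ']
    rcases q with - | q
    · have h2 : circL 0 F (fun l => G (x :: l)) l = F (G [x] :: l) := circL_zero F _ l
      rw [h2]
      simp only [Nat.cast_zero, mul_zero, negPow_zero, one_smul, shl_zero_right]
      congr 1
      rcases p with - | p
      · rw [circL_eq_zero_of_length_lt (by omega), Finset.range_zero, Finset.sum_empty]
      · rw [ih p 0 _ _ (by omega)]
        simp [insertL, negPow_zero, shl_zero_right]
    · rw [ih p q F (fun l => G (x :: l)) (by omega), Finset.sum_range_succ' _ p, ← add_assoc]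
      congr 1
      · have h1 : negPow ((q + 1 : ℕ) : ℤ) • circL (q + 1 + 1) (fun l => F (x :: l)) G l =
            ∑ k ∈ Finset.range p, negPow ((k + 1 : ℕ) * (q + 1 : ℕ)) •
              shl (fun _ => 1) k (q + 1) (insertL k (q + 1) (fun l => F (x :: l)) G) l := by
          rcases p with - | p
          · rw [circL_eq_zero_of_length_lt (by omega), Finset.range_zero, Finset.sum_empty,
              smul_zero]
          · rw [ih p (q + 1) _ _ (by omega), Finset.smul_sum]
            refine Finset.sum_congr rfl fun k _ => ?_
            rw [negPow_smul_negPow_smul]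
            congr 2
            push_cast
            ring
        rw [h1, ← Finset.sum_add_distrib]
        refine Finset.sum_congr rfl fun k hk => ?_
        have hk : k < p := Finset.mem_range.1 hk
        rw [shl_cons, smul_add]
        congr 1
        have h3 : shl (fun _ : W => 1) (k + 1) q (fun m => negPow (1 * degL (fun _ => 1)
            (m.take (k + 1))) • insertL (k + 1) (q + 1) F G (m.insertIdx (k + 1) x)) l =
            shl (fun _ : W => 1) (k + 1) q (fun m => negPow (k + 1) •
              insertL (k + 1) q F (fun l => G (x :: l)) m) l := by
          refine shl_congr _ _ _ _ _ _ (by omega) fun m hm => ?_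
          have hd : degL (fun _ : W => 1) (m.take (k + 1)) = k + 1 := by
            simp [degL]
            omega
          rw [hd, one_mul]
          simp only [insertL]
          rw [take_insertIdx, drop_insertIdx _ _ _ (by omega)]
          simp
        rw [h3, shl_smul, negPow_smul_negPow_smul]
        congr 1
        refine negPow_congr ⟨-(k + 1), ?_⟩
        push_cast
        ring
      · simp [shl_zero_left, insertL, negPow_zero]

end InsertLists

/-! ### Cochains as functions of lists. -/

section ListEvaluation

variable {K : Type*} [Field K] {W : Type*} [AddCommGroup W] [Module K W]

/-- The value `f(x₀, …, xₙ)` as a function of the list `x₀, …, xₙ`. -/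
def evalList (f : Cochains K W) : List W → W
  | [] => 0
  | x :: l => f l.length (x :: l).get

theorem cochains_apply_congr (f : Cochains K W) {m n : ℕ} (h : m = n) (y : Fin (m + 1) → W)
    (x : Fin (n + 1) → W) (hxy : ∀ i : Fin (m + 1), y i = x ⟨i, by omega⟩) : f m y = f n x := by
  subst h
  exact congrArg _ (funext hxy)

theorem evalList_ofFn (f : Cochains K W) {n : ℕ} (x : Fin (n + 1) → W) :
    evalList f (List.ofFn x) = f n x := by
  have h : ∀ (l : List W) (_ : l = List.ofFn x), evalList f l = f n x := by
    intro l hl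
    rcases l with - | ⟨a, l⟩
    · simp at hl
    · have hlen : l.length = n := by simpa using congrArg List.length hl
      refine cochains_apply_congr f hlen _ _ fun i => ?_
      simp [hl, -List.ofFn_succ]
  exact h _ rfl

theorem evalList_injective {f g : Cochains K W} (h : ∀ l, evalList f l = evalList g l) :
    f = g := by
  refine DFinsupp.ext fun n => MultilinearMap.ext fun x => ?_
  rw [← evalList_ofFn, ← evalList_ofFn, h]

theorem evalList_add (f g : Cochains K W) (l : List W) :
    evalList (f + g) l = evalList f l + evalList g l := by
  cases l with
  | nil => simp [evalList]
  | cons x l => rw [evalList, DirectSum.add_apply]; rfl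

/-- Evaluation on a list, as an additive map. -/
def evalListHom (l : List W) : Cochains K W →+ W where
  toFun f := evalList f l
  map_zero' := by
    have := evalList_add (0 : Cochains K W) 0 l
    simpa using this
  map_add' f g := evalList_add f g l

theorem evalList_sub (f g : Cochains K W) (l : List W) :
    evalList (f - g) l = evalList f l - evalList g l :=
  map_sub (evalListHom l) f g

theorem evalList_zsmul (c : ℤ) (f : Cochains K W) (l : List W) :
    evalList (c • f) l = c • evalList f l :=
  map_zsmul (evalListHom l) c f

/-- A homogeneous cochain as a function of lists. -/
def evalLof {p : ℕ} (f : Cochain K W p) : List W → W :=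
  evalList (DirectSum.lof K ℕ (Cochain K W) p f)

theorem evalLof_ofFn {p : ℕ} (f : Cochain K W p) (x : Fin (p + 1) → W) :
    evalLof f (List.ofFn x) = f x := by
  rw [evalLof, evalList_ofFn, DirectSum.lof_apply]

theorem evalLof_of_length_ne {p : ℕ} (f : Cochain K W p) {l : List W} (h : l.length ≠ p + 1) :
    evalLof f l = 0 := by
  rcases l with - | ⟨x, l⟩
  · rfl
  · have : DirectSum.lof K ℕ (Cochain K W) p f l.length = 0 :=
      DFinsupp.single_eq_of_ne (by simpa using h)
    rw [evalLof, evalList, this]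
    rfl

theorem listAdditive_evalLof {p : ℕ} (f : Cochain K W p) : ListAdditive (evalLof f) := by
  intro l a b m
  by_cases h : l.length + m.length = p
  · have hl : ∀ c, (l ++ c :: m).length = p + 1 := fun c => by simp; omega
    obtain ⟨x, hx⟩ := exists_ofFn _ _ (hl 0)
    have hu : ∀ c, l ++ c :: m = List.ofFn (Function.update x ⟨l.length, by omega⟩ c) := by
      intro c
      refine List.ext_getElem (by simp; omega) fun k h1 h2 => ?_
      have hk : k < p + 1 := by simpa using h2
      have hxk : x ⟨k, hk⟩ = (l ++ 0 :: m)[k]'(by rw [hl]; exact hk) := by simp [hx, -List.ofFn_succ]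
      rw [List.getElem_ofFn, Function.update_apply]
      split_ifs with hkl
      · have : k = l.length := congrArg Fin.val hkl
        subst this
        simp
      · have hne : k ≠ l.length := fun h => hkl (Fin.ext h)
        rw [hxk]
        simp only [List.getElem_append]
        split_ifs with h3
        · rfl
        · obtain ⟨j, hj⟩ : ∃ j, k - l.length = j + 1 := ⟨k - l.length - 1, by omega⟩
          simp [hj]
    rw [hu, hu, hu, evalLof_ofFn, evalLof_ofFn, evalLof_ofFn, MultilinearMap.map_update_add]
  · have hl : ∀ c, (l ++ c :: m).length ≠ p + 1 := fun c => by simp; omega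
    rw [evalLof_of_length_ne f (hl _), evalLof_of_length_ne f (hl _),
      evalLof_of_length_ne f (hl _), add_zero]

theorem insertAt_eq_insertL {p q : ℕ} (f : Cochain K W p) (g : Cochain K W q) (k : Fin (p + 1))
    (x : Fin (p + q + 1) → W) :
    f (outerArgs q k x (g (innerArgs q k x))) =
      insertL k q (evalLof f) (evalLof g) (List.ofFn x) := by
  have h1 : ((List.ofFn x).drop k).take (q + 1) = List.ofFn (innerArgs q k x) := by
    refine List.ext_getElem (by simp; omega) fun j h1 h2 => ?_
    simp [innerArgs, -List.ofFn_succ]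
  rw [insertL, h1, evalLof_ofFn]
  generalize g (innerArgs q k x) = y
  have h2 : (List.ofFn x).take k ++ y :: ((List.ofFn x).drop k).drop (q + 1) =
      List.ofFn (outerArgs q k x y) := by
    refine List.ext_getElem (by simp; omega) fun j h1 h2 => ?_
    have hj : j < p + 1 := by simpa using h2
    rw [List.getElem_ofFn]
    simp only [List.getElem_append, outerArgs, Fin.lt_def, Fin.ext_iff, List.length_take,
      List.length_ofFn]
    rcases lt_trichotomy j k with h | h | h
    · rw [dif_pos (by omega), if_pos h]
      simp [-List.ofFn_succ]
    · rw [dif_neg (by omega), if_neg (by omega), if_pos h]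
      have : j - min (k : ℕ) (p + q + 1) = 0 := by omega
      simp [this]
    · rw [dif_neg (by omega), if_neg (by omega), if_neg (by omega)]
      obtain ⟨i, hi⟩ : ∃ i, j - min (k : ℕ) (p + q + 1) = i + 1 :=
        ⟨j - min (k : ℕ) (p + q + 1) - 1, by omega⟩
      simp only [hi, List.getElem_cons_succ, List.getElem_drop, List.getElem_ofFn]
      congr 2
      omega
  rw [h2, evalLof_ofFn]

/-- The bridge from `circ` to the recursion: its permutation signs are Koszul signs for letters that
all have degree one. -/
theorem evalLof_circ {p q : ℕ} (f : Cochain K W p) (g : Cochain K W q) (l : List W) :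
    evalLof (circ f g) l = circL (q + 1) (evalLof f) (evalLof g) l := by
  by_cases h : l.length = p + q + 1
  · obtain ⟨x, rfl⟩ := exists_ofFn l _ h
    rw [evalLof_ofFn, circ_apply, circL_eq_sum_shl p q _ _ _ h, Finset.sum_range]
    refine Finset.sum_congr rfl fun k _ => ?_
    rw [← sum_shuffles_eq_shl _ (by omega), Finset.smul_sum]
    refine Finset.sum_congr rfl fun σ _ => ?_
    rw [insertAt_eq_insertL, mul_smul, koszulSign_const_one]
  · rw [evalLof_of_length_ne _ h, circL_congr (P' := fun _ => 0) (g' := evalLof g)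
      (fun k hk _ => evalLof_of_length_ne f (by omega)) (fun _ _ => rfl), circL_zero_left]

end ListEvaluation

/-! ### The Balavoine graded Lie algebra. -/

section GradedLie

variable {K : Type*} [Field K] {W : Type*} [AddCommGroup W] [Module K W]

theorem lof_mem_cochainGrading (n : ℕ) (f : Cochain K W n) :
    DirectSum.lof K ℕ (Cochain K W) n f ∈ cochainGrading K W n := by
  intro m hm
  exact DFinsupp.single_eq_of_ne (by exact_mod_cast hm)

theorem eq_zero_or_eq_lof {i : ℤ} {f : Cochains K W} (hf : f ∈ cochainGrading K W i) :
    f = 0 ∨ ∃ (n : ℕ) (g : Cochain K W n), i = n ∧ f = DirectSum.lof K ℕ (Cochain K W) n g := by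
  rcases lt_or_ge i 0 with hi | hi
  · exact Or.inl (DFinsupp.ext fun n => hf n (by omega))
  · obtain ⟨n, rfl⟩ := Int.eq_ofNat_of_zero_le hi
    refine Or.inr ⟨n, f n, rfl, DFinsupp.ext fun m => ?_⟩
    by_cases h : m = n
    · subst h
      exact (DirectSum.lof_apply K m (f m)).symm
    · rw [hf m (by exact_mod_cast h)]
      exact (DFinsupp.single_eq_of_ne h).symm

theorem isInternal_cochainGrading : DirectSum.IsInternal (cochainGrading K W) := by
  rw [DirectSum.isInternal_submodule_iff_iSupIndep_and_iSup_eq_top]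
  constructor
  · intro i
    rw [Submodule.disjoint_def]
    intro f hf hf'
    have hle : ⨆ j, ⨆ _ : j ≠ i, cochainGrading K W j ≤
        ⨅ n : ℕ, ⨅ _ : (n : ℤ) = i, LinearMap.ker (DirectSum.component K ℕ (Cochain K W) n) := by
      refine iSup₂_le fun j hj g hg => ?_
      simp only [Submodule.mem_iInf, LinearMap.mem_ker]
      intro n hn
      exact hg n (by rw [hn]; exact hj.symm)
    have hm := hle hf'
    simp only [Submodule.mem_iInf, LinearMap.mem_ker] at hm
    refine DFinsupp.ext fun n => ?_
    by_cases h : (n : ℤ) = i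
    · exact hm n h
    · exact hf n h
  · rw [eq_top_iff]
    rintro f -
    induction f using DirectSum.induction_on with
    | zero => exact Submodule.zero_mem _
    | of n g => exact Submodule.mem_iSup_of_mem (n : ℤ) (lof_mem_cochainGrading n g)
    | add f g hf hg => exact Submodule.add_mem _ hf hg

theorem balavoineBracket_degree (i j : ℤ) (x y : Cochains K W) (hx : x ∈ cochainGrading K W i)
    (hy : y ∈ cochainGrading K W j) :
    balavoineBracket K W x y ∈ cochainGrading K W (i + j) := by
  rcases eq_zero_or_eq_lof hx with rfl | ⟨p, f, rfl, rfl⟩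
  · simp
  rcases eq_zero_or_eq_lof hy with rfl | ⟨q, g, rfl, rfl⟩
  · simp
  rw [balavoineBracket_lof]
  refine Submodule.sub_mem _ ?_ (zsmul_mem ?_ _)
  · exact_mod_cast lof_mem_cochainGrading (p + q) (circ f g)
  · rw [add_comm]
    exact_mod_cast lof_mem_cochainGrading (q + p) (circ g f)

theorem balavoineBracket_antisymm (i j : ℤ) (x y : Cochains K W) (hx : x ∈ cochainGrading K W i)
    (hy : y ∈ cochainGrading K W j) :
    balavoineBracket K W x y = -(negPow (i * j) • balavoineBracket K W y x) := by
  rcases eq_zero_or_eq_lof hx with rfl | ⟨p, f, rfl, rfl⟩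
  · simp
  rcases eq_zero_or_eq_lof hy with rfl | ⟨q, g, rfl, rfl⟩
  · simp
  rw [balavoineBracket_lof, balavoineBracket_lof, mul_comm (q : ℤ), smul_sub, negPow_smul_self,
    neg_sub]

theorem evalLof_preLie {p q r : ℕ} (f : Cochain K W p) (g : Cochain K W q) (h : Cochain K W r)
    (l : List W) :
    evalLof (circ (circ f g) h) l - evalLof (circ f (circ g h)) l =
      negPow (q * r) • (evalLof (circ (circ f h) g) l - evalLof (circ f (circ h g)) l) := by
  have e : ∀ {m n : ℕ} (a : Cochain K W m) (b : Cochain K W n),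
      evalLof (circ a b) = circL (n + 1) (evalLof a) (evalLof b) :=
    fun a b => funext (evalLof_circ a b)
  simp only [e]
  rw [add_comm r q]
  exact circL_preLie q r (listAdditive_evalLof f) (evalLof g) (evalLof h) l

theorem negPow_eq_one_or (a : ℤ) : negPow a = 1 ∨ negPow a = -1 := by
  rcases Int.even_or_odd a with h | h
  · exact Or.inl (by simp [negPow, Int.negOnePow_even a h])
  · exact Or.inr (by simp [negPow, Int.negOnePow_odd a h])

theorem balavoineBracket_jacobi (i j k : ℤ) (x y z : Cochains K W)
    (hx : x ∈ cochainGrading K W i) (hy : y ∈ cochainGrading K W j)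
    (hz : z ∈ cochainGrading K W k) :
    balavoineBracket K W x (balavoineBracket K W y z) =
      balavoineBracket K W (balavoineBracket K W x y) z +
        negPow (i * j) • balavoineBracket K W y (balavoineBracket K W x z) := by
  rcases eq_zero_or_eq_lof hx with rfl | ⟨p, f, rfl, rfl⟩
  · simp
  rcases eq_zero_or_eq_lof hy with rfl | ⟨q, g, rfl, rfl⟩
  · simp
  rcases eq_zero_or_eq_lof hz with rfl | ⟨r, h, rfl, rfl⟩
  · simp
  simp only [balavoineBracket_lof, map_sub, map_zsmul, LinearMap.sub_apply, LinearMap.smul_apply]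
  refine evalList_injective fun l => ?_
  simp only [evalList_add, evalList_sub, evalList_zsmul]
  -- The Jacobi identity is a signed combination of three pre-Lie identities, one for each choice of
  -- the outermost cochain.
  have e1 := evalLof_preLie f g h l
  have e2 := evalLof_preLie g f h l
  have e3 := evalLof_preLie h f g l
  simp only [evalLof] at e1 e2 e3
  push_cast
  simp only [mul_add, add_mul, negPow_add]
  rw [mul_comm (q : ℤ) p]
  -- The square of `(-1)^{pq}` occurs; fixing its value leaves an identity that is linear in the
  -- compositions.
  rcases negPow_eq_one_or ((p : ℤ) * q) with ha | ha <;> rw [ha] at e3 ⊢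
  · linear_combination (norm := module) (-1 : ℤ) • e1 + e2 -
      (negPow (p * r) * negPow (q * r)) • e3
  · linear_combination (norm := module) (-1 : ℤ) • e1 - e2 -
      (negPow (p * r) * negPow (q * r)) • e3

theorem isGradedLieAlgebra_cochains :
    IsGradedLieAlgebra (cochainGrading K W) (balavoineBracket K W) where
  internal := isInternal_cochainGrading
  degree := balavoineBracket_degree
  antisymm := balavoineBracket_antisymm
  jacobi := balavoineBracket_jacobi

section Components

variable {M M' : Submodule K (Cochains K W)} {N N' : ∀ n, Submodule K (Cochain K W n)}

theorem lof_mem_of_mem (hM : ∀ f, f ∈ M ↔ ∀ n, f n ∈ N n) {n : ℕ} {f : Cochain K W n}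
    (hf : f ∈ N n) : DirectSum.lof K ℕ (Cochain K W) n f ∈ M := by
  rw [hM]
  intro m
  by_cases h : m = n
  · subst h
    rwa [DirectSum.lof_apply]
  · have : DirectSum.lof K ℕ (Cochain K W) n f m = 0 := DFinsupp.single_eq_of_ne h
    rw [this]
    exact Submodule.zero_mem _

theorem mem_of_lof_mem (S : Submodule K (Cochains K W)) (f : Cochains K W)
    (h : ∀ n, DirectSum.lof K ℕ (Cochain K W) n (f n) ∈ S) : f ∈ S := by
  classical
  rw [← DirectSum.sum_support_of f]
  exact Submodule.sum_mem _ fun n _ => h n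

theorem iSup_inf_cochainGrading (hM : ∀ f, f ∈ M ↔ ∀ n, f n ∈ N n) :
    ⨆ i, M ⊓ cochainGrading K W i = M := by
  refine le_antisymm (iSup_le fun i => inf_le_left) fun f hf => ?_
  exact mem_of_lof_mem _ f fun n => Submodule.mem_iSup_of_mem (n : ℤ)
    ⟨lof_mem_of_mem hM ((hM f).1 hf n), lof_mem_cochainGrading n _⟩

theorem balavoineBracket_mem (hM : ∀ f, f ∈ M ↔ ∀ n, f n ∈ N n)
    (hN : ∀ (p q : ℕ) (f : Cochain K W p) (g : Cochain K W q), f ∈ N p → g ∈ N q →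
      circ f g ∈ N (p + q)) (x : Cochains K W) (hx : x ∈ M) (y : Cochains K W) (hy : y ∈ M) :
    balavoineBracket K W x y ∈ M := by
  have h1 : x ∈ M.comap ((balavoineBracket K W).flip y) := by
    refine mem_of_lof_mem _ x fun p => ?_
    have h2 : y ∈ M.comap (balavoineBracket K W (DirectSum.lof K ℕ (Cochain K W) p (x p))) := by
      refine mem_of_lof_mem _ y fun q => ?_
      have hp := (hM x).1 hx p
      have hq := (hM y).1 hy q
      rw [Submodule.mem_comap, balavoineBracket_lof]
      exact M.sub_mem (lof_mem_of_mem hM (hN _ _ _ _ hp hq))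
        (zsmul_mem (lof_mem_of_mem hM (hN _ _ _ _ hq hp)) _)
    exact h2
  exact h1

theorem balavoineBracket_eq_zero (hM : ∀ f, f ∈ M ↔ ∀ n, f n ∈ N n)
    (hN : ∀ (p q : ℕ) (f : Cochain K W p) (g : Cochain K W q), f ∈ N p → g ∈ N q →
      circ f g = 0) (x : Cochains K W) (hx : x ∈ M) (y : Cochains K W) (hy : y ∈ M) :
    balavoineBracket K W x y = 0 := by
  have h1 : x ∈ LinearMap.ker ((balavoineBracket K W).flip y) := by
    refine mem_of_lof_mem _ x fun p => ?_
    have h2 : y ∈ LinearMap.ker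
        (balavoineBracket K W (DirectSum.lof K ℕ (Cochain K W) p (x p))) := by
      refine mem_of_lof_mem _ y fun q => ?_
      have hp := (hM x).1 hx p
      have hq := (hM y).1 hy q
      rw [LinearMap.mem_ker, balavoineBracket_lof, hN _ _ _ _ hp hq, hN _ _ _ _ hq hp]
      simp
    exact h2
  exact h1

end Components

end GradedLie

/-! ### The V-data. -/

section VData

variable (K : Type*) [Field K] (𝔤 : Type*) [AddCommGroup 𝔤] [Module K 𝔤]
  (V : Type*) [AddCommGroup V] [Module K V]

theorem mem_subspaceH (f : Cochains K (𝔤 × V)) :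
    f ∈ subspaceH K 𝔤 V ↔ ∀ n, f n ∈ LinearMap.range (liftH K 𝔤 V n) := Iff.rfl

theorem mem_subspaceL' (f : Cochains K (𝔤 × V)) :
    f ∈ subspaceL' K 𝔤 V ↔ ∀ n, f n ∈ LinearMap.range (liftL K 𝔤 V n) := Iff.rfl

theorem projH_apply (f : Cochains K (𝔤 × V)) (n : ℕ) :
    projH K 𝔤 V f n = projHComponent K 𝔤 V n (f n) := by
  simp [projH]

theorem projH_lof (n : ℕ) (f : Cochain K (𝔤 × V) n) :
    projH K 𝔤 V (DirectSum.lof K ℕ (Cochain K (𝔤 × V)) n f) =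
      DirectSum.lof K ℕ (Cochain K (𝔤 × V)) n (projHComponent K 𝔤 V n f) := by
  simp [projH]

theorem mem_ker_projH (f : Cochains K (𝔤 × V)) :
    f ∈ LinearMap.ker (projH K 𝔤 V) ↔
      ∀ n, f n ∈ LinearMap.ker (projHComponent K 𝔤 V n) := by
  simp only [LinearMap.mem_ker, ← projH_apply]
  exact ⟨fun h n => by rw [h]; rfl, fun h => DFinsupp.ext h⟩

variable {K 𝔤 V}

theorem liftH_apply (n : ℕ) (c : MultilinearMap K (fun _ : Fin (n + 1) => V) 𝔤)
    (w : Fin (n + 1) → 𝔤 × V) : liftH K 𝔤 V n c w = (c fun i => (w i).2, 0) := by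
  simp [liftH]

theorem projHComponent_apply (n : ℕ) (f : Cochain K (𝔤 × V) n) (w : Fin (n + 1) → 𝔤 × V) :
    projHComponent K 𝔤 V n f w = ((f fun i => (0, (w i).2)).1, 0) := by
  simp [projHComponent, liftH_apply]

theorem mem_ker_projHComponent (n : ℕ) (f : Cochain K (𝔤 × V) n) :
    f ∈ LinearMap.ker (projHComponent K 𝔤 V n) ↔
      ∀ w : Fin (n + 1) → 𝔤 × V, (∀ i, (w i).1 = 0) → (f w).1 = 0 := by
  rw [LinearMap.mem_ker]
  constructor
  · intro h w hw
    have := congrArg (fun g : Cochain K (𝔤 × V) n => (g w).1) h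
    simp only [projHComponent_apply] at this
    have e : (fun i => ((0 : 𝔤), (w i).2)) = w := funext fun i => Prod.ext (hw i).symm rfl
    rwa [e] at this
  · intro h
    refine MultilinearMap.ext fun w => ?_
    rw [projHComponent_apply, h _ fun i => rfl]
    rfl

/-- On arguments from `V` the inner cochain has its value in `V`, so the outer one again sees only
arguments from `V`. -/
theorem circ_mem_ker_projHComponent (p q : ℕ) (f : Cochain K (𝔤 × V) p)
    (g : Cochain K (𝔤 × V) q) (hf : f ∈ LinearMap.ker (projHComponent K 𝔤 V p))
    (hg : g ∈ LinearMap.ker (projHComponent K 𝔤 V q)) :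
    circ f g ∈ LinearMap.ker (projHComponent K 𝔤 V (p + q)) := by
  rw [mem_ker_projHComponent] at hf hg ⊢
  intro w hw
  rw [circ_apply, Prod.fst_sum]
  refine Finset.sum_eq_zero fun k _ => ?_
  rw [Prod.fst_sum]
  refine Finset.sum_eq_zero fun σ _ => ?_
  rw [Prod.smul_fst, hf, smul_zero]
  intro i
  simp only [outerArgs]
  split_ifs
  · exact hw _
  · exact hg _ fun j => hw _
  · exact hw _

/-- The inner value lies in `𝔤`, while the outer cochain reads only `V`-components and so has a zero
argument. -/
theorem circ_eq_zero_of_mem_range_liftH (p q : ℕ) (f : Cochain K (𝔤 × V) p)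
    (g : Cochain K (𝔤 × V) q) (hf : f ∈ LinearMap.range (liftH K 𝔤 V p))
    (hg : g ∈ LinearMap.range (liftH K 𝔤 V q)) : circ f g = 0 := by
  obtain ⟨c, rfl⟩ := hf
  obtain ⟨d, rfl⟩ := hg
  refine MultilinearMap.ext fun w => ?_
  rw [circ_apply]
  refine Finset.sum_eq_zero fun k _ => Finset.sum_eq_zero fun σ _ => ?_
  rw [liftH_apply, c.map_coord_zero k (by simp [outerArgs, liftH_apply])]
  exact smul_zero _

theorem projHComponent_mem_range (n : ℕ) (f : Cochain K (𝔤 × V) n) :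
    projHComponent K 𝔤 V n f ∈ LinearMap.range (liftH K 𝔤 V n) :=
  ⟨_, rfl⟩

theorem projHComponent_liftH (n : ℕ) (c : MultilinearMap K (fun _ : Fin (n + 1) => V) 𝔤) :
    projHComponent K 𝔤 V n (liftH K 𝔤 V n c) = liftH K 𝔤 V n c := by
  refine MultilinearMap.ext fun w => ?_
  simp [projHComponent_apply, liftH_apply]

theorem isVData_cochains :
    IsVData (cochainGrading K (𝔤 × V)) (balavoineBracket K (𝔤 × V)) (subspaceH K 𝔤 V)
      (projH K 𝔤 V) 0 := by
  have hz := balavoineBracket_eq_zero (mem_subspaceH K 𝔤 V) circ_eq_zero_of_mem_range_liftH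
  refine ⟨isGradedLieAlgebra_cochains, ⟨iSup_inf_cochainGrading (mem_subspaceH K 𝔤 V),
    fun x hx y hy => ?_⟩, hz, fun i x hx n hn => ?_, ?_, ?_,
    ⟨iSup_inf_cochainGrading (mem_ker_projH K 𝔤 V), balavoineBracket_mem (mem_ker_projH K 𝔤 V)
      circ_mem_ker_projHComponent⟩, map_zero _, Submodule.zero_mem _, map_zero _⟩
  · rw [hz x hx y hy]
    exact Submodule.zero_mem _
  · rw [projH_apply, hx n hn, map_zero]
  · refine LinearMap.ext fun f => DFinsupp.ext fun n => ?_
    rw [LinearMap.comp_apply, projH_apply, projH_apply]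
    obtain ⟨c, hc⟩ := projHComponent_mem_range n (f n)
    rw [← hc, projHComponent_liftH]
  · ext f
    constructor
    · rintro ⟨g, rfl⟩ n
      rw [projH_apply]
      exact projHComponent_mem_range n _
    · intro hf
      refine ⟨f, DFinsupp.ext fun n => ?_⟩
      obtain ⟨c, hc⟩ := hf n
      rw [projH_apply, ← hc, projHComponent_liftH]

end VData

/-! ### Stability of the defining conditions of `L'` under `∘̄`. -/

section LieType

variable {G V : Type*} [AddCommGroup G] [AddCommGroup V]

/-- The property of a function of lists of vectors in `𝔤 ⊕ V` of being given by alternating maps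
`Hom(⋀ⁿ⁺¹ 𝔤, 𝔤)` and `Hom(⋀ⁿ 𝔤 ⊗ V, V)`. -/
structure IsLieType (F : List (G × V) → G × V) : Prop where
  indep : ∀ l w y m, F (l ++ w :: y :: m) = F (l ++ (w.1, 0) :: y :: m)
  last_fst : ∀ l w, (F (l ++ [w])).1 = (F (l ++ [(w.1, 0)])).1
  last_snd : ∀ l w, (F (l ++ [w])).2 = (F (l ++ [(0, w.2)])).2
  alt : ∀ l w y m, F (l ++ w :: w :: y :: m) = 0
  alt_last : ∀ l w, (F (l ++ [w, w])).1 = 0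

variable {P Q : List (G × V) → G × V}

theorem IsLieType.cons (hP : IsLieType P) (x : G × V) : IsLieType fun l => P (x :: l) where
  indep l := hP.indep (x :: l)
  last_fst l := hP.last_fst (x :: l)
  last_snd l := hP.last_snd (x :: l)
  alt l := hP.alt (x :: l)
  alt_last l := hP.alt_last (x :: l)

theorem circL_singleton (q : ℕ) (P Q : List (G × V) → G × V) (w : G × V) :
    circL (q + 1) P Q [w] = if q = 0 then P [Q [w]] else 0 := by
  rcases q with - | q <;> simp [circL_cons, circL_nil, circL_zero]

/-- The only delicate case is `w` being the last argument of `Q`. The value of `Q` is then followed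
by `y`, so `P` sees only its `𝔤`-component, which does not depend on the `V`-component of `w`. -/
theorem circL_indep (q : ℕ) (hP : IsLieType P) (hQ : IsLieType Q) (l : List (G × V))
    (w y : G × V) (m : List (G × V)) :
    circL (q + 1) P Q (l ++ w :: y :: m) = circL (q + 1) P Q (l ++ (w.1, 0) :: y :: m) := by
  induction l generalizing q P Q with
  | nil =>
    simp only [List.nil_append, circL_cons q P Q]
    congr 1
    · congr 1
      refine circL_congr (fun k _ hk => ?_) fun _ _ => rfl
      obtain ⟨z, k, rfl⟩ := List.exists_cons_of_ne_nil hk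
      exact hP.indep [] w z k
    · rcases q with - | q
      · rw [circL_zero, circL_zero]
        have h1 := hP.indep [] (Q [w]) y m
        have h2 := hP.indep [] (Q [(w.1, 0)]) y m
        have h3 := hQ.last_fst [] w
        simp only [List.nil_append] at h1 h2 h3
        rw [h1, h2, h3]
      · refine circL_congr (fun _ _ _ => rfl) fun k hk => ?_
        obtain ⟨z, k, rfl⟩ := List.exists_cons_of_length_eq_add_one hk
        exact hQ.indep [] w z k
  | cons x l ih =>
    simp only [List.cons_append, circL_cons q P Q]
    congr 1
    · rw [ih q (hP.cons x) hQ]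
    · rcases q with - | q
      · simpa only [circL_zero, List.cons_append] using hP.indep (Q [x] :: l) w y m
      · exact ih q hP (hQ.cons x)

theorem circL_last_fst (q : ℕ) (hP : IsLieType P) (hQ : IsLieType Q) (l : List (G × V))
    (w : G × V) :
    (circL (q + 1) P Q (l ++ [w])).1 = (circL (q + 1) P Q (l ++ [(w.1, 0)])).1 := by
  induction l generalizing q P Q with
  | nil =>
    simp only [List.nil_append, circL_singleton]
    split_ifs
    · have h1 := hP.last_fst [] (Q [w])
      have h2 := hP.last_fst [] (Q [(w.1, 0)])
      have h3 := hQ.last_fst [] w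
      simp only [List.nil_append] at h1 h2 h3
      rw [h1, h2, h3]
    · rfl
  | cons x l ih =>
    simp only [List.cons_append, circL_cons q P Q, Prod.fst_add, Prod.smul_fst]
    congr 1
    · rw [ih q (hP.cons x) hQ]
    · rcases q with - | q
      · simpa only [circL_zero, List.cons_append] using hP.last_fst (Q [x] :: l) w
      · exact ih q hP (hQ.cons x)

theorem circL_last_snd (q : ℕ) (hP : IsLieType P) (hQ : IsLieType Q) (l : List (G × V))
    (w : G × V) :
    (circL (q + 1) P Q (l ++ [w])).2 = (circL (q + 1) P Q (l ++ [(0, w.2)])).2 := by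
  induction l generalizing q P Q with
  | nil =>
    simp only [List.nil_append, circL_singleton]
    split_ifs
    · have h1 := hP.last_snd [] (Q [w])
      have h2 := hP.last_snd [] (Q [(0, w.2)])
      have h3 := hQ.last_snd [] w
      simp only [List.nil_append] at h1 h2 h3
      rw [h1, h2, h3]
    · rfl
  | cons x l ih =>
    simp only [List.cons_append, circL_cons q P Q, Prod.snd_add, Prod.smul_snd]
    congr 1
    · rw [ih q (hP.cons x) hQ]
    · rcases q with - | q
      · simpa only [circL_zero, List.cons_append] using hP.last_snd (Q [x] :: l) w
      · exact ih q hP (hQ.cons x)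

theorem IsLieType.swap (hP : IsLieType P) (hPa : ListAdditive P) (a b y : G × V)
    (m : List (G × V)) : P (a :: b :: y :: m) + P (b :: a :: y :: m) = 0 := by
  have h := hP.alt [] (a + b) y m
  have ha := hP.alt [] a y m
  have hb := hP.alt [] b y m
  simp only [List.nil_append] at h ha hb
  rw [hPa.cons_add, (hPa.cons a).cons_add, (hPa.cons b).cons_add, ha, hb] at h
  simpa using h

theorem IsLieType.swap_last (hP : IsLieType P) (hPa : ListAdditive P) (a b : G × V) :
    (P [a, b]).1 + (P [b, a]).1 = 0 := by
  have h := hP.alt_last [] (a + b)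
  have ha := hP.alt_last [] a
  have hb := hP.alt_last [] b
  simp only [List.nil_append] at h ha hb
  rw [hPa.cons_add, (hPa.cons a).cons_add, (hPa.cons b).cons_add, Prod.fst_add, Prod.fst_add,
    Prod.fst_add, ha, hb] at h
  simpa using h

/-- Terms with both copies of `w` in `P` or both in `Q` vanish. Those with one copy in each come in
two kinds, which cancel. -/
theorem circL_alt (q : ℕ) (hP : IsLieType P) (hQ : IsLieType Q) (hPa : ListAdditive P)
    (l : List (G × V)) (w y : G × V) (m : List (G × V)) :
    circL (q + 1) P Q (l ++ w :: w :: y :: m) = 0 := by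
  induction l generalizing q P Q with
  | nil =>
    have h0 : circL (q + 1) (fun l => P (w :: w :: l)) Q (y :: m) = 0 := by
      rw [circL_congr (P' := fun _ => 0) (g' := Q) (fun k _ hk => ?_) fun _ _ => rfl,
        circL_zero_left]
      obtain ⟨z, k, rfl⟩ := List.exists_cons_of_ne_nil hk
      exact hP.alt [] w z k
    rw [List.nil_append, circL_cons, circL_cons, h0, smul_zero, zero_add]
    rcases q with - | q
    -- For `q = 0` the surviving terms are `P(w, Q w, y, …)` and `P(Q w, w, y, …)`, opposite by
    -- antisymmetry of `P`.
    · rw [circL_zero, circL_zero, Nat.cast_zero, negPow_zero, one_smul]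
      exact hP.swap hPa _ _ _ _
    · rw [circL_cons q P]
      -- If the two copies are the last arguments of `Q`, only the `𝔤`-component of its value
      -- vanishes. That is enough, since `y` still follows and `P` ignores the `V`-component.
      have h1 : circL q P (fun l => Q (w :: w :: l)) (y :: m) = 0 := by
        rcases q with - | q
        · rw [circL_zero]
          have h1 := hP.indep [] (Q [w, w]) y m
          have h2 := hQ.alt_last [] w
          simp only [List.nil_append] at h1 h2
          rw [h1, h2]
          exact hPa.cons_zero _
        · rw [circL_congr (P' := P) (g' := fun _ => 0) (fun _ _ _ => rfl) fun k hk => ?_,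
            circL_zero_right _ hPa]
          obtain ⟨z, k, rfl⟩ := List.exists_cons_of_length_eq_add_one hk
          exact hQ.alt [] w z k
      rw [h1, add_zero, Nat.cast_succ, negPow_add, negPow_one, mul_neg_one, neg_smul,
        neg_add_cancel]
  | cons x l ih =>
    rw [List.cons_append, circL_cons, ih q (hP.cons x) hQ (hPa.cons x), smul_zero, zero_add]
    rcases q with - | q
    · simpa only [circL_zero, List.cons_append] using hP.alt (Q [x] :: l) w y m
    · exact ih q hP (hQ.cons x) hPa

theorem circL_alt_last (q : ℕ) (hP : IsLieType P) (hQ : IsLieType Q) (hPa : ListAdditive P)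
    (l : List (G × V)) (w : G × V) : (circL (q + 1) P Q (l ++ [w, w])).1 = 0 := by
  induction l generalizing q P Q with
  | nil =>
    rw [List.nil_append, circL_cons, circL_cons, circL_nil, smul_zero, zero_add]
    rcases q with - | q
    · rw [circL_zero, circL_zero, Nat.cast_zero, negPow_zero, one_smul]
      exact hP.swap_last hPa _ _
    · rw [circL_cons q P, circL_nil, smul_zero, smul_zero, zero_add, zero_add]
      rcases q with - | q
      · rw [circL_zero]
        have h1 := hP.last_fst [] (Q [w, w])
        have h2 := hQ.alt_last [] w
        simp only [List.nil_append] at h1 h2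
        rw [h1, h2]
        exact congrArg Prod.fst (hPa.cons_zero [])
      · rfl
  | cons x l ih =>
    rw [List.cons_append, circL_cons, Prod.fst_add, Prod.smul_fst,
      ih q (hP.cons x) hQ (hPa.cons x), smul_zero, zero_add]
    rcases q with - | q
    · simpa only [circL_zero, List.cons_append] using hP.alt_last (Q [x] :: l) w
    · exact ih q hP (hQ.cons x) hPa

theorem IsLieType.circL (q : ℕ) (hP : IsLieType P) (hQ : IsLieType Q) (hPa : ListAdditive P) :
    IsLieType (circL (q + 1) P Q) where
  indep := circL_indep q hP hQ
  last_fst := circL_last_fst q hP hQ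
  last_snd := circL_last_snd q hP hQ
  alt := circL_alt q hP hQ hPa
  alt_last := circL_alt_last q hP hQ hPa

end LieType

/-! ### `L'` is a graded Lie subalgebra. -/

section LieTypeCochains

/-- Polarisation with `a + b` gives antisymmetry in adjacent places, which moves the first `a`
towards the second one. -/
theorem eq_zero_of_adjacent {G E : Type*} [AddCommGroup G] [AddCommGroup E] {A : List G → E}
    (hadd : ListAdditive A) (hadj : ∀ l a m, A (l ++ a :: a :: m) = 0) (l : List G) (a : G)
    (k m : List G) : A (l ++ a :: (k ++ a :: m)) = 0 := by
  induction k generalizing l with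
  | nil => exact hadj l a m
  | cons b k ih =>
    have h := hadj l (a + b) (k ++ a :: m)
    have hl : ∀ x y z r, A (l ++ x :: (y + z) :: r) = A (l ++ x :: y :: r) + A (l ++ x :: z :: r) :=
      fun x y z r => by simpa using hadd (l ++ [x]) y z r
    rw [hadd, hl, hl, hadj, hadj, zero_add, add_zero] at h
    have ih' := ih (l ++ [b])
    rw [List.append_assoc, List.singleton_append] at ih'
    rw [ih', add_zero] at h
    simpa using h

theorem eq_zero_of_eq_of_adjacent {G E : Type*} [AddCommGroup G] [AddCommGroup E] {n : ℕ}
    {A : List G → E} (hadd : ListAdditive A) (hadj : ∀ l a m, A (l ++ a :: a :: m) = 0)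
    (v : Fin n → G) (i j : Fin n) (hv : v i = v j) (hij : i ≠ j) : A (List.ofFn v) = 0 := by
  wlog h : i < j generalizing i j
  · exact this j i hv.symm hij.symm (lt_of_le_of_ne (not_lt.1 h) hij.symm)
  have h1 : List.ofFn v = (List.ofFn v).take i ++ v i :: (List.ofFn v).drop (i + 1) := by
    conv_lhs => rw [← List.take_append_drop i (List.ofFn v),
      List.drop_eq_getElem_cons (by simp)]
    rw [List.getElem_ofFn]
  obtain ⟨d, hd⟩ : ∃ d : ℕ, (j : ℕ) = i + 1 + d := ⟨j - (i + 1), by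
    have : (i : ℕ) < j := h
    omega⟩
  have h2 : (List.ofFn v).drop (i + 1) =
      ((List.ofFn v).drop (i + 1)).take d ++ v i :: (List.ofFn v).drop (i + 1 + d + 1) := by
    have hlt : (i : ℕ) + 1 + d < (List.ofFn v).length := by simp; omega
    conv_lhs => rw [← List.take_append_drop d ((List.ofFn v).drop (i + 1)), List.drop_drop,
      List.drop_eq_getElem_cons hlt]
    rw [List.getElem_ofFn]
    have : (⟨i + 1 + d, by omega⟩ : Fin n) = j := Fin.ext hd.symm
    rw [this, hv]
  rw [h1, h2]
  exact eq_zero_of_adjacent hadd hadj _ _ _ _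

variable {K : Type*} [Field K] {𝔤 : Type*} [AddCommGroup 𝔤] [Module K 𝔤]
  {V : Type*} [AddCommGroup V] [Module K V]

theorem evalLof_liftL_fst {n : ℕ} (a : (𝔤 [⋀^Fin (n + 1)]→ₗ[K] 𝔤) ×
    (𝔤 [⋀^Fin n]→ₗ[K] Module.End K V)) {l l' : List (𝔤 × V)}
    (h : l.map Prod.fst = l'.map Prod.fst) :
    (evalLof (liftL K 𝔤 V n a) l).1 = (evalLof (liftL K 𝔤 V n a) l').1 := by
  have hlen : l.length = l'.length := by simpa using congrArg List.length h
  by_cases hl : l.length = n + 1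
  · obtain ⟨w, rfl⟩ := exists_ofFn l _ hl
    obtain ⟨w', rfl⟩ := exists_ofFn l' _ (hlen ▸ hl)
    rw [List.map_ofFn, List.map_ofFn] at h
    have hw := List.ofFn_injective h
    rw [evalLof_ofFn, evalLof_ofFn, ← Prod.mk.eta (p := a), liftL_apply, liftL_apply]
    exact congrArg a.1 hw
  · rw [evalLof_of_length_ne _ hl, evalLof_of_length_ne _ (hlen ▸ hl)]

theorem ofFn_eq_append_singleton {α : Type*} {n : ℕ} (w : Fin (n + 1) → α) :
    List.ofFn w = (List.ofFn fun i : Fin n => w i.castSucc) ++ [w (Fin.last n)] := by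
  rw [List.ofFn_succ', List.concat_eq_append]

theorem evalLof_liftL_snd {n : ℕ} (a : (𝔤 [⋀^Fin (n + 1)]→ₗ[K] 𝔤) ×
    (𝔤 [⋀^Fin n]→ₗ[K] Module.End K V)) {l l' : List (𝔤 × V)} {u u' : 𝔤 × V}
    (h : l.map Prod.fst = l'.map Prod.fst) (hu : u.2 = u'.2) :
    (evalLof (liftL K 𝔤 V n a) (l ++ [u])).2 = (evalLof (liftL K 𝔤 V n a) (l' ++ [u'])).2 := by
  have hlen : l.length = l'.length := by simpa using congrArg List.length h
  by_cases hl : (l ++ [u]).length = n + 1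
  · have hl' : (l' ++ [u']).length = n + 1 := by rw [← hl]; simp [hlen]
    obtain ⟨w, hw⟩ := exists_ofFn _ _ hl
    obtain ⟨w', hw'⟩ := exists_ofFn _ _ hl'
    rw [hw, hw', evalLof_ofFn, evalLof_ofFn, ← Prod.mk.eta (p := a), liftL_apply, liftL_apply]
    rw [ofFn_eq_append_singleton] at hw hw'
    obtain ⟨e1, e2⟩ := List.append_inj' hw rfl
    obtain ⟨e1', e2'⟩ := List.append_inj' hw' rfl
    rw [List.singleton_inj] at e2 e2'
    subst e1 e1'
    rw [List.map_ofFn, List.map_ofFn] at h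
    have hw := List.ofFn_injective h
    simp only [← e2, ← e2', hu]
    exact congrArg (fun x => a.2 x u'.2) hw
  · rw [evalLof_of_length_ne _ hl, evalLof_of_length_ne _ (by simpa [hlen] using hl)]

theorem isLieType_evalLof_liftL {n : ℕ} (a : (𝔤 [⋀^Fin (n + 1)]→ₗ[K] 𝔤) ×
    (𝔤 [⋀^Fin n]→ₗ[K] Module.End K V)) : IsLieType (evalLof (liftL K 𝔤 V n a)) := by
  have hget : ∀ {N : ℕ} (w : Fin N → 𝔤 × V) (l : List (𝔤 × V)) (x : 𝔤 × V) (m : List (𝔤 × V))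
      (_ : l ++ x :: x :: m = List.ofFn w), ∃ (h : l.length + 1 < N),
        w ⟨l.length, by omega⟩ = w ⟨l.length + 1, h⟩ := by
    intro N w l x m h
    have hN : l.length + 1 < N := by
      have := congrArg List.length h
      simp at this
      omega
    refine ⟨hN, ?_⟩
    have e1 : (List.ofFn w)[l.length]'(by simpa using (by omega : l.length < N)) = x := by
      simp [← h]
    have e2 : (List.ofFn w)[l.length + 1]'(by simpa using hN) = x := by
      simp [← h]
    rw [List.getElem_ofFn] at e1 e2
    rw [e1, e2]
  have alt_fst : ∀ l x m, (evalLof (liftL K 𝔤 V n a) (l ++ x :: x :: m)).1 = 0 := by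
    intro l x m
    by_cases hl : (l ++ x :: x :: m).length = n + 1
    · obtain ⟨w, hw⟩ := exists_ofFn _ _ hl
      obtain ⟨h, e⟩ := hget w l x m hw
      rw [hw, evalLof_ofFn, ← Prod.mk.eta (p := a), liftL_apply]
      exact a.1.map_eq_zero_of_eq _ (congrArg Prod.fst e) (by simp)
    · rw [evalLof_of_length_ne _ hl, Prod.fst_zero]
  refine ⟨fun l w y m => ?_, fun l w => ?_, fun l w => ?_, fun l w y m => ?_, fun l w => ?_⟩
  · refine Prod.ext (evalLof_liftL_fst a (by simp)) ?_
    obtain ⟨m', u, hm⟩ := List.eq_nil_or_concat' (y :: m) |>.resolve_left (by simp)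
    rw [hm]
    have := evalLof_liftL_snd a (l := l ++ w :: m') (l' := l ++ (w.1, 0) :: m') (u := u) (u' := u)
      (by simp) rfl
    simpa using this
  · exact evalLof_liftL_fst a (by simp)
  · exact evalLof_liftL_snd a rfl rfl
  · refine Prod.ext (alt_fst _ _ _) ?_
    obtain ⟨m', u, hm⟩ := List.eq_nil_or_concat' (y :: m) |>.resolve_left (by simp)
    rw [hm]
    by_cases hl : (l ++ w :: w :: (m' ++ [u])).length = n + 1
    · obtain ⟨v, hv⟩ := exists_ofFn _ _ hl
      rw [hv, evalLof_ofFn, ← Prod.mk.eta (p := a), liftL_apply]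
      rw [ofFn_eq_append_singleton, ← List.cons_append, ← List.cons_append,
        ← List.append_assoc] at hv
      obtain ⟨e1, -⟩ := List.append_inj' hv rfl
      obtain ⟨h, e⟩ := hget _ l w m' e1
      have : a.2 (fun i => (v i.castSucc).1) = 0 :=
        a.2.map_eq_zero_of_eq _ (congrArg Prod.fst e) (by simp)
      simp only [this]
      rfl
    · rw [evalLof_of_length_ne _ hl]
  · exact alt_fst l w []

theorem IsLieType.append_singleton {F : List (𝔤 × V) → 𝔤 × V} (hF : IsLieType F)
    (l : List (𝔤 × V)) (y : 𝔤 × V) :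
    F (l ++ [y]) = F ((l.map fun w => (w.1, 0)) ++ [y]) := by
  induction l generalizing F with
  | nil => rfl
  | cons x l ih =>
    obtain ⟨z, k, hk⟩ := List.exists_cons_of_ne_nil (l := l ++ [y]) (by simp)
    have h := hF.indep [] x z k
    rw [List.nil_append, List.nil_append, ← hk] at h
    rw [List.cons_append, h, ih (hF.cons (x.1, 0))]
    rfl

/-- The two alternating maps are restrictions of `h`: all arguments in `𝔤` with the `𝔤`-component of
the value, or all but the last in `𝔤` with the `V`-component. The independence conditions show that
they determine `h`. -/
theorem mem_range_liftL_of_isLieType {n : ℕ} (h : Cochain K (𝔤 × V) n)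
    (hh : IsLieType (evalLof h)) : h ∈ LinearMap.range (liftL K 𝔤 V n) := by
  have hadd := listAdditive_evalLof h
  let f₁ : MultilinearMap K (fun _ : Fin (n + 1) => 𝔤) 𝔤 :=
    (LinearMap.fst K 𝔤 V).compMultilinearMap (h.compLinearMap fun _ => LinearMap.inl K 𝔤 V)
  let ι : (𝔤 × V →ₗ[K] 𝔤 × V) →ₗ[K] Module.End K V :=
    { toFun := fun g => LinearMap.snd K 𝔤 V ∘ₗ g ∘ₗ LinearMap.inr K 𝔤 V
      map_add' := fun _ _ => rfl
      map_smul' := fun _ _ => rfl }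
  let φ₁ : MultilinearMap K (fun _ : Fin n => 𝔤) (Module.End K V) :=
    ι.compMultilinearMap (MultilinearMap.compLinearMap
      (MultilinearMap.curryRight (M := fun _ : Fin (n + 1) => 𝔤 × V) h)
      fun _ => LinearMap.inl K 𝔤 V)
  have hf₁ : ∀ x, f₁ x = (evalLof h ((List.ofFn x).map fun a => (a, 0))).1 := by
    intro x
    rw [List.map_ofFn, evalLof_ofFn]
    rfl
  have hφ₁ : ∀ x v, φ₁ x v = (evalLof h (((List.ofFn x).map fun a => (a, 0)) ++ [(0, v)])).2 := by
    intro x v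
    have : ((List.ofFn x).map fun a => (a, (0 : V))) ++ [(0, v)] =
        List.ofFn (Fin.snoc (fun i => (x i, 0)) (0, v) : Fin (n + 1) → 𝔤 × V) := by
      rw [ofFn_eq_append_singleton, List.map_ofFn]
      simp [Function.comp_def]
    rw [this, evalLof_ofFn]
    rfl
  have hpair : ∀ a b : 𝔤, ((a + b, 0) : 𝔤 × V) = (a, 0) + (b, 0) := fun a b => by simp
  let f : 𝔤 [⋀^Fin (n + 1)]→ₗ[K] 𝔤 :=
    { f₁ with
      map_eq_zero_of_eq' := fun v i j hv hij => by
        refine (hf₁ v).trans (eq_zero_of_eq_of_adjacent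
          (A := fun l => (evalLof h (l.map fun a => (a, 0))).1) ?_ ?_ v i j hv hij)
        · intro l a b m
          simp only [List.map_append, List.map_cons]
          rw [hpair, hadd, Prod.fst_add]
        · intro l a m
          simp only [List.map_append, List.map_cons]
          -- An equal pair in the last two places is covered only by `alt_last`, which suffices for
          -- the `𝔤`-component.
          rcases m with - | ⟨y, m⟩
          · exact hh.alt_last _ _
          · rw [List.map_cons, hh.alt, Prod.fst_zero] }
  let φ : 𝔤 [⋀^Fin n]→ₗ[K] Module.End K V :=
    { φ₁ with
      map_eq_zero_of_eq' := fun v i j hv hij => by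
        refine LinearMap.ext fun u => (hφ₁ v u).trans (eq_zero_of_eq_of_adjacent
          (A := fun l => (evalLof h ((l.map fun a => (a, 0)) ++ [(0, u)])).2) ?_ ?_ v i j hv hij)
        · intro l a b m
          simp only [List.map_append, List.map_cons, List.append_assoc, List.cons_append]
          rw [hpair, hadd, Prod.snd_add]
        · intro l a m
          simp only [List.map_append, List.map_cons, List.append_assoc, List.cons_append]
          obtain ⟨z, k, hk⟩ := List.exists_cons_of_ne_nil
            (l := (m.map fun a => (a, (0 : V))) ++ [(0, u)]) (by simp)
          rw [hk, hh.alt, Prod.snd_zero] }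
  refine ⟨(f, φ), MultilinearMap.ext fun w => ?_⟩
  rw [liftL_apply, ← evalLof_ofFn h w, ofFn_eq_append_singleton]
  refine Prod.ext ?_ ?_
  · rw [hh.append_singleton, hh.last_fst]
    refine (hf₁ fun i => (w i).1).trans ?_
    rw [ofFn_eq_append_singleton, List.map_append, List.map_ofFn, List.map_ofFn]
    rfl
  · rw [hh.append_singleton, hh.last_snd]
    refine (hφ₁ (fun i => (w i.castSucc).1) (w (Fin.last n)).2).trans ?_
    rw [List.map_ofFn, List.map_ofFn]
    rfl

theorem circ_mem_range_liftL (p q : ℕ) (f : Cochain K (𝔤 × V) p) (g : Cochain K (𝔤 × V) q)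
    (hf : f ∈ LinearMap.range (liftL K 𝔤 V p)) (hg : g ∈ LinearMap.range (liftL K 𝔤 V q)) :
    circ f g ∈ LinearMap.range (liftL K 𝔤 V (p + q)) := by
  obtain ⟨a, rfl⟩ := hf
  obtain ⟨b, rfl⟩ := hg
  refine mem_range_liftL_of_isLieType _ ?_
  have e : evalLof (circ (liftL K 𝔤 V p a) (liftL K 𝔤 V q b)) =
      circL (q + 1) (evalLof (liftL K 𝔤 V p a)) (evalLof (liftL K 𝔤 V q b)) :=
    funext (evalLof_circ _ _)
  rw [e]
  exact (isLieType_evalLof_liftL a).circL q (isLieType_evalLof_liftL b) (listAdditive_evalLof _)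

theorem isGradedLieSubalgebra_subspaceL' :
    IsGradedLieSubalgebra (cochainGrading K (𝔤 × V)) (balavoineBracket K (𝔤 × V))
      (subspaceL' K 𝔤 V) :=
  ⟨iSup_inf_cochainGrading (mem_subspaceL' K 𝔤 V),
    balavoineBracket_mem (mem_subspaceL' K 𝔤 V) circ_mem_range_liftL⟩

end LieTypeCochains

/-! ### The Maurer–Cartan equation of a triple. -/

section MaurerCartan

variable {K : Type*} [Field K] {𝔤 : Type*} [AddCommGroup 𝔤] [Module K 𝔤]
  {V : Type*} [AddCommGroup V] [Module K V]

theorem eq_zero_iff_evalLof_pair {W : Type*} [AddCommGroup W] [Module K W]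
    (f : Cochain K W 1) : f = 0 ↔ ∀ a b, evalLof f [a, b] = 0 := by
  constructor
  · rintro rfl a b
    exact (evalLof_ofFn (0 : Cochain K W 1) ![a, b])
  · intro h
    refine MultilinearMap.ext fun w => ?_
    rw [← evalLof_ofFn]
    exact h (w 0) (w 1)

theorem eq_zero_iff_evalLof_triple {W : Type*} [AddCommGroup W] [Module K W]
    (f : Cochain K W 2) : f = 0 ↔ ∀ a b c, evalLof f [a, b, c] = 0 := by
  constructor
  · rintro rfl a b c
    exact (evalLof_ofFn (0 : Cochain K W 2) ![a, b, c])
  · intro h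
    refine MultilinearMap.ext fun w => ?_
    rw [← evalLof_ofFn]
    exact h (w 0) (w 1) (w 2)

theorem lof_eq_zero_iff {W : Type*} [AddCommGroup W] [Module K W] {n : ℕ} (f : Cochain K W n) :
    DirectSum.lof K ℕ (Cochain K W) n f = 0 ↔ f = 0 := by
  constructor
  · intro h
    rw [← DirectSum.lof_apply K n f, h]
    rfl
  · rintro rfl
    exact map_zero _

/-- The element of `C⁰(𝔤 ⊕ V, 𝔤 ⊕ V)` given by a linear map `V → 𝔤`. -/
abbrev liftT (T : V →ₗ[K] 𝔤) : Cochain K (𝔤 × V) 0 :=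
  liftH K 𝔤 V 0 (MultilinearMap.ofSubsingleton (ι := Fin 1) K V 𝔤 0 T)

theorem evalLof_liftT (T : V →ₗ[K] 𝔤) (a : 𝔤 × V) : evalLof (liftT T) [a] = (T a.2, 0) := by
  refine (evalLof_ofFn (liftT T) ![a]).trans ?_
  rw [liftH_apply]
  rfl

theorem evalLof_boxPlus (μ : 𝔤 [⋀^Fin 2]→ₗ[K] 𝔤) (ρ : 𝔤 →ₗ[K] Module.End K V) (a b : 𝔤 × V) :
    evalLof (boxPlus μ ρ) [a, b] = (μ ![a.1, b.1], ρ a.1 b.2) :=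
  evalLof_ofFn (boxPlus μ ρ) ![a, b]

/-- The bracket `[f, T]` with a linear map `T : V → 𝔤`, for `f` with two arguments. -/
def bracketT (T : V →ₗ[K] 𝔤) (f : Cochain K (𝔤 × V) 1) : Cochain K (𝔤 × V) 1 :=
  (circ f (liftT T) : Cochain K (𝔤 × V) (1 + 0)) - (circ (liftT T) f : Cochain K (𝔤 × V) (0 + 1))

theorem balavoineBracket_liftT (T : V →ₗ[K] 𝔤) (f : Cochain K (𝔤 × V) 1) :
    balavoineBracket K (𝔤 × V) (DirectSum.lof K ℕ (Cochain K (𝔤 × V)) 1 f)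
      (DirectSum.lof K ℕ (Cochain K (𝔤 × V)) 0 (liftT T)) =
    DirectSum.lof K ℕ (Cochain K (𝔤 × V)) 1 (bracketT T f) := by
  rw [balavoineBracket_lof, bracketT, map_sub, Nat.cast_zero, mul_zero, negPow_zero, one_smul]

theorem evalLof_bracketT (T : V →ₗ[K] 𝔤) (f : Cochain K (𝔤 × V) 1) (a b : 𝔤 × V) :
    evalLof (bracketT T f) [a, b] = evalLof f [(T a.2, 0), b] + evalLof f [a, (T b.2, 0)] -
      (T (evalLof f [a, b]).2, 0) := by
  have h1 : evalLof (bracketT T f) [a, b] =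
      evalLof (circ f (liftT T)) [a, b] - evalLof (circ (liftT T) f) [a, b] := by
    rw [evalLof, bracketT, map_sub, evalList_sub]
    rfl
  rw [h1, evalLof_circ, evalLof_circ]
  simp [circL_cons, circL_zero, circL_nil, evalLof_liftT, negPow_zero, negPow_one]
  abel

theorem evalLof_circ_boxPlus (μ : 𝔤 [⋀^Fin 2]→ₗ[K] 𝔤) (ρ : 𝔤 →ₗ[K] Module.End K V)
    (a b c : 𝔤 × V) : evalLof (circ (boxPlus μ ρ) (boxPlus μ ρ)) [a, b, c] =
      (μ ![μ ![a.1, b.1], c.1] + μ ![b.1, μ ![a.1, c.1]] - μ ![a.1, μ ![b.1, c.1]],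
        ρ (μ ![a.1, b.1]) c.2 + ρ b.1 (ρ a.1 c.2) - ρ a.1 (ρ b.1 c.2)) := by
  rw [evalLof_circ]
  simp [circL_cons, circL_zero, circL_nil, evalLof_boxPlus, negPow_zero, negPow_one]
  constructor <;> abel

section Values

variable (μ : 𝔤 [⋀^Fin 2]→ₗ[K] 𝔤) (ρ : 𝔤 →ₗ[K] Module.End K V) (T : V →ₗ[K] 𝔤)

theorem alternating_zero_left (x : 𝔤) : μ ![0, x] = 0 := μ.map_coord_zero 0 rfl

theorem alternating_zero_right (x : 𝔤) : μ ![x, 0] = 0 := μ.map_coord_zero 1 rfl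

theorem evalLof_bracketT_boxPlus (a b : 𝔤 × V) :
    evalLof (bracketT T (boxPlus μ ρ)) [a, b] =
      (μ ![T a.2, b.1] + μ ![a.1, T b.2] - T (ρ a.1 b.2), ρ (T a.2) b.2) := by
  rw [evalLof_bracketT]
  simp only [evalLof_boxPlus, map_zero]
  refine Prod.ext ?_ ?_ <;> simp

/-- The two brackets substitute `T` in two of three places (the two arguments and the value). Each
choice of places arises in two orders, hence the factor 2; substituting in the first argument twice,
for instance, gives zero. -/
theorem evalLof_bracketT_bracketT_boxPlus (a b : 𝔤 × V) :
    evalLof (bracketT T (bracketT T (boxPlus μ ρ))) [a, b] =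
      (2 • (μ ![T a.2, T b.2] - T (ρ (T a.2) b.2)), 0) := by
  rw [evalLof_bracketT]
  simp only [evalLof_bracketT_boxPlus, map_zero]
  refine Prod.ext ?_ ?_
  · simp [alternating_zero_left, alternating_zero_right]
    abel
  · simp

/-- After two brackets the cochain reads only `V`-components and has values in `𝔤`, so neither
inserting `T` into it nor applying `T` to its value gives anything. -/
theorem bracketT_bracketT_bracketT_boxPlus :
    bracketT T (bracketT T (bracketT T (boxPlus μ ρ))) = 0 := by
  rw [eq_zero_iff_evalLof_pair]
  intro a b
  rw [evalLof_bracketT]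
  simp only [evalLof_bracketT_bracketT_boxPlus, map_zero]
  simp [alternating_zero_left, alternating_zero_right]

theorem projH_lof_eq_zero_iff (f : Cochain K (𝔤 × V) 1) :
    projH K 𝔤 V (DirectSum.lof K ℕ (Cochain K (𝔤 × V)) 1 f) = 0 ↔
      ∀ u v, (evalLof f [(0, u), (0, v)]).1 = 0 := by
  rw [projH_lof, lof_eq_zero_iff, ← LinearMap.mem_ker, mem_ker_projHComponent]
  constructor
  · intro h u v
    have := h ![(0, u), (0, v)] (by simp)
    rwa [← evalLof_ofFn] at this
  · intro h w hw
    rw [← evalLof_ofFn]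
    have e : List.ofFn w = [(0, (w 0).2), (0, (w 1).2)] := by
      change [w 0, w 1] = _
      rw [List.cons.injEq, List.cons.injEq]
      exact ⟨Prod.ext (hw 0) rfl, Prod.ext (hw 1) rfl, rfl⟩
    rw [e]
    exact h _ _

theorem tripleElement_mem : tripleElement μ ρ T ∈ controllingGrading K 𝔤 V 0 := by
  refine ⟨⟨lof_mem_of_mem (mem_subspaceL' K 𝔤 V) ?_, ?_⟩,
    lof_mem_of_mem (mem_subspaceH K 𝔤 V) ⟨_, rfl⟩, ?_⟩
  · refine ⟨(μ, AlternatingMap.ofSubsingleton K 𝔤 (Module.End K V) (0 : Fin 1) ρ),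
      MultilinearMap.ext fun w => ?_⟩
    rw [liftL_apply]
    refine Prod.ext ?_ rfl
    refine congrArg μ (funext fun i => ?_)
    fin_cases i <;> rfl
  · exact_mod_cast lof_mem_cochainGrading 1 (boxPlus μ ρ)
  · exact_mod_cast lof_mem_cochainGrading 0 (liftT T)

theorem nested_tripleElement (n : ℕ) :
    nested (balavoineBracket K (𝔤 × V)) n (tripleElement μ ρ T).1
        (fun _ => (tripleElement μ ρ T).2) =
      DirectSum.lof K ℕ (Cochain K (𝔤 × V)) 1 ((bracketT T)^[n] (boxPlus μ ρ)) := by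
  induction n with
  | zero => rfl
  | succ n ih =>
    rw [nested, ih, Function.iterate_succ_apply']
    exact balavoineBracket_liftT T _

/-- All arguments are equal and of degree `0`, so each of the `n + 1` places for the element of `L'`
contributes the same, without sign. -/
theorem controllingBracket_tripleElement_snd (n : ℕ) :
    (controllingBracket K 𝔤 V (n + 1) (fun _ => 0) (fun _ => tripleElement μ ρ T)).2 =
      ((n + 1 : ℕ) : K) • projH K 𝔤 V (DirectSum.lof K ℕ (Cochain K (𝔤 × V)) 1
        ((bracketT T)^[n] (boxPlus μ ρ))) := by
  have h : (controllingBracket K 𝔤 V (n + 1) (fun _ => 0) (fun _ => tripleElement μ ρ T)).2 =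
      projH K 𝔤 V (nested (balavoineBracket K (𝔤 × V)) (n + 1) 0
        fun _ => (tripleElement μ ρ T).2) +
      ∑ j : Fin (n + 1), negPow (0 * ∑ i ∈ Finset.Iio j, 0) •
        projH K 𝔤 V (nested (balavoineBracket K (𝔤 × V)) n (tripleElement μ ρ T).1
          fun _ => (tripleElement μ ρ T).2) := rfl
  rw [h, nested_eq_nestL, map_zero, map_zero, zero_add, nested_tripleElement]
  simp only [zero_mul, negPow_zero, one_smul]
  rw [Finset.sum_const, Finset.card_univ, Fintype.card_fin, Nat.cast_smul_eq_nsmul]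

theorem isMaurerCartan_tripleElement_iff [CharZero K] :
    IsMaurerCartan (controllingGrading K 𝔤 V) (controllingBracket K 𝔤 V) (tripleElement μ ρ T) ↔
      circ (boxPlus μ ρ) (boxPlus μ ρ) = 0 ∧ ∀ u v, μ ![T u, T v] = T (ρ (T u) v) := by
  -- Indices are shifted by one: `l k` is the term with the bracket of `k + 1` arguments.
  set l : ℕ → Cochains K (𝔤 × V) × Cochains K (𝔤 × V) := fun k =>
    ((Nat.factorial (k + 1) : K)⁻¹) • controllingBracket K 𝔤 V (k + 1) (fun _ => 0)
      (fun _ => tripleElement μ ρ T) with hl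
  have hit : ∀ n, (bracketT T)^[n + 3] (boxPlus μ ρ) = 0 := by
    intro n
    have h0 : bracketT T (0 : Cochain K (𝔤 × V) 1) = 0 := by
      rw [eq_zero_iff_evalLof_pair]
      intro a b
      rw [evalLof_bracketT, (eq_zero_iff_evalLof_pair 0).1 rfl, (eq_zero_iff_evalLof_pair 0).1 rfl,
        (eq_zero_iff_evalLof_pair 0).1 rfl]
      simp
    rw [Function.iterate_add_apply]
    have : (bracketT T)^[3] (boxPlus μ ρ) = 0 := bracketT_bracketT_bracketT_boxPlus μ ρ T
    rw [this, Function.iterate_fixed h0]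
  have h0 : l 0 = 0 := by
    have h : projH K 𝔤 V (DirectSum.lof K ℕ (Cochain K (𝔤 × V)) 1 (boxPlus μ ρ)) = 0 := by
      rw [projH_lof_eq_zero_iff]
      intro u v
      rw [evalLof_boxPlus]
      exact alternating_zero_left μ 0
    refine Prod.ext ?_ ?_
    · simp [hl, controllingBracket, voronovBracket]
    · rw [hl, Prod.smul_snd, controllingBracket_tripleElement_snd, Function.iterate_zero_apply, h,
        smul_zero, smul_zero]
      rfl
  -- A cochain of odd degree has bracket `2 (f ∘̄ f)` with itself, which absorbs `1/2!`; the minus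
  -- sign comes from `l₂`. The `𝔥`-part vanishes as one insertion of `T` leaves no term from `V ⊗ V`
  -- to `𝔤`.
  have h1 : l 1 = (-DirectSum.lof K ℕ (Cochain K (𝔤 × V)) 2
      (circ (boxPlus μ ρ) (boxPlus μ ρ)), 0) := by
    have h : projH K 𝔤 V (DirectSum.lof K ℕ (Cochain K (𝔤 × V)) 1
        (bracketT T (boxPlus μ ρ))) = 0 := by
      rw [projH_lof_eq_zero_iff]
      intro u v
      rw [evalLof_bracketT_boxPlus]
      simp [alternating_zero_left, alternating_zero_right]
    refine Prod.ext ?_ ?_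
    · have h' : (l 1).1 = ((Nat.factorial 2 : K)⁻¹) • negPow (0 + 1) •
          balavoineBracket K (𝔤 × V) (DirectSum.lof K ℕ (Cochain K (𝔤 × V)) 1 (boxPlus μ ρ))
            (DirectSum.lof K ℕ (Cochain K (𝔤 × V)) 1 (boxPlus μ ρ)) := rfl
      rw [h', balavoineBracket_lof, zero_add, negPow_one, Nat.cast_one, one_mul, negPow_one,
        neg_one_smul, neg_one_smul, sub_neg_eq_add, ← two_smul K, smul_neg, smul_smul]
      norm_num
    · rw [hl, Prod.smul_snd, controllingBracket_tripleElement_snd, Function.iterate_one, h,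
        smul_zero, smul_zero]
  -- The coefficient is `3/3!`, from three equal places for `μ ⊞ ρ`.
  have h2 : l 2 = (0, (2 : K)⁻¹ • projH K 𝔤 V (DirectSum.lof K ℕ (Cochain K (𝔤 × V)) 1
      (bracketT T (bracketT T (boxPlus μ ρ))))) := by
    refine Prod.ext ?_ ?_
    · simp [hl, controllingBracket, voronovBracket]
    · rw [hl, Prod.smul_snd, controllingBracket_tripleElement_snd, smul_smul]
      congr 1
      norm_num [Nat.factorial]
  have h3 : ∀ n, l (n + 3) = 0 := by
    intro n
    refine Prod.ext ?_ ?_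
    · simp [hl, controllingBracket, voronovBracket]
    · rw [hl, Prod.smul_snd, controllingBracket_tripleElement_snd, hit, map_zero, map_zero,
        smul_zero, smul_zero]
      rfl
  have hsupp : Function.support l ⊆ (Finset.range 3 : Finset ℕ) := by
    intro k hk
    by_contra hc
    obtain ⟨n, rfl⟩ : ∃ n, k = n + 3 := ⟨k - 3, by simp at hc; omega⟩
    exact hk (h3 n)
  have hsum : ∑ᶠ k, l k = (-DirectSum.lof K ℕ (Cochain K (𝔤 × V)) 2
      (circ (boxPlus μ ρ) (boxPlus μ ρ)), (2 : K)⁻¹ • projH K 𝔤 V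
        (DirectSum.lof K ℕ (Cochain K (𝔤 × V)) 1 (bracketT T (bracketT T (boxPlus μ ρ))))) := by
    rw [finsum_eq_sum_of_support_subset l hsupp, Finset.sum_range_succ, Finset.sum_range_succ,
      Finset.sum_range_one, h0, h1, h2]
    simp
  have hP : (2 : K)⁻¹ • projH K 𝔤 V (DirectSum.lof K ℕ (Cochain K (𝔤 × V)) 1
      (bracketT T (bracketT T (boxPlus μ ρ)))) = 0 ↔
        ∀ u v, μ ![T u, T v] = T (ρ (T u) v) := by
    rw [smul_eq_zero_iff_right (by norm_num), projH_lof_eq_zero_iff]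
    refine forall₂_congr fun u v => ?_
    rw [evalLof_bracketT_bracketT_boxPlus]
    rw [← Nat.cast_smul_eq_nsmul K, smul_eq_zero_iff_right (by norm_num), sub_eq_zero]
  unfold IsMaurerCartan
  rw [hsum, Prod.mk_eq_zero, neg_eq_zero, lof_eq_zero_iff, hP]
  exact ⟨fun h => h.2.2, fun h => ⟨tripleElement_mem μ ρ T,
    (Finset.finite_toSet _).subset hsupp, h⟩⟩

/-- On three elements of `𝔤` the square of `μ ⊞ ρ` is the Jacobiator of `μ`; on two elements of `𝔤`
and one of `V` it is the defect of `ρ` being a representation. Together these are all its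
components. -/
theorem isLieLeibnizTriple_iff_circ : IsLieLeibnizTriple μ ρ T ↔
    circ (boxPlus μ ρ) (boxPlus μ ρ) = 0 ∧ ∀ u v, μ ![T u, T v] = T (ρ (T u) v) := by
  have h : circ (boxPlus μ ρ) (boxPlus μ ρ) = 0 ↔
      (∀ x y z : 𝔤, μ ![x, μ ![y, z]] = μ ![μ ![x, y], z] + μ ![y, μ ![x, z]]) ∧
      ∀ x y : 𝔤, ρ (μ ![x, y]) = ρ x ∘ₗ ρ y - ρ y ∘ₗ ρ x := by
    rw [eq_zero_iff_evalLof_triple]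
    simp only [evalLof_circ_boxPlus, Prod.mk_eq_zero]
    constructor
    · intro h
      refine ⟨fun x y z => ?_, fun x y => LinearMap.ext fun v => ?_⟩
      · exact (sub_eq_zero.1 (h (x, 0) (y, 0) (z, 0)).1).symm
      · have := (h (x, 0) (y, 0) (0, v)).2
        rw [LinearMap.sub_apply, eq_sub_iff_add_eq]
        exact sub_eq_zero.1 this
    · rintro ⟨hj, hr⟩ a b c
      refine ⟨sub_eq_zero.2 (hj _ _ _).symm, ?_⟩
      rw [hr, LinearMap.sub_apply]
      simp
  rw [h]
  exact ⟨fun h => ⟨⟨h.jacobi, h.rep⟩, h.embedding⟩, fun h => ⟨h.1.1, h.1.2, h.2⟩⟩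

end Values

end MaurerCartan

end LieLeibniz

theorem theorem4p6 {K : Type*} [Field K] [CharZero K]
    (𝔤 : Type*) [AddCommGroup 𝔤] [Module K 𝔤] (V : Type*) [AddCommGroup V] [Module K V] :
    IsVData (cochainGrading K (𝔤 × V)) (balavoineBracket K (𝔤 × V)) (subspaceH K 𝔤 V)
      (projH K 𝔤 V) 0 ∧
    IsGradedLieSubalgebra (cochainGrading K (𝔤 × V)) (balavoineBracket K (𝔤 × V))
      (subspaceL' K 𝔤 V) ∧
    IsLInfinityAlgebra ((subspaceL' K 𝔤 V).prod (subspaceH K 𝔤 V))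
      (controllingGrading K 𝔤 V) (controllingBracket K 𝔤 V) ∧
    ∀ (μ : 𝔤 [⋀^Fin 2]→ₗ[K] 𝔤) (ρ : 𝔤 →ₗ[K] Module.End K V) (T : V →ₗ[K] 𝔤),
      IsLieLeibnizTriple μ ρ T ↔
        IsMaurerCartan (controllingGrading K 𝔤 V) (controllingBracket K 𝔤 V)
          (tripleElement μ ρ T) :=
  ⟨isVData_cochains, isGradedLieSubalgebra_subspaceL',
    isVData_cochains.isLInfinityAlgebra isGradedLieSubalgebra_subspaceL',
    fun μ ρ T => (isLieLeibnizTriple_iff_circ μ ρ T).trans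
      (isMaurerCartan_tripleElement_iff μ ρ T).symm⟩
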